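/- **Setting.** All algebras are unital over $\mathbb C$; $t\mapsto t'$ is the exchange of the factors of $A\otimes A$, and $*$ acts on $A\otimes A$ by $(\xi\otimes\eta)^*=\eta^*\otimes\xi^*$. A *ribbon Hopf-$*$-algebra* is a Hopf algebra $(A,\Delta,\epsilon,\mathcal S)$ with a conjugate-linear anti-multiplicative involution $*$ such that $\epsilon(\xi^*)=\overline{\epsilon(\xi)}$, $\Delta(\xi^*)=\Delta(\xi)^*$, $\mathcal S(\xi^*)=\mathcal S(\xi)^*$, with an invertible $R\in A\otimes A$ such that $R\Delta(\xi)=\Delta'(\xi)R$, $(\Delta\otimes id)(R)=R_{13}R_{23}$, $(id\otimes\Delta)(R)=R_{13}R_{12}$, $R^*=R^{-1}$, and with a central $v\in A$ such that, for $u=\sum\mathcal S(r^2)r^1$ with $R=\sum r^1\otimes r^2$, one has $v^2=u\,\mathcal S(u)$, $\mathcal S(v)=v$, $\epsilon(v)=1$, $v^*=v^{-1}$, $\Delta(v)=(R'R)^{-1}(v\otimes v)$. Let $\mathcal G_*$ be a semisimple ribbon Hopf-$*$-algebra. Choose in every equivalence class of its irreducible representations one unitary representation $\tau^I$ on a space $V^I=\mathbb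 C^{d_I}$ (unitary: $\tau^I(\xi^*)=\tau^I(\xi)^*$). Let $C^a[IJ|K]:V^I\otimes V^J\to V^K$, $a=1,\dots,N^{IJ}_K$, be a basis of the intertwiners, $C^a[IJ|K](\tau^I\otimes\tau^J)(\Delta(\xi))=\tau^K(\xi)C^a[IJ|K]$. Assume that there are $\kappa_I\in\mathbb C$ with $\tau^I(v)=\kappa_I^2$ and $$C^a[IJ|K]\,(\tau^I\otimes\tau^J)(R')\,C^b[IJ|L]^*=\delta_{a,b}\,\delta_{K,L}\,\frac{\kappa_I\kappa_J}{\kappa_K}.$$ Let $G$ be a finite graph without loops (for instance the 1-skeleton of a triangulated closed oriented surface) with vertex set $S$ and set $L$ of oriented links; $-i$ is the link $i$ with opposite orientation and $t(i)$ is the vertex that $i$ points to. A ciliation is given, i.e. for each $x\in S$ a linear order $<$ on the set of links $i$ with $t(i)=x$ (on a surface: the clockwise order starting from a cilium at $x$). To every $x\in S$ let there be assigned a ribbon Hopf-$*$-algebra $\mathcal G_x$ that is twist equivalent to $\mathcal G_*$: there are a $*$-isomorphism $\iota_x:\mathcal G_x\to\mathcal G_*$ and an invertible $F_x\in\mathcal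 G_*\otimes\mathcal G_*$ with $F_x^*=F_x^{-1}$, $\epsilon_x=\epsilon_*\circ\iota_x$, $\iota_x\circ\mathcal S_x=\mathcal S_*\circ\iota_x$, $(\iota_x\otimes\iota_x)(\Delta_x(\xi))=F_x^{-1}\Delta_*(\iota_x(\xi))F_x$, $(\iota_x\otimes\iota_x)(R_x)=F_x'^{-1}R_*F_x$, $\iota_x(v_x)=v_*$. Put $\mathcal G=\bigotimes_{x\in S}\mathcal G_x$, with the induced co-product $\Delta$, $R$-matrix $R=\prod_x R_x$ and $*$-operation. Put $\tau^I_x=\tau^I\circ\iota_x$ and $C^a_x[IJ|K]=C^a[IJ|K](\tau^I\otimes\tau^J)(F_x)$. For a link $i$ from $x=t(-i)$ to $y=t(i)$ let $\tau^{I,i}$ be the representation of $\mathcal G$ which is $\tau^I_y$ on $\mathcal G_y$, the contragredient $\xi\mapsto{}^t\tau^I_x(\mathcal S_x(\xi))$ on $\mathcal G_x$, and $\epsilon_z$ on the other factors. Its matrix indices are pairs $\alpha=(a_1,a_2)$ with $a_1$ belonging to the source $x$ and $a_2$ to the target $y$. Put $C^a[IJ|K]^i=C^a_y[IJ|K]\otimes{}^t(C^a_x[IJ|K]^*)$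 and $\eta^{I,i}=e_x\otimes{}^t\tau^I_y(\mathcal S_y(u_y))$, where $e_x$ is the identity. Explicitly, for $\beta=(b_1,b_2)$ an index of $-i$ (so $b_1$ belongs to $y$ and $b_2$ to $x$) and $\alpha=(a_1,a_2)$ an index of $i$, $\eta^{I,i}_{\beta\alpha}=\delta_{b_2,a_1}\,\tau^I_y(\mathcal S_y(u_y))_{a_2b_1}$. The *lattice algebra* $\mathcal B$ is the associative algebra generated by $\mathcal G$ (with its unit and its operations) and elements $U^I_\alpha(i)$, $i\in L$, subject to the following relations (sums over repeated indices): 1. (covariance) $\xi\,U^I_\alpha(i)=U^I_\beta(i)\,(\tau^{I,i}_{\beta\alpha}\otimes id)(\Delta(\xi))$ for all $\xi\in\mathcal G$; 2. (functoriality) $U^I_\alpha(i)U^J_\beta(i)=\sum_{K,a}U^K_\gamma(i)\,C^a[IJ|K]^i_{\gamma,\alpha\beta}$ and $\sum_bU^I_{ab}(i)U^I_{bc}(-i)=\delta_{a,c}$, for all $i\in L$; 3. (braid relations) $U^I_\alpha(i)U^J_\beta(j)=U^J_\gamma(j)U^I_\delta(i)\,(\tau^{I,i}_{\delta\alpha}\otimes\tau^{J,j}_{\gamma\beta})(R)$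 if $t(i)=t(j)$ and $i<j$, or if $i,j$ have no common endpoint; and for one link $i$ from $x$ to $y$ $$U^I_{ab}(i)U^J_{cd}(i)=\sum(\tau^I_x\otimes\tau^J_x)(R_x)_{ac,a'c'}\;U^J_{c'd'}(i)U^I_{a'b'}(i)\;(\tau^I_y\otimes\tau^J_y)(R_y'^{-1})_{b'd',bd}.$$ **Proposition.** There is a unique anti-homomorphism of rings $\theta:\mathcal B\to\mathcal B$ with $$\theta(\xi)=\xi^*\quad(\xi\in\mathcal G),\qquad \theta(U^I_\alpha(i))=\sum_{\beta,\gamma}U^I_\gamma(-i)\,(\tau^{I,-i}_{\gamma\beta}\otimes id)(R^{-1})\,\eta^{I,i}_{\beta\alpha},$$ for all $I$, $i\in L$ and $\alpha$ (here $\xi$ and $\xi^*$ stand for their images in $\mathcal B$), and $\theta$ is conjugate-linear. -/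

import Mathlib

open scoped TensorProduct Kronecker

noncomputable section

namespace LatticeCS

/-! ### Ribbon Hopf-*-algebras -/

section Local

/-- The exchange of the two tensor factors, `t ↦ t'`. -/
def swap {A : Type*} [Ring A] [Algebra ℂ A] : (A ⊗[ℂ] A) →ₐ[ℂ] (A ⊗[ℂ] A) :=
  (Algebra.TensorProduct.comm ℂ A A).toAlgHom

/-- `ξ ↦ ξ ⊗ 1` -/
def legL (A : Type*) [Ring A] [Algebra ℂ A] : A →ₐ[ℂ] (A ⊗[ℂ] A) :=
  Algebra.TensorProduct.includeLeft

/-- `ξ ↦ 1 ⊗ ξ` -/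
def legR (A : Type*) [Ring A] [Algebra ℂ A] : A →ₐ[ℂ] (A ⊗[ℂ] A) :=
  Algebra.TensorProduct.includeRight

/-- The conjugation on `A ⊗ A` that reverses the factors: `(ξ ⊗ η)^* = η^* ⊗ ξ^*`. -/
def flipStar {A : Type*} [Ring A] [Algebra ℂ A] [StarRing A] [StarModule ℂ A]
    (t : A ⊗[ℂ] A) : A ⊗[ℂ] A := swap (star t)

/-- The linear map `φ ⊗ id : A ⊗ A → A` for a linear functional `φ`. -/
def slice {A : Type*} [Ring A] [Algebra ℂ A] (φ : A →ₗ[ℂ] ℂ) : (A ⊗[ℂ] A) →ₗ[ℂ] A :=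
  (TensorProduct.lid ℂ A).toLinearMap ∘ₗ φ.rTensor A

/-- The linear functional `φ ⊗ ψ : A ⊗ A → ℂ` for linear functionals `φ`, `ψ`. -/
def pairing {A : Type*} [Ring A] [Algebra ℂ A] (φ ψ : A →ₗ[ℂ] ℂ) : (A ⊗[ℂ] A) →ₗ[ℂ] ℂ :=
  LinearMap.mul' ℂ ℂ ∘ₗ TensorProduct.map φ ψ

/-- The matrix element `ξ ↦ τ(ξ)_{ab}` of a matrix representation. -/
def entry {A : Type*} [Ring A] [Algebra ℂ A] {m : Type*} [Fintype m] [DecidableEq m]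
    (τ : A →ₐ[ℂ] Matrix m m ℂ) (a b : m) : A →ₗ[ℂ] ℂ :=
  (Matrix.entryLinearMap ℂ ℂ a b : Matrix m m ℂ →ₗ[ℂ] ℂ) ∘ₗ τ.toLinearMap

/-- The matrix `(τ ⊗ σ)(t)` for `t ∈ A ⊗ A`. -/
def tensorRep {A : Type*} [Ring A] [Algebra ℂ A] {m n : Type*} [Fintype m] [DecidableEq m]
    [Fintype n] [DecidableEq n] (τ : A →ₐ[ℂ] Matrix m m ℂ) (σ : A →ₐ[ℂ] Matrix n n ℂ)
    (t : A ⊗[ℂ] A) : Matrix (m × n) (m × n) ℂ :=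
  Matrix.of fun p q => pairing (entry τ p.1 q.1) (entry σ p.2 q.2) t

/-- The element `u = ∑ S(r²) r¹` built from `r = ∑ r¹ ⊗ r²`. -/
def drinfeld {A : Type*} [Ring A] [HopfAlgebra ℂ A] (r : A ⊗[ℂ] A) : A :=
  LinearMap.mul' ℂ A ((HopfAlgebra.antipode ℂ (A := A)).rTensor A (swap r))

/-- A ribbon Hopf-*-algebra: a Hopf algebra with a *-operation, an `R`-matrix and a ribbon
element.  The *-operation on `A ⊗ A` is the one that reverses the factors. -/
class RibbonHopfStar (A : Type*) [Ring A] [HopfAlgebra ℂ A] [StarRing A] [StarModule ℂ A] where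
  /-- the universal `R`-matrix -/
  R : (A ⊗[ℂ] A)ˣ
  /-- the ribbon element -/
  v : A
  counit_star : ∀ ξ : A, Coalgebra.counit (R := ℂ) (star ξ) = star (Coalgebra.counit (R := ℂ) ξ)
  comul_star : ∀ ξ : A, Coalgebra.comul (R := ℂ) (star ξ) = flipStar (Coalgebra.comul (R := ℂ) ξ)
  antipode_star : ∀ ξ : A, HopfAlgebra.antipode ℂ (star ξ) = star (HopfAlgebra.antipode ℂ ξ)
  /-- `R Δ(ξ) = Δ'(ξ) R` -/
  R_comul : ∀ ξ : A, (R : A ⊗[ℂ] A) * Coalgebra.comul (R := ℂ) ξ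
    = swap (Coalgebra.comul (R := ℂ) ξ) * (R : A ⊗[ℂ] A)
  /-- `(Δ ⊗ id)(R) = R₁₃ R₂₃` in `(A ⊗ A) ⊗ A` -/
  comul_id_R : Algebra.TensorProduct.map (Bialgebra.comulAlgHom ℂ A) (AlgHom.id ℂ A) R
    = Algebra.TensorProduct.map (legL A) (AlgHom.id ℂ A) R
      * Algebra.TensorProduct.map (legR A) (AlgHom.id ℂ A) R
  /-- `(id ⊗ Δ)(R) = R₁₃ R₁₂` in `A ⊗ (A ⊗ A)` -/
  id_comul_R : Algebra.TensorProduct.map (AlgHom.id ℂ A) (Bialgebra.comulAlgHom ℂ A) R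
    = Algebra.TensorProduct.map (AlgHom.id ℂ A) (legR A) R
      * Algebra.TensorProduct.map (AlgHom.id ℂ A) (legL A) R
  /-- unitarity `R^* = R⁻¹` -/
  R_star : flipStar (R : A ⊗[ℂ] A) = ((R⁻¹ : (A ⊗[ℂ] A)ˣ) : A ⊗[ℂ] A)
  v_central : ∀ ξ : A, v * ξ = ξ * v
  v_sq : v * v = drinfeld (R : A ⊗[ℂ] A) * HopfAlgebra.antipode ℂ (drinfeld (R : A ⊗[ℂ] A))
  antipode_v : HopfAlgebra.antipode ℂ v = v
  counit_v : Coalgebra.counit (R := ℂ) v = 1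
  v_star_mul : star v * v = 1
  v_mul_star : v * star v = 1
  /-- `Δ(v) = (R' R)⁻¹ (v ⊗ v)` -/
  comul_v : Coalgebra.comul (R := ℂ) v
    = ((R⁻¹ : (A ⊗[ℂ] A)ˣ) : A ⊗[ℂ] A) * swap ((R⁻¹ : (A ⊗[ℂ] A)ˣ) : A ⊗[ℂ] A) * (v ⊗ₜ[ℂ] v)

/-- The `R`-matrix of a ribbon Hopf-*-algebra. -/
def Rmat (A : Type*) [Ring A] [HopfAlgebra ℂ A] [StarRing A] [StarModule ℂ A]
    [RibbonHopfStar A] : (A ⊗[ℂ] A)ˣ := RibbonHopfStar.R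

/-- The ribbon element of a ribbon Hopf-*-algebra. -/
def ribbon (A : Type*) [Ring A] [HopfAlgebra ℂ A] [StarRing A] [StarModule ℂ A]
    [RibbonHopfStar A] : A := RibbonHopfStar.v

/-- A twist equivalence of the ribbon Hopf-*-algebra `A` with the ribbon Hopf-*-algebra `B`:
a *-isomorphism `ι : A → B` and a unitary `F ∈ B ⊗ B` relating the structures. -/
structure TwistEquiv (A B : Type*) [Ring A] [HopfAlgebra ℂ A] [StarRing A] [StarModule ℂ A]
    [RibbonHopfStar A] [Ring B] [HopfAlgebra ℂ B] [StarRing B] [StarModule ℂ B]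
    [RibbonHopfStar B] where
  ι : A ≃⋆ₐ[ℂ] B
  F : (B ⊗[ℂ] B)ˣ
  F_star : flipStar (F : B ⊗[ℂ] B) = ((F⁻¹ : (B ⊗[ℂ] B)ˣ) : B ⊗[ℂ] B)
  counit_eq : ∀ ξ : A, Coalgebra.counit (R := ℂ) ξ = Coalgebra.counit (R := ℂ) (ι ξ)
  antipode_eq : ∀ ξ : A, ι (HopfAlgebra.antipode ℂ ξ) = HopfAlgebra.antipode ℂ (ι ξ)
  /-- `(ι ⊗ ι)(Δ(ξ)) = F⁻¹ Δ(ι ξ) F` -/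
  comul_eq : ∀ ξ : A,
    Algebra.TensorProduct.map (ι.toAlgEquiv : A →ₐ[ℂ] B) (ι.toAlgEquiv : A →ₐ[ℂ] B)
        (Coalgebra.comul (R := ℂ) ξ)
      = ((F⁻¹ : (B ⊗[ℂ] B)ˣ) : B ⊗[ℂ] B) * Coalgebra.comul (R := ℂ) (ι ξ) * (F : B ⊗[ℂ] B)
  /-- `(ι ⊗ ι)(R) = F'⁻¹ R F` -/
  R_eq : Algebra.TensorProduct.map (ι.toAlgEquiv : A →ₐ[ℂ] B) (ι.toAlgEquiv : A →ₐ[ℂ] B)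
        (Rmat A : A ⊗[ℂ] A)
      = swap ((F⁻¹ : (B ⊗[ℂ] B)ˣ) : B ⊗[ℂ] B) * (Rmat B : B ⊗[ℂ] B) * (F : B ⊗[ℂ] B)
  ribbon_eq : ι (ribbon A) = ribbon B

end Local

/-! ### Representations -/

section Reps

/-- A matrix representation on `ℂⁿ` is irreducible if `n ≠ 0` and it has no invariant subspaces
besides `0` and `ℂⁿ`. -/
def IsIrrep {A : Type*} [Ring A] [Algebra ℂ A] {n : ℕ}
    (τ : A →ₐ[ℂ] Matrix (Fin n) (Fin n) ℂ) : Prop :=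
  n ≠ 0 ∧ ∀ p : Submodule ℂ (Fin n → ℂ),
    (∀ ξ : A, ∀ w ∈ p, Matrix.mulVec (τ ξ) w ∈ p) → p = ⊥ ∨ p = ⊤

/-- Equivalence of matrix representations, by an invertible intertwiner `T`. -/
def RepEquiv {A : Type*} [Ring A] [Algebra ℂ A] {m n : ℕ}
    (τ : A →ₐ[ℂ] Matrix (Fin m) (Fin m) ℂ) (σ : A →ₐ[ℂ] Matrix (Fin n) (Fin n) ℂ) : Prop :=
  ∃ (T : Matrix (Fin n) (Fin m) ℂ) (T' : Matrix (Fin m) (Fin n) ℂ),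
    T * T' = 1 ∧ T' * T = 1 ∧ ∀ ξ : A, T * τ ξ = σ ξ * T

/-- A choice of one unitary matrix representation in each equivalence class of irreducible
representations of `H`, with labels `I : Lab`. -/
structure UnitaryIrreps (H : Type*) [Ring H] [Algebra ℂ H] [StarRing H] (Lab : Type*) where
  dim : Lab → ℕ
  rep : ∀ I, H →⋆ₐ[ℂ] Matrix (Fin (dim I)) (Fin (dim I)) ℂ
  irrep : ∀ I, IsIrrep (rep I).toAlgHom
  label_unique : ∀ I J, RepEquiv (rep I).toAlgHom (rep J).toAlgHom → I = J
  complete : ∀ (n : ℕ) (σ : H →ₐ[ℂ] Matrix (Fin n) (Fin n) ℂ), IsIrrep σ →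
    ∃ I, RepEquiv (rep I).toAlgHom σ

variable {H : Type*} [Ring H] [HopfAlgebra ℂ H] [StarRing H] [StarModule ℂ H] [RibbonHopfStar H]
  {Lab : Type*}

/-- The underlying algebra homomorphism of `τ^I`. -/
def UnitaryIrreps.τ (ρ : UnitaryIrreps H Lab) (I : Lab) :
    H →ₐ[ℂ] Matrix (Fin (ρ.dim I)) (Fin (ρ.dim I)) ℂ := (ρ.rep I).toAlgHom

/-- Clebsch-Gordan maps `C^a[IJ|K] : V^I ⊗ V^J → V^K`, `a = 1, …, N^{IJ}_K`: for all `I, J, K` they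
form a basis of the space of intertwiners, and they are normalized with respect to square roots
`κ_I` of the values `v^I` of the ribbon element. -/
structure ClebschGordan (ρ : UnitaryIrreps H Lab) where
  /-- the fusion rules `N^{IJ}_K` -/
  N : Lab → Lab → Lab → ℕ
  C : ∀ I J K, Fin (N I J K) → Matrix (Fin (ρ.dim K)) (Fin (ρ.dim I) × Fin (ρ.dim J)) ℂ
  intertwine : ∀ I J K a (ξ : H),
    C I J K a * tensorRep (ρ.τ I) (ρ.τ J) (Coalgebra.comul (R := ℂ) ξ) = ρ.τ K ξ * C I J K a
  linearIndependent : ∀ I J K, LinearIndependent ℂ (C I J K)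
  span : ∀ I J K (T : Matrix (Fin (ρ.dim K)) (Fin (ρ.dim I) × Fin (ρ.dim J)) ℂ),
    (∀ ξ : H, T * tensorRep (ρ.τ I) (ρ.τ J) (Coalgebra.comul (R := ℂ) ξ) = ρ.τ K ξ * T) →
    T ∈ Submodule.span ℂ (Set.range (C I J K))
  κ : Lab → ℂ
  κ_sq : ∀ I, ρ.τ I (ribbon H) = (κ I ^ 2) • 1
  normalized : ∀ I J K a b,
    C I J K a * tensorRep (ρ.τ I) (ρ.τ J) (swap (Rmat H : H ⊗[ℂ] H)) * (C I J K b).conjTranspose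
      = if a = b then (κ I * κ J / κ K) • 1 else 0
  orthogonal : ∀ I J K L a b, K ≠ L →
    C I J K a * tensorRep (ρ.τ I) (ρ.τ J) (swap (Rmat H : H ⊗[ℂ] H)) * (C I J L b).conjTranspose
      = 0

/-- The contragredient representation `ξ ↦ ᵗτ(S(ξ))`. -/
def contragredient {A : Type*} [Ring A] [HopfAlgebra ℂ A] {m : Type*} [Fintype m] [DecidableEq m]
    (τ : A →ₐ[ℂ] Matrix m m ℂ) : A →ₐ[ℂ] Matrix m m ℂ :=
  AlgHom.ofLinearMap
    ((Matrix.transposeLinearEquiv m m ℂ ℂ).toLinearMap ∘ₗ τ.toLinearMap ∘ₗ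
      HopfAlgebra.antipode ℂ)
    (by simp)
    (fun ξ ζ => by simp [HopfAlgebra.antipode_mul_antidistrib, Matrix.transpose_mul])

end Reps

/-! ### The algebra of gauge transformations `𝒢 = ⨂ₓ 𝒢ₓ` -/

section PiTensor

variable {V : Type*} {A : V → Type*} [∀ x, Ring (A x)] [∀ x, Algebra ℂ (A x)]

open Classical in
/-- The inclusion of the factor at `x` in a tensor product of algebras. -/
def single (x : V) : A x →ₐ[ℂ] (⨂[ℂ] y, A y) := PiTensorProduct.singleAlgHom x

theorem commute_single {x y : V} (h : x ≠ y) (a : A x) (b : A y) :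
    Commute (single (A := A) x a) (single y b) := by
  classical
  unfold single
  simp only [PiTensorProduct.singleAlgHom_apply]
  exact Commute.tprod (Pi.mulSingle_commute h a b)

open Classical in
/-- Algebra homomorphisms `fₓ : Aₓ → D` with pairwise commuting images induce an algebra
homomorphism `⨂ₓ Aₓ → D`, `⊗ₓ aₓ ↦ ∏ₓ fₓ(aₓ)`. -/
def piLift [Fintype V] {D : Type*} [Ring D] [Algebra ℂ D] (f : ∀ x, A x →ₐ[ℂ] D)
    (comm : Pairwise fun x y => ∀ (a : A x) (b : A y), Commute (f x a) (f y b)) :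
    (⨂[ℂ] x, A x) →ₐ[ℂ] D :=
  have comm' : Pairwise fun x y => ∀ (a : A x) (b : A y),
      Commute ((f x : A x →* D) a) ((f y : A y →* D) b) := comm
  have key : ∀ [DecidableEq V] (m : ∀ x, A x) (x : V) (a : A x),
      MonoidHom.noncommPiCoprod (fun x => (f x : A x →* D)) comm' (Function.update m x a)
        = MonoidHom.noncommPiCoprod (fun x => (f x : A x →* D)) comm' (Function.update m x 1)
          * f x a := by
    intro inst m x a
    obtain rfl : inst = Classical.decEq V := Subsingleton.elim _ _
    have h : Function.update m x a = Function.update m x 1 * Pi.mulSingle x a := by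
      ext y
      by_cases hy : y = x
      · subst hy; simp
      · simp [hy]
    rw [h, map_mul]
    congr 1
    exact MonoidHom.noncommPiCoprod_mulSingle _ _ _
  PiTensorProduct.liftAlgHom
    { toFun := MonoidHom.noncommPiCoprod (fun x => (f x : A x →* D)) comm'
      map_update_add' := by
        intro _ m x a b
        rw [key m x (a + b), key m x a, key m x b, map_add, mul_add]
      map_update_smul' := by
        intro _ m x c a
        rw [key m x (c • a), key m x a, map_smul, mul_smul_comm] }
    (map_one (MonoidHom.noncommPiCoprod (fun x => (f x : A x →* D)) comm'))
    (map_mul (MonoidHom.noncommPiCoprod (fun x => (f x : A x →* D)) comm'))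

/-- `piLift f` restricts to `fₓ` on the factor at `x`. -/
theorem piLift_single [Fintype V] {D : Type*} [Ring D] [Algebra ℂ D] (f : ∀ x, A x →ₐ[ℂ] D)
    (comm : Pairwise fun x y => ∀ (a : A x) (b : A y), Commute (f x a) (f y b)) (x : V) (a : A x) :
    piLift f comm (single x a) = f x a := by
  classical
  unfold piLift single
  rw [PiTensorProduct.singleAlgHom_apply, PiTensorProduct.liftAlgHom_apply,
    PiTensorProduct.lift.tprod]
  exact MonoidHom.noncommPiCoprod_mulSingle (fun x => (f x : A x →* D)) (hcomm := comm) x a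

/-- The *-operation on `⨂ₓ Aₓ`: the conjugate-linear map with `(⊗ₓ aₓ)^* = ⊗ₓ aₓ^*`. -/
def piStar [∀ x, StarRing (A x)] [∀ x, StarModule ℂ (A x)] :
    (⨂[ℂ] x, A x) →+ (⨂[ℂ] x, A x) :=
  PiTensorProduct.liftAddHom
    (fun p => star p.1 • PiTensorProduct.tprod ℂ (fun x => star (p.2 x)))
    (fun r f x hf => by
      have h : (fun y => star (f y)) x = 0 := by simp [hf]
      rw [MultilinearMap.map_coord_zero _ x h, smul_zero])
    (fun f => by simp)
    (fun r f x a b => by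
      have h : ∀ c : A x, (fun y => star (Function.update f x c y))
          = Function.update (fun y => star (f y)) x (star c) := by
        intro c
        ext y
        by_cases hy : y = x
        · subst hy; simp
        · simp [hy]
      simp only [h, star_add, MultilinearMap.map_update_add, smul_add])
    (fun r r' f => by simp [add_smul])
    (fun r f x c => by
      have h : ∀ c : A x, (fun y => star (Function.update f x c y))
          = Function.update (fun y => star (f y)) x (star c) := by
        intro c
        ext y
        by_cases hy : y = x
        · subst hy; simp
        · simp [hy]
      simp only [h, star_smul, MultilinearMap.map_update_smul, Function.update_eq_self,
        smul_smul, star_mul', mul_comm])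

theorem piStar_smul_tprod [∀ x, StarRing (A x)] [∀ x, StarModule ℂ (A x)] (c : ℂ)
    (a : ∀ x, A x) : piStar (c • PiTensorProduct.tprod ℂ a)
      = star c • PiTensorProduct.tprod ℂ (fun x => star (a x)) := by
  rw [← PiTensorProduct.tprodCoeff_eq_smul_tprod]
  rfl

end PiTensor

section Gauge

variable {V : Type*} (𝒢 : V → Type*) [∀ x, Ring (𝒢 x)] [∀ x, HopfAlgebra ℂ (𝒢 x)]

/-- The algebra `𝒢 = ⨂ₓ 𝒢ₓ` of gauge transformations. -/
abbrev Gauge : Type _ := ⨂[ℂ] x, 𝒢 x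

/-- The inclusion `𝒢ₓ ⊗ 𝒢ₓ → 𝒢 ⊗ 𝒢`. -/
def single₂ (x : V) : (𝒢 x ⊗[ℂ] 𝒢 x) →ₐ[ℂ] (Gauge 𝒢 ⊗[ℂ] Gauge 𝒢) :=
  Algebra.TensorProduct.map (single x) (single x)

theorem commute_single₂ {x y : V} (h : x ≠ y) (s : 𝒢 x ⊗[ℂ] 𝒢 x) (t : 𝒢 y ⊗[ℂ] 𝒢 y) :
    Commute (single₂ 𝒢 x s) (single₂ 𝒢 y t) := by
  induction s using TensorProduct.induction_on with
  | zero => rw [map_zero]; exact Commute.zero_left _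
  | add s₁ s₂ h₁ h₂ => rw [map_add]; exact h₁.add_left h₂
  | tmul a b =>
    induction t using TensorProduct.induction_on with
    | zero => rw [map_zero]; exact Commute.zero_right _
    | add s₁ s₂ h₁ h₂ => rw [map_add]; exact h₁.add_right h₂
    | tmul c d =>
      simp only [single₂, Algebra.TensorProduct.map_tmul, Commute, SemiconjBy,
        Algebra.TensorProduct.tmul_mul_tmul, (commute_single h a c).eq, (commute_single h b d).eq]

/-- The co-product `Δ` of `𝒢`, induced by the co-products of the factors. -/
def gaugeComul [Fintype V] : Gauge 𝒢 →ₐ[ℂ] (Gauge 𝒢 ⊗[ℂ] Gauge 𝒢) :=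
  piLift (fun x => (single₂ 𝒢 x).comp (Bialgebra.comulAlgHom ℂ (𝒢 x)))
    (fun _ _ h _ _ => commute_single₂ 𝒢 h _ _)

/-- The `R`-matrix of `𝒢`, the product of the commuting `R`-matrices of the factors. -/
def gaugeR [Fintype V] [∀ x, StarRing (𝒢 x)] [∀ x, StarModule ℂ (𝒢 x)] [∀ x, RibbonHopfStar (𝒢 x)] :
    (Gauge 𝒢 ⊗[ℂ] Gauge 𝒢)ˣ :=
  Finset.univ.noncommProd
    (fun x => Units.map (single₂ 𝒢 x : (𝒢 x ⊗[ℂ] 𝒢 x) →* (Gauge 𝒢 ⊗[ℂ] Gauge 𝒢)) (Rmat (𝒢 x)))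
    (fun _ _ _ _ h => Units.ext (commute_single₂ 𝒢 h _ _).eq)

end Gauge

/-! ### Ciliated graphs and the representations on links -/

/-- A ciliated graph with vertex set `V`, set of oriented links `L` and no loops: `rev i` is the
link `i` with opposite orientation (written `-i`), `target i` the vertex that `i` points to.  The
cyclic order of the links pointing to a vertex `x`, cut open at the cilium of `x`, is a strict
linear order on the set of these links, `lt i j` meaning that `i` comes before `j` (clockwise). -/
structure CiliatedGraph (V L : Type*) where
  rev : L → L
  rev_rev : ∀ i, rev (rev i) = i
  target : L → V
  no_loop : ∀ i, target (rev i) ≠ target i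
  lt : L → L → Prop
  lt_target : ∀ i j, lt i j → target i = target j
  lt_irrefl : ∀ i, ¬ lt i i
  lt_trans : ∀ i j k, lt i j → lt j k → lt i k
  lt_total : ∀ i j, target i = target j → i = j ∨ lt i j ∨ lt j i

namespace CiliatedGraph

variable {V L : Type*} (Γ : CiliatedGraph V L)

/-- The vertex at which a link starts. -/
def source (i : L) : V := Γ.target (Γ.rev i)

/-- The links `i` and `j` have no common endpoint. -/
def NoCommonEnd (i j : L) : Prop :=
  Γ.target i ≠ Γ.target j ∧ Γ.target i ≠ Γ.source j ∧
    Γ.source i ≠ Γ.target j ∧ Γ.source i ≠ Γ.source j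

end CiliatedGraph

section Links

/-- `M ↦ M ⊗ 1` -/
def kronLeft (n : ℕ) :
    Matrix (Fin n) (Fin n) ℂ →ₐ[ℂ] Matrix (Fin n × Fin n) (Fin n × Fin n) ℂ where
  toFun M := M ⊗ₖ 1
  map_one' := by simp
  map_zero' := by simp
  map_add' M M' := by simp [Matrix.add_kronecker]
  map_mul' M M' := by simp [← Matrix.mul_kronecker_mul]
  commutes' c := by simp [Algebra.algebraMap_eq_smul_one, Matrix.smul_kronecker]

/-- `M ↦ 1 ⊗ M` -/
def kronRight (n : ℕ) :
    Matrix (Fin n) (Fin n) ℂ →ₐ[ℂ] Matrix (Fin n × Fin n) (Fin n × Fin n) ℂ where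
  toFun M := 1 ⊗ₖ M
  map_one' := by simp
  map_zero' := by simp
  map_add' M M' := by simp [Matrix.kronecker_add]
  map_mul' M M' := by simp [← Matrix.mul_kronecker_mul]
  commutes' c := by simp [Algebra.algebraMap_eq_smul_one, Matrix.kronecker_smul]

theorem kronLeft_apply (n : ℕ) (M : Matrix (Fin n) (Fin n) ℂ) : kronLeft n M = M ⊗ₖ 1 := rfl

theorem kronRight_apply (n : ℕ) (M : Matrix (Fin n) (Fin n) ℂ) : kronRight n M = 1 ⊗ₖ M := rfl

theorem commute_kron (n : ℕ) (M M' : Matrix (Fin n) (Fin n) ℂ) :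
    Commute (kronLeft n M) (kronRight n M') := by
  simp only [Commute, SemiconjBy, kronLeft_apply, kronRight_apply, ← Matrix.mul_kronecker_mul,
    one_mul, mul_one]

/-- The representation `ξ ↦ ε(ξ) 1` by scalars. -/
def counitRep (A D : Type*) [Ring A] [HopfAlgebra ℂ A] [Ring D] [Algebra ℂ D] : A →ₐ[ℂ] D :=
  (Algebra.ofId ℂ D).comp (Bialgebra.counitAlgHom ℂ A)

theorem commute_counitRep (A D : Type*) [Ring A] [HopfAlgebra ℂ A] [Ring D] [Algebra ℂ D]
    (a : A) (d : D) : Commute (counitRep A D a) d :=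
  Algebra.commute_algebraMap_left (Bialgebra.counitAlgHom ℂ A a) d

variable {V L : Type*} {𝒢 : V → Type*} [∀ x, Ring (𝒢 x)] [∀ x, HopfAlgebra ℂ (𝒢 x)]
  [∀ x, StarRing (𝒢 x)] [∀ x, StarModule ℂ (𝒢 x)] [∀ x, RibbonHopfStar (𝒢 x)]
  {H : Type*} [Ring H] [HopfAlgebra ℂ H] [StarRing H] [StarModule ℂ H] [RibbonHopfStar H]
  {Lab : Type*}

/-- The representation `τ^I_x = τ^I ∘ ι_x` of `𝒢ₓ`. -/
def vertexRep (T : ∀ x, TwistEquiv (𝒢 x) H) (ρ : UnitaryIrreps H Lab) (I : Lab) (x : V) :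
    𝒢 x →ₐ[ℂ] Matrix (Fin (ρ.dim I)) (Fin (ρ.dim I)) ℂ :=
  (ρ.τ I).comp ((T x).ι.toAlgEquiv : 𝒢 x →ₐ[ℂ] H)

/-- The Clebsch-Gordan maps `C^a_x[IJ|K] = C^a[IJ|K] (τ^I ⊗ τ^J)(F_x)` of `𝒢ₓ`. -/
def vertexCG (T : ∀ x, TwistEquiv (𝒢 x) H) {ρ : UnitaryIrreps H Lab} (cg : ClebschGordan ρ)
    (I J K : Lab) (a : Fin (cg.N I J K)) (x : V) :
    Matrix (Fin (ρ.dim K)) (Fin (ρ.dim I) × Fin (ρ.dim J)) ℂ :=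
  cg.C I J K a * tensorRep (ρ.τ I) (ρ.τ J) ((T x).F : H ⊗[ℂ] H)

/-- The local part at the vertex `z` of the representation `τ^{I,i}`. Its carrier space has the
index set `Fin dim × Fin dim`; the first index belongs to the source of `i`, the second one to the
target of `i`. -/
def linkRepAt (Γ : CiliatedGraph V L) (T : ∀ x, TwistEquiv (𝒢 x) H) (ρ : UnitaryIrreps H Lab)
    (I : Lab) (i : L) (z : V) :
    𝒢 z →ₐ[ℂ] Matrix (Fin (ρ.dim I) × Fin (ρ.dim I)) (Fin (ρ.dim I) × Fin (ρ.dim I)) ℂ :=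
  open Classical in
  if z = Γ.target i then (kronRight _).comp (vertexRep T ρ I z)
  else if z = Γ.source i then (kronLeft _).comp (contragredient (vertexRep T ρ I z))
  else counitRep (𝒢 z) _

theorem commute_linkRepAt (Γ : CiliatedGraph V L) (T : ∀ x, TwistEquiv (𝒢 x) H)
    (ρ : UnitaryIrreps H Lab) (I : Lab) (i : L) :
    Pairwise fun z w => ∀ (a : 𝒢 z) (b : 𝒢 w),
      Commute (linkRepAt Γ T ρ I i z a) (linkRepAt Γ T ρ I i w b) := by
  intro z w h a b
  by_cases h₁ : z = Γ.target i
  · have h₂ : w ≠ Γ.target i := fun e => h (h₁.trans e.symm)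
    by_cases h₃ : w = Γ.source i
    · simp only [linkRepAt, if_pos h₁, if_neg h₂, if_pos h₃]
      exact (commute_kron _ _ _).symm
    · simp only [linkRepAt, if_neg h₂, if_neg h₃]
      exact (commute_counitRep _ _ _ _).symm
  · by_cases h₂ : z = Γ.source i
    · have h₃ : w ≠ Γ.source i := fun e => h (h₂.trans e.symm)
      by_cases h₄ : w = Γ.target i
      · simp only [linkRepAt, if_neg h₁, if_pos h₂, if_pos h₄]
        exact commute_kron _ _ _
      · simp only [linkRepAt, if_neg h₃, if_neg h₄]
        exact (commute_counitRep _ _ _ _).symm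
    · simp only [linkRepAt, if_neg h₁, if_neg h₂]
      exact commute_counitRep _ _ _ _

/-- The representation `τ^{I,i}` of `𝒢` assigned to the link `i`: it is `τ^I_y` on `𝒢_y` for the
target `y`, the contragredient of `τ^I_x` on `𝒢ₓ` for the source `x`, and the co-unit on the other
factors. -/
def linkRep [Fintype V] (Γ : CiliatedGraph V L) (T : ∀ x, TwistEquiv (𝒢 x) H)
    (ρ : UnitaryIrreps H Lab) (I : Lab) (i : L) :
    Gauge 𝒢 →ₐ[ℂ] Matrix (Fin (ρ.dim I) × Fin (ρ.dim I)) (Fin (ρ.dim I) × Fin (ρ.dim I)) ℂ :=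
  piLift (linkRepAt Γ T ρ I i) (commute_linkRepAt Γ T ρ I i)

/-- The matrix elements of `C^a[IJ|K]^i = C^a_y[IJ|K] ⊗ ᵗ(C^a_x[IJ|K]^*)` for a link `i` from `x`
to `y`; row `γ`, column `(α, β)`. -/
def linkCG (Γ : CiliatedGraph V L) (T : ∀ x, TwistEquiv (𝒢 x) H) {ρ : UnitaryIrreps H Lab}
    (cg : ClebschGordan ρ) (I J K : Lab) (a : Fin (cg.N I J K)) (i : L)
    (γ : Fin (ρ.dim K) × Fin (ρ.dim K)) (α : Fin (ρ.dim I) × Fin (ρ.dim I))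
    (β : Fin (ρ.dim J) × Fin (ρ.dim J)) : ℂ :=
  (vertexCG T cg I J K a (Γ.source i)).conjTranspose.transpose γ.1 (α.1, β.1)
    * vertexCG T cg I J K a (Γ.target i) γ.2 (α.2, β.2)

/-- The matrix elements of `η^{I,i} = e_x ⊗ ᵗη_y`, `η_y = τ^I_y(S_y(u_y))`, for a link `i` from `x`
to `y`.  The row index `β` belongs to the link `-i` (from `y` to `x`), the column index `α` to the
link `i`. -/
def linkEta (Γ : CiliatedGraph V L) (T : ∀ x, TwistEquiv (𝒢 x) H) (ρ : UnitaryIrreps H Lab)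
    (I : Lab) (i : L) (β α : Fin (ρ.dim I) × Fin (ρ.dim I)) : ℂ :=
  (1 : Matrix (Fin (ρ.dim I)) (Fin (ρ.dim I)) ℂ) β.2 α.1
    * (vertexRep T ρ I (Γ.target i) (HopfAlgebra.antipode ℂ
        (drinfeld (Rmat (𝒢 (Γ.target i)) : 𝒢 (Γ.target i) ⊗[ℂ] 𝒢 (Γ.target i))))).transpose β.1 α.2

end Links

/-! ### The lattice algebra -/

section LatticeAlgebra

/-- The generators of the lattice algebra: the elements `ξ` of the gauge algebra `G` and the
symbols `U^I_α(i)`, `α = (α.1, α.2)` with `α.1` belonging to the source and `α.2` to the target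
of `i`. -/
inductive Gen (G L Lab : Type*) (dim : Lab → ℕ)
  | gauge (ξ : G) : Gen G L Lab dim
  | hol (I : Lab) (i : L) (α : Fin (dim I) × Fin (dim I)) : Gen G L Lab dim

variable {V L : Type*} [Fintype V] {𝒢 : V → Type*} [∀ x, Ring (𝒢 x)] [∀ x, HopfAlgebra ℂ (𝒢 x)]
  [∀ x, StarRing (𝒢 x)] [∀ x, StarModule ℂ (𝒢 x)] [∀ x, RibbonHopfStar (𝒢 x)]
  {H : Type*} [Ring H] [HopfAlgebra ℂ H] [StarRing H] [StarModule ℂ H] [RibbonHopfStar H]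
  {Lab : Type*} [Fintype Lab]
  (Γ : CiliatedGraph V L) (T : ∀ x, TwistEquiv (𝒢 x) H) {ρ : UnitaryIrreps H Lab}

/-- The free algebra on the generators of the lattice algebra. -/
abbrev FreeLattice (𝒢 : V → Type*) [∀ x, Ring (𝒢 x)] [∀ x, HopfAlgebra ℂ (𝒢 x)] (L : Type*)
    (ρ : UnitaryIrreps H Lab) : Type _ :=
  FreeAlgebra ℂ (Gen (Gauge 𝒢) L Lab ρ.dim)

/-- The generator `ξ ∈ 𝒢` of the free algebra. -/
def fξ (ρ : UnitaryIrreps H Lab) (ξ : Gauge 𝒢) : FreeLattice 𝒢 L ρ := FreeAlgebra.ι ℂ (Gen.gauge ξ)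

/-- The generator `U^I_α(i)` of the free algebra. -/
def fU (𝒢 : V → Type*) [∀ x, Ring (𝒢 x)] [∀ x, HopfAlgebra ℂ (𝒢 x)] (ρ : UnitaryIrreps H Lab)
    (I : Lab) (i : L) (α : Fin (ρ.dim I) × Fin (ρ.dim I)) : FreeLattice 𝒢 L ρ :=
  FreeAlgebra.ι ℂ (Gen.hol I i α)

/-- The defining relations of the lattice algebra. -/
inductive Rel (cg : ClebschGordan ρ) : FreeLattice 𝒢 L ρ → FreeLattice 𝒢 L ρ → Prop
  /- `𝒢` is a unital subalgebra -/
  | gauge_scalar (c : ℂ) : Rel cg (fξ ρ (algebraMap ℂ (Gauge 𝒢) c)) (algebraMap ℂ _ c)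
  | gauge_add (ξ ζ : Gauge 𝒢) : Rel cg (fξ ρ (ξ + ζ)) (fξ ρ ξ + fξ ρ ζ)
  | gauge_mul (ξ ζ : Gauge 𝒢) : Rel cg (fξ ρ (ξ * ζ)) (fξ ρ ξ * fξ ρ ζ)
  /- covariance: `ξ U^I_α(i) = ∑_β U^I_β(i) (τ^{I,i}_{βα} ⊗ id)(Δ(ξ))` -/
  | covariance (ξ : Gauge 𝒢) (I : Lab) (i : L) (α : Fin (ρ.dim I) × Fin (ρ.dim I)) :
      Rel cg (fξ ρ ξ * fU 𝒢 ρ I i α)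
        (∑ β, fU 𝒢 ρ I i β * fξ ρ (slice (entry (linkRep Γ T ρ I i) β α) (gaugeComul 𝒢 ξ)))
  /- functoriality: `U^I_α(i) U^J_β(i) = ∑ U^K_γ(i) C^a[IJ|K]^i_{γ,αβ}` -/
  | functoriality (I J : Lab) (i : L) (α : Fin (ρ.dim I) × Fin (ρ.dim I))
      (β : Fin (ρ.dim J) × Fin (ρ.dim J)) :
      Rel cg (fU 𝒢 ρ I i α * fU 𝒢 ρ J i β)
        (∑ K, ∑ a : Fin (cg.N I J K), ∑ γ, linkCG Γ T cg I J K a i γ α β • fU 𝒢 ρ K i γ)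
  /- functoriality: `∑_b U^I_{ab}(i) U^I_{bc}(-i) = δ_{ac}` -/
  | inverse (I : Lab) (i : L) (a c : Fin (ρ.dim I)) :
      Rel cg (∑ b, fU 𝒢 ρ I i (a, b) * fU 𝒢 ρ I (Γ.rev i) (b, c)) (if a = c then 1 else 0)
  /- braid relations for `i < j`, and for `i`, `j` without common endpoints:
  `U^I_α(i) U^J_β(j) = ∑ U^J_γ(j) U^I_δ(i) (τ^{I,i}_{δα} ⊗ τ^{J,j}_{γβ})(R)` -/
  | braid (I J : Lab) (i j : L) (h : Γ.lt i j ∨ Γ.NoCommonEnd i j)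
      (α : Fin (ρ.dim I) × Fin (ρ.dim I)) (β : Fin (ρ.dim J) × Fin (ρ.dim J)) :
      Rel cg (fU 𝒢 ρ I i α * fU 𝒢 ρ J j β)
        (∑ γ, ∑ δ, pairing (entry (linkRep Γ T ρ I i) δ α) (entry (linkRep Γ T ρ J j) γ β)
            (gaugeR 𝒢 : Gauge 𝒢 ⊗[ℂ] Gauge 𝒢) • (fU 𝒢 ρ J j γ * fU 𝒢 ρ I i δ))
  /- braid relations for `i = j`, a link from `x` to `y`: `U₁ U₂ = R_x U₂ U₁ R_y'⁻¹` with
  `U₁ = U^I(i)`, `U₂ = U^J(i)` -/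
  | braid_self (I J : Lab) (i : L) (a b : Fin (ρ.dim I)) (c d : Fin (ρ.dim J)) :
      Rel cg (fU 𝒢 ρ I i (a, b) * fU 𝒢 ρ J i (c, d))
        (∑ a', ∑ b', ∑ c', ∑ d',
          (tensorRep (vertexRep T ρ I (Γ.source i)) (vertexRep T ρ J (Γ.source i))
              (Rmat (𝒢 (Γ.source i)) : 𝒢 (Γ.source i) ⊗[ℂ] 𝒢 (Γ.source i)) (a, c) (a', c')
            * tensorRep (vertexRep T ρ I (Γ.target i)) (vertexRep T ρ J (Γ.target i))
              (swap (((Rmat (𝒢 (Γ.target i)))⁻¹ : (𝒢 (Γ.target i) ⊗[ℂ] 𝒢 (Γ.target i))ˣ) :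
                𝒢 (Γ.target i) ⊗[ℂ] 𝒢 (Γ.target i))) (b', d') (b, d))
            • (fU 𝒢 ρ J i (c', d') * fU 𝒢 ρ I i (a', b')))

/-- The lattice algebra `ℬ`. -/
abbrev LatticeAlg (cg : ClebschGordan ρ) : Type _ := RingQuot (Rel Γ T cg)

variable (cg : ClebschGordan ρ)

/-- The homomorphism `𝒢 → ℬ`. -/
def ofGauge : Gauge 𝒢 →ₐ[ℂ] LatticeAlg Γ T cg where
  toFun ξ := RingQuot.mkAlgHom ℂ (Rel Γ T cg) (fξ ρ ξ)
  map_one' := by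
    have h := RingQuot.mkAlgHom_rel ℂ (Rel.gauge_scalar (Γ := Γ) (T := T) (cg := cg) 1)
    simpa using h
  map_zero' := by
    have h := RingQuot.mkAlgHom_rel ℂ (Rel.gauge_scalar (Γ := Γ) (T := T) (cg := cg) 0)
    simpa using h
  map_add' ξ ζ := by
    rw [RingQuot.mkAlgHom_rel ℂ (Rel.gauge_add (Γ := Γ) (T := T) (cg := cg) ξ ζ), map_add]
  map_mul' ξ ζ := by
    rw [RingQuot.mkAlgHom_rel ℂ (Rel.gauge_mul (Γ := Γ) (T := T) (cg := cg) ξ ζ), map_mul]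
  commutes' c := by
    rw [RingQuot.mkAlgHom_rel ℂ (Rel.gauge_scalar (Γ := Γ) (T := T) (cg := cg) c),
      AlgHom.commutes]

/-- The generator `U^I_α(i)` of `ℬ`. -/
def hol (I : Lab) (i : L) (α : Fin (ρ.dim I) × Fin (ρ.dim I)) : LatticeAlg Γ T cg :=
  RingQuot.mkAlgHom ℂ (Rel Γ T cg) (fU 𝒢 ρ I i α)

/-- The anti-homomorphism `θ : ℬ → ℬ` satisfies `θ(ξ) = ξ^*` for `ξ ∈ 𝒢` and
`θ(U^I_α(i)) = ∑ U^I_γ(-i) (τ^{I,-i}_{γβ} ⊗ id)(R⁻¹) η^{I,i}_{βα}`. -/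
def IsTheta (θ : LatticeAlg Γ T cg →+* (LatticeAlg Γ T cg)ᵐᵒᵖ) : Prop :=
  (∀ ξ : Gauge 𝒢, θ (ofGauge Γ T cg ξ) = MulOpposite.op (ofGauge Γ T cg (piStar ξ))) ∧
  ∀ (I : Lab) (i : L) (α : Fin (ρ.dim I) × Fin (ρ.dim I)),
    θ (hol Γ T cg I i α) = MulOpposite.op (∑ γ, ∑ β, linkEta Γ T ρ I i β α •
      (hol Γ T cg I (Γ.rev i) γ * ofGauge Γ T cg
        (slice (entry (linkRep Γ T ρ I (Γ.rev i)) γ β)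
          (((gaugeR 𝒢)⁻¹ : (Gauge 𝒢 ⊗[ℂ] Gauge 𝒢)ˣ) : Gauge 𝒢 ⊗[ℂ] Gauge 𝒢))))

end LatticeAlgebra

end LatticeCS
end

/-! Let w = 𝒮(u), and let U^*(i) be the row prescribed for θ(U(i)), called `starHol` below.
Uniqueness holds because ξ and U(i) generate ℬ and θ(ξ) = ξ^* already forces conjugate-linearity on
scalars. For existence, the free algebra is mapped semilinearly to ℬᵒᵖ, and each defining relation
has to be verified for the rows U^*(i) with all products reversed.

Three mechanisms carry the verification. First, dressing a covariant row U by (τ ⊗ id)(R⁻¹) is well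
behaved: ξ passes through the dressed row with Δ' in place of Δ (`mul_vecMul_dress`). A product of
dressed rows is the product row dressed through Δ, times a scalar matrix (τ ⊗ σ)(R⁻¹)
(`rowMul_dress`); the reason is the cocycle identity for R⁻¹, an inverted form of the Yang-Baxter
equation. Second, η carries the complex conjugate of τ^{I,i}(ξ) to τ^{I,-i}(𝒮(ξ^*)) on each tensor
factor (`etaMat_conj`). Third, a w = w 𝒮²(a) and R'RΔ(w) = w ⊗ w (`mul_antipodeDrinfeld`,
`comul_antipodeDrinfeld`).

Covariance then reduces to ∑ ξ₍₂₎𝒮(ξ₍₃₎) ⊗ ξ₍₁₎ = 1 ⊗ ξ. Functoriality reduces to an identity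
between the Clebsch-Gordan maps for JI and IJ (`linkCGMat_etaMat`). Its source is that C^a[JI|K]R⁻¹P
and C^b[IJ|K] span the same intertwiners and have the same normalization, hence differ by a unitary
matrix, so that ∑ C^* ⊗ C is the same for both (`braidedCG_sum`). In the inverse relation the two
factors η supply a w at each end of the link, which cancels the remaining R⁻¹; evaluation is an
intertwiner, so the dressing acts through the co-unit.

For the braid relations, the exchange relation of -i and -j is found by inverting the matrices U(i),
U(j), and `flipRow_rowMul_dress` transports it to the dressed rows. For a single link the braid
matrix is the image of R(R_y'R_y)⁻¹, and R_y'R_y commutes with the image of Δ. -/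

open scoped TensorProduct Kronecker

noncomputable section

namespace LatticeCS

/-! ### The antipode and the co-product -/

section HopfAntipode

variable {A : Type*} [Ring A] [HopfAlgebra ℂ A]

/-- The map `𝒮 ⊗ 𝒮`. -/
def antipode₂ (A : Type*) [Ring A] [HopfAlgebra ℂ A] : (A ⊗[ℂ] A) →ₗ[ℂ] (A ⊗[ℂ] A) :=
  TensorProduct.map (HopfAlgebra.antipode ℂ) (HopfAlgebra.antipode ℂ)

@[simp] theorem antipode₂_tmul (a b : A) : antipode₂ A (a ⊗ₜ b)
    = HopfAlgebra.antipode ℂ a ⊗ₜ HopfAlgebra.antipode ℂ b := rfl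

@[simp] theorem swap_tmul {A : Type*} [Ring A] [Algebra ℂ A] (a b : A) :
    swap (a ⊗ₜ[ℂ] b) = b ⊗ₜ a := rfl

@[simp] theorem swap_swap {A : Type*} [Ring A] [Algebra ℂ A] (t : A ⊗[ℂ] A) :
    swap (swap t) = t := by
  induction t using TensorProduct.induction_on with
  | zero => simp
  | tmul a b => simp
  | add s t hs ht => simp [hs, ht]

theorem antipode₂_mul (s t : A ⊗[ℂ] A) : antipode₂ A (s * t) = antipode₂ A t * antipode₂ A s := by
  induction s using TensorProduct.induction_on with
  | zero => simp
  | add s s' hs hs' => simp [add_mul, mul_add, hs, hs']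
  | tmul a b =>
    induction t using TensorProduct.induction_on with
    | zero => simp
    | add s s' hs hs' => simp [add_mul, mul_add, hs, hs']
    | tmul c d => simp [HopfAlgebra.antipode_mul_antidistrib]

theorem antipode₂_one : antipode₂ A 1 = 1 := by
  simp [Algebra.TensorProduct.one_def]

theorem antipode₂_swap (t : A ⊗[ℂ] A) : antipode₂ A (swap t) = swap (antipode₂ A t) := by
  induction t using TensorProduct.induction_on with
  | zero => simp
  | tmul a b => simp
  | add s t hs ht => simp [hs, ht]

-- Both sides are convolution inverses of Δ in Hom(A, A ⊗ A). For the right-hand side this is seen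
-- by writing Δ as the convolution product of ξ ↦ ξ ⊗ 1 and ξ ↦ 1 ⊗ ξ and inverting the factors in
-- reverse order.
open LinearMap WithConv in
theorem comul_antipode (a : A) : Coalgebra.comul (R := ℂ) (HopfAlgebra.antipode ℂ a)
    = antipode₂ A (swap (Coalgebra.comul (R := ℂ) a)) := by
  let S : A →ₗ[ℂ] A := HopfAlgebra.antipode ℂ
  let l₁ : A →ₗ[ℂ] A ⊗[ℂ] A := (legL A).toLinearMap
  let l₂ : A →ₗ[ℂ] A ⊗[ℂ] A := (legR A).toLinearMap
  have e₁ : toConv (l₁ ∘ₗ S) * toConv l₁ = 1 := by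
    ext b
    have h := HopfAlgebra.sum_antipode_mul_eq_algebraMap_counit (R := ℂ) (Coalgebra.Repr.arbitrary ℂ b)
    rw [(Coalgebra.Repr.arbitrary ℂ b).convMul_apply]
    simpa [l₁, S, map_sum] using congrArg (legL A) h
  have e₂ : toConv (l₂ ∘ₗ S) * toConv l₂ = 1 := by
    ext b
    have h := HopfAlgebra.sum_antipode_mul_eq_algebraMap_counit (R := ℂ) (Coalgebra.Repr.arbitrary ℂ b)
    rw [(Coalgebra.Repr.arbitrary ℂ b).convMul_apply]
    simpa [l₂, S, map_sum] using congrArg (legR A) h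
  have e₃ : toConv l₁ * toConv l₂ = toConv (Coalgebra.comul (R := ℂ) (A := A)) := by
    ext b
    rw [(Coalgebra.Repr.arbitrary ℂ b).convMul_apply, ← (Coalgebra.Repr.arbitrary ℂ b).eq]
    simp [l₁, l₂, legL, legR]
  have e₄ : toConv (l₂ ∘ₗ S) * toConv (l₁ ∘ₗ S)
      = toConv (antipode₂ A ∘ₗ (swap (A := A)).toLinearMap ∘ₗ Coalgebra.comul (R := ℂ) (A := A)) := by
    ext b
    rw [(Coalgebra.Repr.arbitrary ℂ b).convMul_apply]
    simp [← (Coalgebra.Repr.arbitrary ℂ b).eq, l₁, l₂, legL, legR, S]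
  have e₅ : toConv (antipode₂ A ∘ₗ (swap (A := A)).toLinearMap ∘ₗ Coalgebra.comul (R := ℂ) (A := A))
      * toConv (Coalgebra.comul (R := ℂ) (A := A)) = 1 := by
    rw [← e₄, ← e₃, mul_assoc, ← mul_assoc (toConv (l₁ ∘ₗ S)), e₁, one_mul, e₂]
  have h := left_inv_eq_right_inv e₅ (comul_right_inv (C := A) (R := ℂ))
  exact (LinearMap.congr_fun (congrArg WithConv.ofConv h) a).symm

/-- The map `a ⊗ b ↦ a p 𝒮(b)`. -/
def sandwich (p : A) : (A ⊗[ℂ] A) →ₗ[ℂ] A :=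
  LinearMap.mul' ℂ A ∘ₗ TensorProduct.map (LinearMap.mulRight ℂ p) (HopfAlgebra.antipode ℂ)

@[simp] theorem sandwich_tmul (p a b : A) :
    sandwich p (a ⊗ₜ b) = a * p * HopfAlgebra.antipode ℂ b := by
  simp [sandwich]

/-- Because 𝒮 is anti-multiplicative, `sandwich` is a left action of A ⊗ A on A. Relations in A ⊗ A,
such as RΔ = Δ'R, thereby become relations for w, the image of 1 under R. -/
theorem sandwich_sandwich (s t : A ⊗[ℂ] A) (p : A) :
    sandwich (sandwich p s) t = sandwich p (t * s) := by
  induction t using TensorProduct.induction_on with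
  | zero => simp
  | add t t' h h' => simp [add_mul, h, h']
  | tmul a b =>
    induction s using TensorProduct.induction_on with
    | zero => simp [sandwich]
    | add s s' h h' =>
      rw [mul_add, map_add, map_add, ← h, ← h']
      simp [mul_add, add_mul]
    | tmul c d => simp [HopfAlgebra.antipode_mul_antidistrib, mul_assoc]

theorem sandwich_comul (a : A) : sandwich 1 (Coalgebra.comul (R := ℂ) a)
    = algebraMap ℂ A (Coalgebra.counit a) := by
  rw [← HopfAlgebra.mul_antipode_lTensor_comul_apply]
  simp [sandwich, LinearMap.lTensor]

end HopfAntipode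

/-! ### The R-matrix, the co-unit and the antipode -/

section Quasitriangular

variable {A : Type*} [Ring A] [HopfAlgebra ℂ A] [StarRing A] [StarModule ℂ A] [RibbonHopfStar A]

local notation "S" => HopfAlgebra.antipode ℂ
local notation "Δ" => Coalgebra.comul (R := ℂ)
local notation "Rm" => (Rmat A : A ⊗[ℂ] A)
local notation "Ri" => (((Rmat A)⁻¹ : (A ⊗[ℂ] A)ˣ) : A ⊗[ℂ] A)

variable (A) in
theorem exists_sum_Rmat : ∃ s : Finset (A × A), Rm = ∑ p ∈ s, p.1 ⊗ₜ[ℂ] p.2 :=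
  TensorProduct.exists_finset _

theorem comul_id_Rmat {s : Finset (A × A)} (hs : Rm = ∑ p ∈ s, p.1 ⊗ₜ[ℂ] p.2) :
    ∑ p ∈ s, Δ p.1 ⊗ₜ[ℂ] p.2 = ∑ p ∈ s, ∑ q ∈ s, (p.1 ⊗ₜ[ℂ] q.1) ⊗ₜ[ℂ] (p.2 * q.2) := by
  have h := RibbonHopfStar.comul_id_R (A := A)
  change Algebra.TensorProduct.map _ _ Rm = Algebra.TensorProduct.map _ _ Rm *
    Algebra.TensorProduct.map _ _ Rm at h
  rw [hs] at h
  simpa [map_sum, Finset.sum_mul_sum, legL, legR] using h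

theorem id_comul_Rmat {s : Finset (A × A)} (hs : Rm = ∑ p ∈ s, p.1 ⊗ₜ[ℂ] p.2) :
    ∑ p ∈ s, p.1 ⊗ₜ[ℂ] Δ p.2 = ∑ p ∈ s, ∑ q ∈ s, (p.1 * q.1) ⊗ₜ[ℂ] (q.2 ⊗ₜ[ℂ] p.2) := by
  have h := RibbonHopfStar.id_comul_R (A := A)
  change Algebra.TensorProduct.map _ _ Rm = Algebra.TensorProduct.map _ _ Rm *
    Algebra.TensorProduct.map _ _ Rm at h
  rw [hs] at h
  simpa [map_sum, Finset.sum_mul_sum, legL, legR] using h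

theorem Rmat_comul (a : A) : Rm * Δ a = swap (Δ a) * Rm := RibbonHopfStar.R_comul a

/-- `(ε ⊗ id)(R) = 1` -/
theorem counit_id_Rmat {s : Finset (A × A)} (hs : Rm = ∑ p ∈ s, p.1 ⊗ₜ[ℂ] p.2) :
    ∑ p ∈ s, Coalgebra.counit (R := ℂ) p.1 • p.2 = 1 := by
  let F : (A ⊗[ℂ] A) ⊗[ℂ] A →ₗ[ℂ] A ⊗[ℂ] A := (slice (Coalgebra.counit (R := ℂ))).rTensor A
  have hF : ∀ t b, F (t ⊗ₜ b) = slice (Coalgebra.counit (R := ℂ)) t ⊗ₜ b := fun _ _ => rfl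
  have hsl : ∀ a b : A, slice (Coalgebra.counit (R := ℂ)) (a ⊗ₜ b) = Coalgebra.counit (R := ℂ) a • b := by
    intro a b; simp [slice]
  have h := congrArg F (comul_id_Rmat hs)
  have e : ∀ a : A, slice (Coalgebra.counit (R := ℂ)) (Δ a) = a := by
    intro a; simp [slice]
  simp only [map_sum, hF, e, hsl] at h
  -- Applying ε to the first leg of (Δ ⊗ id)(R) = R₁₃R₂₃ gives R = (1 ⊗ x)R with x = (ε ⊗ id)(R). As
  -- R is invertible, x = 1.
  have h2 : Rm = (1 ⊗ₜ[ℂ] ∑ p ∈ s, Coalgebra.counit (R := ℂ) p.1 • p.2) * Rm := by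
    conv_lhs => rw [hs, h]
    rw [hs, TensorProduct.tmul_sum, Finset.sum_mul_sum]
    simp only [Algebra.TensorProduct.tmul_mul_tmul, one_mul]
    refine Finset.sum_congr rfl fun p _ => Finset.sum_congr rfl fun q _ => ?_
    rw [TensorProduct.smul_tmul, smul_mul_assoc]
  have h3 : (1 ⊗ₜ[ℂ] ∑ p ∈ s, Coalgebra.counit (R := ℂ) p.1 • p.2 : A ⊗[ℂ] A) = 1 := by
    have := congrArg (· * Ri) h2
    simpa [mul_assoc] using this.symm
  have h4 := congrArg (slice (Coalgebra.counit (R := ℂ))) h3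
  rw [Algebra.TensorProduct.one_def] at h4
  simpa [hsl] using h4

/-- `(id ⊗ ε)(R) = 1` -/
theorem id_counit_Rmat {s : Finset (A × A)} (hs : Rm = ∑ p ∈ s, p.1 ⊗ₜ[ℂ] p.2) :
    ∑ p ∈ s, Coalgebra.counit (R := ℂ) p.2 • p.1 = 1 := by
  let F : A ⊗[ℂ] (A ⊗[ℂ] A) →ₗ[ℂ] A ⊗[ℂ] A := (slice (Coalgebra.counit (R := ℂ))).lTensor A
  have hF : ∀ t b, F (b ⊗ₜ t) = b ⊗ₜ slice (Coalgebra.counit (R := ℂ)) t := fun _ _ => rfl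
  have hsl : ∀ a b : A, slice (Coalgebra.counit (R := ℂ)) (a ⊗ₜ b) = Coalgebra.counit (R := ℂ) a • b := by
    intro a b; simp [slice]
  have h := congrArg F (id_comul_Rmat hs)
  have e : ∀ a : A, slice (Coalgebra.counit (R := ℂ)) (Δ a) = a := by
    intro a; simp [slice]
  simp only [map_sum, hF, e, hsl] at h
  have h2 : Rm = Rm * ((∑ p ∈ s, Coalgebra.counit (R := ℂ) p.2 • p.1) ⊗ₜ[ℂ] 1) := by
    conv_lhs => rw [hs, h]
    rw [hs, TensorProduct.sum_tmul, Finset.sum_mul_sum]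
    simp only [Algebra.TensorProduct.tmul_mul_tmul, mul_one]
    refine Finset.sum_congr rfl fun p _ => Finset.sum_congr rfl fun q _ => ?_
    rw [← TensorProduct.smul_tmul, mul_smul_comm]
  have h3 : ((∑ p ∈ s, Coalgebra.counit (R := ℂ) p.2 • p.1) ⊗ₜ[ℂ] 1 : A ⊗[ℂ] A) = 1 := by
    have := congrArg (Ri * ·) h2
    simpa [← mul_assoc] using this.symm
  have h4 := congrArg (fun t => slice (Coalgebra.counit (R := ℂ)) (swap t)) h3
  rw [Algebra.TensorProduct.one_def] at h4
  simpa [hsl] using h4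

/-- `(𝒮 ⊗ id)(R) = R⁻¹` -/
theorem antipode_id_Rmat : (S).rTensor A Rm = Ri := by
  obtain ⟨s, hs⟩ := exists_sum_Rmat A
  -- Contraction of the first two legs of (Δ ⊗ id)(R) = R₁₃R₂₃ by a ⊗ b ↦ 𝒮(a)b leaves (ε ⊗ id)(R) =
  -- 1 on one side and (𝒮 ⊗ id)(R)R on the other.
  let F : (A ⊗[ℂ] A) ⊗[ℂ] A →ₗ[ℂ] A ⊗[ℂ] A := (LinearMap.mul' ℂ A ∘ₗ (S).rTensor A).rTensor A
  have h := congrArg F (comul_id_Rmat hs)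
  have hF : ∀ t b, F (t ⊗ₜ b) = LinearMap.mul' ℂ A ((S).rTensor A t) ⊗ₜ b := fun _ _ => rfl
  simp only [map_sum, hF, HopfAlgebra.mul_antipode_rTensor_comul_apply, LinearMap.rTensor_tmul,
    LinearMap.mul'_apply] at h
  have h1 : (1 : A ⊗[ℂ] A) = (S).rTensor A Rm * Rm := by
    conv_rhs => rw [hs]
    simp only [map_sum, Finset.sum_mul_sum, LinearMap.rTensor_tmul,
      Algebra.TensorProduct.tmul_mul_tmul]
    simp only [← h, Algebra.algebraMap_eq_smul_one, TensorProduct.smul_tmul,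
      ← TensorProduct.tmul_sum, counit_id_Rmat hs, Algebra.TensorProduct.one_def]
  have := congrArg (· * Ri) h1
  simpa [mul_assoc] using this.symm

/-- `(id ⊗ 𝒮)(R⁻¹) = R` -/
theorem id_antipode_Rmat_inv : (S).lTensor A Ri = Rm := by
  -- The identity for R is inverted first, (id ⊗ Δ)(R⁻¹) = R₁₂⁻¹R₁₃⁻¹. Contracting the last two legs
  -- by a ⊗ b ↦ a𝒮(b) then gives 1 = R⁻¹(id ⊗ 𝒮)(R⁻¹), without any use of 𝒮⁻¹.
  let F : A ⊗[ℂ] (A ⊗[ℂ] A) →ₗ[ℂ] A ⊗[ℂ] A := (LinearMap.mul' ℂ A ∘ₗ (S).lTensor A).lTensor A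
  have hF : ∀ t b, F (b ⊗ₜ t) = b ⊗ₜ LinearMap.mul' ℂ A ((S).lTensor A t) := fun _ _ => rfl
  let u : (A ⊗[ℂ] A) →ₐ[ℂ] A ⊗[ℂ] (A ⊗[ℂ] A) :=
    Algebra.TensorProduct.map (AlgHom.id ℂ A) (Bialgebra.comulAlgHom ℂ A)
  let j₃ : (A ⊗[ℂ] A) →ₐ[ℂ] A ⊗[ℂ] (A ⊗[ℂ] A) :=
    Algebra.TensorProduct.map (AlgHom.id ℂ A) (legR A)
  let j₂ : (A ⊗[ℂ] A) →ₐ[ℂ] A ⊗[ℂ] (A ⊗[ℂ] A) :=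
    Algebra.TensorProduct.map (AlgHom.id ℂ A) (legL A)
  have h : u Rm = j₃ Rm * j₂ Rm := RibbonHopfStar.id_comul_R
  have e : ∀ (f : (A ⊗[ℂ] A) →ₐ[ℂ] A ⊗[ℂ] (A ⊗[ℂ] A)), f Rm * f Ri = 1 ∧ f Ri * f Rm = 1 := by
    intro f
    rw [← map_mul, ← map_mul]; simp
  have h' : u Ri = j₂ Ri * j₃ Ri := by
    refine left_inv_eq_right_inv (e u).2 ?_
    rw [h, mul_assoc, ← mul_assoc (j₂ Rm), (e j₂).1, one_mul, (e j₃).1]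
  have h1 := congrArg F h'
  have hu : ∀ t, F (u t) = (slice (Coalgebra.counit (R := ℂ)) (swap t)) ⊗ₜ 1 := by
    intro t
    induction t using TensorProduct.induction_on with
    | zero => simp
    | add s t hs ht => simp [hs, ht, TensorProduct.add_tmul]
    | tmul a b =>
      simp only [u, Algebra.TensorProduct.map_tmul, AlgHom.coe_id, id_eq,
        Bialgebra.comulAlgHom_apply, hF, HopfAlgebra.mul_antipode_lTensor_comul_apply, slice,
        swap_tmul]
      simp [Algebra.algebraMap_eq_smul_one, TensorProduct.smul_tmul]
  have hj : ∀ t t', F (j₂ t * j₃ t') = t * (S).lTensor A t' := by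
    intro t t'
    induction t using TensorProduct.induction_on with
    | zero => simp
    | add s t hs ht => simp [hs, ht, add_mul]
    | tmul a b =>
      induction t' using TensorProduct.induction_on with
      | zero => simp
      | add s t hs ht => simp [hs, ht, mul_add]
      | tmul c d => simp [j₂, j₃, legL, legR, hF]
  rw [hu, hj] at h1
  have e1 : slice (Coalgebra.counit (R := ℂ)) (swap Ri) = 1 := by
    let E : (A ⊗[ℂ] A) →ₐ[ℂ] A := Algebra.TensorProduct.lift (AlgHom.id ℂ A) (counitRep A A)
      (fun a b => (commute_counitRep A A b a).symm)
    have hE : ∀ t, E t = slice (Coalgebra.counit (R := ℂ)) (swap t) := by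
      intro t
      induction t using TensorProduct.induction_on with
      | zero => simp
      | add s t hs ht => simp [hs, ht]
      | tmul a b =>
        simp [E, slice, counitRep, Algebra.ofId_apply, Algebra.algebraMap_eq_smul_one]
    have hE1 : E Rm = 1 := by
      obtain ⟨s, hs⟩ := exists_sum_Rmat A
      rw [hE, ← id_counit_Rmat hs, hs]
      simp [slice]
    rw [← hE]
    have := congrArg E (Rmat A).mul_inv
    rw [map_mul, hE1] at this
    simpa using this
  rw [e1, ← Algebra.TensorProduct.one_def] at h1
  have := congrArg (Rm * ·) h1
  simpa [← mul_assoc] using this.symm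

theorem antipode₂_Rmat : antipode₂ A Rm = Rm := by
  have : antipode₂ A Rm = (S).lTensor A ((S).rTensor A Rm) := by
    rw [LinearMap.lTensor, LinearMap.rTensor, ← LinearMap.comp_apply, ← TensorProduct.map_comp]
    rfl
  rw [this, antipode_id_Rmat, id_antipode_Rmat_inv]

theorem antipode₂_Rmat_inv : antipode₂ A Ri = Ri := by
  have h := congrArg (antipode₂ A) (Rmat A).inv_mul
  rw [antipode₂_mul, antipode₂_Rmat, antipode₂_one] at h
  have := congrArg (Ri * ·) h
  simpa [← mul_assoc] using this

end Quasitriangular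

/-! ### The element w = 𝒮(u) -/

section DrinfeldElement

variable {A : Type*} [Ring A] [HopfAlgebra ℂ A] [StarRing A] [StarModule ℂ A] [RibbonHopfStar A]

local notation "S" => HopfAlgebra.antipode ℂ
local notation "Δ" => Coalgebra.comul (R := ℂ)
local notation "Rm" => (Rmat A : A ⊗[ℂ] A)
local notation "Ri" => (((Rmat A)⁻¹ : (A ⊗[ℂ] A)ˣ) : A ⊗[ℂ] A)

/-- The element `𝒮(u)`. -/
def antipodeDrinfeld (A : Type*) [Ring A] [HopfAlgebra ℂ A] [StarRing A] [StarModule ℂ A]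
    [RibbonHopfStar A] : A := HopfAlgebra.antipode ℂ (drinfeld (Rmat A : A ⊗[ℂ] A))

local notation "w" => antipodeDrinfeld A

/-- Applying 𝒮 to u = ∑ 𝒮(r²)r¹ gives ∑ 𝒮(r¹)𝒮²(r²), and invariance of R under 𝒮 ⊗ 𝒮 removes one
antipode from each leg. -/
theorem antipodeDrinfeld_eq : w = sandwich 1 Rm := by
  have h : ∀ t : A ⊗[ℂ] A, S (drinfeld t) = sandwich 1 (antipode₂ A t) := by
    intro t
    unfold drinfeld
    induction t using TensorProduct.induction_on with
    | zero => simp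
    | add s t hs ht => simp [hs, ht]
    | tmul a b => simp [HopfAlgebra.antipode_mul_antidistrib]
  rw [antipodeDrinfeld, h, antipode₂_Rmat]

/-- From RΔ = Δ'R one gets ∑ c₍₂₎ w 𝒮(c₍₁₎) = ε(c)w. The element ∑ a₍₃₎ w 𝒮(𝒮(a₍₁₎)a₍₂₎) is then
evaluated in two ways: contracting 𝒮(a₍₁₎)a₍₂₎ yields aw, and contracting a₍₃₎ against 𝒮(a₍₂₎)
yields w𝒮²(a). These are the maps `Θ₁` and `Θ₂`. -/
theorem mul_antipodeDrinfeld (a : A) : a * w = w * S (S a) := by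
  let m : (A ⊗[ℂ] A) →ₗ[ℂ] A := LinearMap.mul' ℂ A
  let Θ₁ : (A ⊗[ℂ] A) ⊗[ℂ] A →ₗ[ℂ] A := m ∘ₗ TensorProduct.map (LinearMap.mulRight ℂ w)
      (S ∘ₗ m ∘ₗ LinearMap.rTensor A S) ∘ₗ (TensorProduct.comm ℂ (A ⊗[ℂ] A) A).toLinearMap
  let Θ₂ : A ⊗[ℂ] (A ⊗[ℂ] A) →ₗ[ℂ] A := m ∘ₗ TensorProduct.map
      (sandwich w ∘ₗ (swap (A := A)).toLinearMap) (S ∘ₗ S) ∘ₗ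
      (TensorProduct.comm ℂ A (A ⊗[ℂ] A)).toLinearMap
  have h₁ : ∀ t q, Θ₁ (t ⊗ₜ q) = q * w * S (m (LinearMap.rTensor A S t)) := fun _ _ => rfl
  have h₂ : ∀ c t, Θ₂ (c ⊗ₜ t) = sandwich w (swap t) * S (S c) := fun _ _ => rfl
  have e : Θ₂ ∘ₗ (TensorProduct.assoc ℂ A A A).toLinearMap = Θ₁ := by
    refine TensorProduct.ext_threefold fun x y z => ?_
    simp [h₁, h₂, m, HopfAlgebra.antipode_mul_antidistrib, mul_assoc]
  have k := congrArg Θ₂ (Coalgebra.coassoc_apply (R := ℂ) a)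
  have k₁ : Θ₂ (TensorProduct.assoc ℂ A A A (LinearMap.rTensor A Δ (Δ a)))
      = Θ₁ (LinearMap.rTensor A Δ (Δ a)) := LinearMap.congr_fun e _
  rw [k₁] at k
  have l₁ : ∀ t : A ⊗[ℂ] A, Θ₁ (LinearMap.rTensor A Δ t)
      = slice (Coalgebra.counit (R := ℂ)) t * w := by
    intro t
    induction t using TensorProduct.induction_on with
    | zero => simp
    | add s t hs ht => simp [hs, ht, add_mul]
    | tmul b c =>
      rw [LinearMap.rTensor_tmul, h₁, HopfAlgebra.mul_antipode_rTensor_comul_apply]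
      simp [slice, Algebra.algebraMap_eq_smul_one, HopfAlgebra.antipode_one]
  have l₂ : ∀ t : A ⊗[ℂ] A, Θ₂ (LinearMap.lTensor A Δ t)
      = w * S (S (slice (Coalgebra.counit (R := ℂ)) (swap t))) := by
    intro t
    induction t using TensorProduct.induction_on with
    | zero => simp
    | add s t hs ht => simp [hs, ht, mul_add]
    | tmul b c =>
      rw [LinearMap.lTensor_tmul, h₂]
      have : sandwich w (swap (Δ c)) = Coalgebra.counit (R := ℂ) c • w := by
        rw [antipodeDrinfeld_eq, sandwich_sandwich, ← Rmat_comul, ← sandwich_sandwich,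
          sandwich_comul]
        have : ∀ (x : ℂ) (t : A ⊗[ℂ] A), sandwich (algebraMap ℂ A x) t = x • sandwich 1 t := by
          intro x t
          induction t using TensorProduct.induction_on with
          | zero => simp
          | add s t hs ht => simp [hs, ht]
          | tmul b c => simp [Algebra.algebraMap_eq_smul_one]
        exact this _ _
      rw [this]
      simp [slice]
  rw [l₁, l₂] at k
  have r₁ : slice (Coalgebra.counit (R := ℂ)) (Δ a) = a := by simp [slice]
  have r₂ : slice (Coalgebra.counit (R := ℂ)) (swap (Δ a)) = a := by
    have : ∀ t : A ⊗[ℂ] A, slice (Coalgebra.counit (R := ℂ)) (swap t)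
        = TensorProduct.rid ℂ A (LinearMap.lTensor A (Coalgebra.counit (R := ℂ)) t) := by
      intro t
      induction t using TensorProduct.induction_on with
      | zero => simp
      | add s t hs ht => simp [hs, ht]
      | tmul b c => simp [slice]
    simp [this]
  rwa [r₁, r₂] at k

theorem tmul_antipodeDrinfeld (t : A ⊗[ℂ] A) :
    t * (w ⊗ₜ w) = (w ⊗ₜ w) * antipode₂ A (antipode₂ A t) := by
  induction t using TensorProduct.induction_on with
  | zero => simp
  | add s t hs ht => simp [hs, ht, mul_add, add_mul]
  | tmul b c => simp [mul_antipodeDrinfeld]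

theorem commute_antipodeDrinfeld : Commute Rm (w ⊗ₜ w) := by
  have := tmul_antipodeDrinfeld Rm
  rwa [antipode₂_Rmat, antipode₂_Rmat] at this

theorem sandwich_antipodeDrinfeld : sandwich w Ri = 1 := by
  rw [antipodeDrinfeld_eq, sandwich_sandwich, Units.inv_mul, Algebra.TensorProduct.one_def]
  simp [HopfAlgebra.antipode_one]

/-- Moving w to the left in ∑ a w 𝒮(b) gives w ∑ 𝒮²(a)𝒮(b), and (𝒮 ⊗ 𝒮)(R⁻¹) = R⁻¹. This is the
one-sided form of `sandwich_antipodeDrinfeld` needed at the source of a link. -/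
theorem antipodeDrinfeld_mul : w * LinearMap.mul' ℂ A (LinearMap.rTensor A S Ri) = 1 := by
  have h : ∀ t : A ⊗[ℂ] A, w * LinearMap.mul' ℂ A (LinearMap.rTensor A S (antipode₂ A t))
      = sandwich w t := by
    intro t
    induction t using TensorProduct.induction_on with
    | zero => simp
    | add s t hs ht => simp [hs, ht, mul_add]
    | tmul b c => simp [mul_antipodeDrinfeld, mul_assoc]
  have := h Ri
  rwa [antipode₂_Rmat_inv, sandwich_antipodeDrinfeld] at this

/-- `R' R Δ(𝒮(u)) = 𝒮(u) ⊗ 𝒮(u)` -/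
theorem comul_antipodeDrinfeld : swap Rm * Rm * Δ w = w ⊗ₜ w := by
  obtain ⟨s, hs⟩ := exists_sum_Rmat A
  let Δa : A →ₐ[ℂ] A ⊗[ℂ] A := Bialgebra.comulAlgHom ℂ A
  have hΔa : ∀ a, Δ a = Δa a := fun _ => rfl
  let sw : A ⊗[ℂ] A →ₐ[ℂ] A ⊗[ℂ] A := swap
  have c₁ : ∑ p ∈ s, sw (Δ p.1) ⊗ₜ[ℂ] p.2
      = ∑ p ∈ s, ∑ q ∈ s, (q.1 ⊗ₜ[ℂ] p.1) ⊗ₜ[ℂ] (p.2 * q.2) := by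
    have := congrArg (LinearMap.rTensor A sw.toLinearMap) (comul_id_Rmat hs)
    simpa [map_sum, sw] using this
  have c₂ : ∑ p ∈ s, p.1 ⊗ₜ[ℂ] sw (Δ p.2)
      = ∑ p ∈ s, ∑ q ∈ s, (p.1 * q.1) ⊗ₜ[ℂ] (p.2 ⊗ₜ[ℂ] q.2) := by
    have := congrArg (LinearMap.lTensor A sw.toLinearMap) (id_comul_Rmat hs)
    simpa [map_sum, sw] using this
  have hw : w = ∑ p ∈ s, p.1 * S p.2 := by
    rw [antipodeDrinfeld_eq, hs]; simp
  -- In Δ(w) = ∑ Δ(p₁)Δ(𝒮(p₂)) the second factor is expanded by Δ∘𝒮 = (𝒮 ⊗ 𝒮)∘Δ' and (id ⊗ Δ)(R) =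
  -- R₁₃R₁₂. Multiplication by R from the left turns both co-products into Δ'. The inner sum then
  -- collapses by `d₃` and the outer one by `d₄` and `d₅`.
  have d₁ : Δ w = ∑ p ∈ s, Δ p.1 * (∑ q ∈ s, Δ q.1 * (1 ⊗ₜ S q.2)) * (S p.2 ⊗ₜ 1) := by
    have := congrArg (LinearMap.mul' ℂ (A ⊗[ℂ] A) ∘ₗ
      TensorProduct.map Δa.toLinearMap (antipode₂ A)) c₂
    simp only [map_sum, LinearMap.comp_apply, TensorProduct.map_tmul, AlgHom.toLinearMap_apply,
      LinearMap.mul'_apply, sw, ← comul_antipode, antipode₂_tmul] at this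
    calc Δ w = ∑ p ∈ s, Δa p.1 * Δ (S p.2) := by
          rw [hw, hΔa, map_sum]
          simp [hΔa]
      _ = _ := by
          rw [this]
          simp only [Finset.mul_sum, Finset.sum_mul, map_mul]
          refine Finset.sum_congr rfl fun p _ => Finset.sum_congr rfl fun q _ => ?_
          simp only [hΔa, mul_assoc, Algebra.TensorProduct.tmul_mul_tmul, one_mul, mul_one]
  have d₂ : ∑ q ∈ s, ∑ r ∈ s, (q.1 * r.1) ⊗ₜ[ℂ] (r.2 * S q.2) = (1 : A ⊗[ℂ] A) := by
    have := congrArg (LinearMap.lTensor A (sandwich (1 : A))) (id_comul_Rmat hs)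
    simp only [map_sum, LinearMap.lTensor_tmul, sandwich_comul, sandwich_tmul, mul_one] at this
    rw [← this, Algebra.TensorProduct.one_def, ← id_counit_Rmat hs, TensorProduct.sum_tmul]
    refine Finset.sum_congr rfl fun p _ => ?_
    rw [Algebra.algebraMap_eq_smul_one, id_counit_Rmat hs, TensorProduct.smul_tmul]
  have d₃ : ∑ q ∈ s, sw (Δ q.1) * Rm * (1 ⊗ₜ S q.2) = 1 ⊗ₜ w := by
    have := congrArg (LinearMap.mul' ℂ (A ⊗[ℂ] A) ∘ₗ TensorProduct.map (LinearMap.mulRight ℂ Rm)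
      ((legR A).toLinearMap ∘ₗ S)) c₁
    simp only [map_sum, LinearMap.comp_apply, TensorProduct.map_tmul, AlgHom.toLinearMap_apply,
      LinearMap.mul'_apply, LinearMap.mulRight_apply, legR,
      Algebra.TensorProduct.includeRight_apply] at this
    rw [this]
    calc _ = ∑ p ∈ s, (1 ⊗ₜ p.1) * (∑ q ∈ s, ∑ r ∈ s, (q.1 * r.1) ⊗ₜ[ℂ] (r.2 * S q.2))
          * (1 ⊗ₜ[ℂ] S p.2) := by
          refine Finset.sum_congr rfl fun p _ => ?_
          rw [Finset.mul_sum, Finset.sum_mul]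
          refine Finset.sum_congr rfl fun q _ => ?_
          rw [hs]
          simp only [Finset.mul_sum, Finset.sum_mul, Algebra.TensorProduct.tmul_mul_tmul,
            HopfAlgebra.antipode_mul_antidistrib, one_mul, mul_one, mul_assoc]
      _ = 1 ⊗ₜ w := by
          rw [d₂, hw, TensorProduct.tmul_sum]
          simp
  have d₄ : ∑ p ∈ s, sw (Δ p.1) * (1 ⊗ₜ w) * (S p.2 ⊗ₜ 1)
      = ∑ p ∈ s, (w * S p.2) ⊗ₜ (p.1 * w) := by
    have := congrArg (LinearMap.mul' ℂ (A ⊗[ℂ] A) ∘ₗ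
      TensorProduct.map (LinearMap.mulRight ℂ ((1 : A) ⊗ₜ[ℂ] w))
      ((legL A).toLinearMap ∘ₗ S)) c₁
    simp only [map_sum, LinearMap.comp_apply, TensorProduct.map_tmul, AlgHom.toLinearMap_apply,
      LinearMap.mul'_apply, LinearMap.mulRight_apply, legL,
      Algebra.TensorProduct.includeLeft_apply] at this
    rw [this]
    refine Finset.sum_congr rfl fun p _ => ?_
    conv_rhs => rw [hw, Finset.sum_mul, TensorProduct.sum_tmul, ← hw]
    refine Finset.sum_congr rfl fun q _ => ?_
    simp [HopfAlgebra.antipode_mul_antidistrib, mul_assoc]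
  have d₅ : ∑ p ∈ s, (w * S p.2) ⊗ₜ (p.1 * w) = (w ⊗ₜ w) * swap Ri := by
    rw [← antipode₂_Rmat_inv, ← antipode_id_Rmat, hs]
    simp only [map_sum, LinearMap.rTensor_tmul, antipode₂_tmul, swap_tmul, Finset.mul_sum,
      Algebra.TensorProduct.tmul_mul_tmul, mul_antipodeDrinfeld]
  have hR : ∀ (a : A) (x : A ⊗[ℂ] A), Rm * (Δ a * x) = sw (Δ a) * (Rm * x) := by
    intro a x
    rw [← mul_assoc, Rmat_comul, mul_assoc]
  have d₆ : Rm * Δ w = (w ⊗ₜ w) * swap Ri := by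
    rw [d₁, ← d₅, ← d₄, ← d₃]
    simp only [Finset.mul_sum, Finset.sum_mul, mul_assoc, hR]
  rw [mul_assoc, d₆, ← mul_assoc]
  have : swap Rm * (w ⊗ₜ w) = (w ⊗ₜ w) * swap Rm := by
    have := congrArg swap (commute_antipodeDrinfeld (A := A)).eq
    simpa using this
  rw [this, mul_assoc, ← map_mul, Units.mul_inv, map_one, mul_one]

end DrinfeldElement

/-! ### Tensor products of matrix representations -/

section TensorRep

variable {A : Type*} [Ring A] [Algebra ℂ A] {m n : Type*} [Fintype m] [DecidableEq m]
    [Fintype n] [DecidableEq n]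

/-- `tensorRep` as an algebra homomorphism. -/
def tensorRepHom (τ : A →ₐ[ℂ] Matrix m m ℂ) (σ : A →ₐ[ℂ] Matrix n n ℂ) :
    (A ⊗[ℂ] A) →ₐ[ℂ] Matrix (m × n) (m × n) ℂ :=
  (Matrix.kroneckerAlgEquiv m n ℂ).toAlgHom.comp (Algebra.TensorProduct.map τ σ)

@[simp] theorem tensorRepHom_tmul (τ : A →ₐ[ℂ] Matrix m m ℂ) (σ : A →ₐ[ℂ] Matrix n n ℂ) (a b : A) :
    tensorRepHom τ σ (a ⊗ₜ b) = τ a ⊗ₖ σ b := by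
  simp [tensorRepHom]

@[simp] theorem entry_apply (τ : A →ₐ[ℂ] Matrix m m ℂ) (i j : m) (a : A) :
    entry τ i j a = τ a i j := rfl

@[simp] theorem pairing_tmul (φ ψ : A →ₗ[ℂ] ℂ) (a b : A) :
    pairing φ ψ (a ⊗ₜ b) = φ a * ψ b := rfl

@[simp] theorem slice_tmul (φ : A →ₗ[ℂ] ℂ) (a b : A) : slice φ (a ⊗ₜ b) = φ a • b := by
  simp [slice]

theorem tensorRep_eq (τ : A →ₐ[ℂ] Matrix m m ℂ) (σ : A →ₐ[ℂ] Matrix n n ℂ) (t : A ⊗[ℂ] A) :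
    tensorRep τ σ t = tensorRepHom τ σ t := by
  ext p q
  simp only [tensorRep, Matrix.of_apply]
  induction t using TensorProduct.induction_on with
  | zero => simp
  | add s t hs ht => simp [hs, ht]
  | tmul a b => simp [Matrix.kroneckerMap_apply]

theorem tensorRepHom_apply (τ : A →ₐ[ℂ] Matrix m m ℂ) (σ : A →ₐ[ℂ] Matrix n n ℂ) (t : A ⊗[ℂ] A)
    (p q : m × n) : tensorRepHom τ σ t p q = pairing (entry τ p.1 q.1) (entry σ p.2 q.2) t := by
  rw [← tensorRep_eq]; rfl

theorem tensorRepHom_swap (τ : A →ₐ[ℂ] Matrix m m ℂ) (σ : A →ₐ[ℂ] Matrix n n ℂ) (t : A ⊗[ℂ] A)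
    (p q : m × n) : tensorRepHom τ σ (swap t) p q = tensorRepHom σ τ t p.swap q.swap := by
  induction t using TensorProduct.induction_on with
  | zero => simp
  | add s t hs ht => simp [hs, ht]
  | tmul a b => simp [Matrix.kroneckerMap_apply, mul_comm]

end TensorRep

/-! ### Covariant rows and their dressing by an element of G ⊗ G -/

section Dress

variable {X G B : Type*} [Ring X] [Algebra ℂ X] [Ring G] [Algebra ℂ G] [Ring B] [Algebra ℂ B]
  {m n : Type*} [Fintype m] [DecidableEq m] [Fintype n] [DecidableEq n]

theorem commute_dress (ι : G →ₐ[ℂ] B) (τ : X →ₐ[ℂ] Matrix n n ℂ) (x : X) (ξ : G) :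
    Commute (((Algebra.ofId ℂ B).mapMatrix.comp τ) x) (((Matrix.scalarAlgHom n ℂ).comp ι) ξ) := by
  ext i j
  simp [Matrix.scalar, Algebra.ofId_apply, Algebra.commutes]

/-- The homomorphism `X ⊗ G → Mₙ(B)`, `x ⊗ ξ ↦ τ(x) ι(ξ)`. -/
def dress (ι : G →ₐ[ℂ] B) (τ : X →ₐ[ℂ] Matrix n n ℂ) : (X ⊗[ℂ] G) →ₐ[ℂ] Matrix n n B :=
  Algebra.TensorProduct.lift ((Algebra.ofId ℂ B).mapMatrix.comp τ)
    ((Matrix.scalarAlgHom n ℂ).comp ι) (commute_dress ι τ)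

@[simp] theorem dress_tmul (ι : G →ₐ[ℂ] B) (τ : X →ₐ[ℂ] Matrix n n ℂ) (x : X) (ξ : G) (i j : n) :
    dress ι τ (x ⊗ₜ ξ) i j = τ x i j • ι ξ := by
  rw [dress, Algebra.TensorProduct.lift_tmul]
  simp [Matrix.scalar, Algebra.ofId_apply, Algebra.smul_def]

theorem dress_apply (ι : G →ₐ[ℂ] B) (τ : G →ₐ[ℂ] Matrix n n ℂ) (t : G ⊗[ℂ] G) (i j : n) :
    dress ι τ t i j = ι (slice (entry τ i j) t) := by
  induction t using TensorProduct.induction_on with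
  | zero => simp
  | add s t hs ht => simp [hs, ht]
  | tmul a b => simp

theorem dress_map_left {Y : Type*} [Ring Y] [Algebra ℂ Y] (ι : G →ₐ[ℂ] B)
    (τ : X →ₐ[ℂ] Matrix n n ℂ) (f : Y →ₐ[ℂ] X) (t : Y ⊗[ℂ] G) :
    dress ι τ (Algebra.TensorProduct.map f (AlgHom.id ℂ G) t) = dress ι (τ.comp f) t := by
  induction t using TensorProduct.induction_on with
  | zero => simp
  | add s t hs ht => simp [hs, ht]
  | tmul a b => ext i j; simp

theorem dress_includeLeft (ι : G →ₐ[ℂ] B) (τ : X →ₐ[ℂ] Matrix n n ℂ) (x : X) :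
    dress ι τ (x ⊗ₜ 1) = (τ x).map (algebraMap ℂ B) := by
  ext i j
  simp [Algebra.algebraMap_eq_smul_one]

/-- Rows `U` with `ξ U = U (τ ⊗ id)(Δ(ξ))`. -/
def IsCovariant (ι : G →ₐ[ℂ] B) (Δ : G →ₐ[ℂ] G ⊗[ℂ] G) (τ : G →ₐ[ℂ] Matrix n n ℂ) (U : n → B) :
    Prop :=
  ∀ ξ α, ι ξ * U α = Matrix.vecMul U (dress ι τ (Δ ξ)) α

/-- The product `U₁ U₂` of two rows. -/
def rowMul (U : m → B) (U' : n → B) : m × n → B := fun p => U p.1 * U' p.2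

theorem dress_id_comul (ι : G →ₐ[ℂ] B) (Δ : G →ₐ[ℂ] G ⊗[ℂ] G) (τ : G →ₐ[ℂ] Matrix m m ℂ)
    (σ : G →ₐ[ℂ] Matrix n n ℂ) (t : G ⊗[ℂ] G) (p q : m × n) :
    dress ι (tensorRepHom τ σ) ((Algebra.TensorProduct.assoc ℂ ℂ ℂ G G G).symm
      (Algebra.TensorProduct.map (AlgHom.id ℂ G) Δ t)) p q
    = dress ι σ (Δ (slice (entry τ p.1 q.1) t)) p.2 q.2 := by
  induction t using TensorProduct.induction_on with
  | zero => simp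
  | add s t hs ht => simp [hs, ht]
  | tmul a b =>
    simp only [Algebra.TensorProduct.map_tmul, AlgHom.coe_id, id_eq, slice_tmul, entry_apply,
      map_smul, Matrix.smul_apply]
    generalize Δ b = s
    induction s using TensorProduct.induction_on with
    | zero => simp
    | add s t hs ht => simp [TensorProduct.tmul_add, hs, ht]
    | tmul c d => simp [Matrix.kroneckerMap_apply, mul_smul]

/-- The dressing puts elements of ι(G) between U and U'. Covariance of U' carries them to the right,
at the price of the co-product in the second leg. -/
theorem rowMul_dress_left {ι : G →ₐ[ℂ] B} {Δ : G →ₐ[ℂ] G ⊗[ℂ] G} {τ : G →ₐ[ℂ] Matrix m m ℂ}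
    {σ : G →ₐ[ℂ] Matrix n n ℂ} {U : m → B} {U' : n → B} (h : IsCovariant ι Δ σ U')
    (t : G ⊗[ℂ] G) :
    rowMul (Matrix.vecMul U (dress ι τ t)) U'
      = Matrix.vecMul (rowMul U U') (dress ι (tensorRepHom τ σ)
        ((Algebra.TensorProduct.assoc ℂ ℂ ℂ G G G).symm
          (Algebra.TensorProduct.map (AlgHom.id ℂ G) Δ t))) := by
  ext p
  simp only [rowMul, Matrix.vecMul, dotProduct, dress_id_comul, Fintype.sum_prod_type,
    Finset.sum_mul]
  refine Finset.sum_congr rfl fun i _ => ?_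
  rw [dress_apply, mul_assoc, h]
  simp only [Matrix.vecMul, dotProduct, Finset.mul_sum, mul_assoc]

theorem rowMul_dress_right (ι : G →ₐ[ℂ] B) (τ : G →ₐ[ℂ] Matrix m m ℂ)
    (σ : G →ₐ[ℂ] Matrix n n ℂ) (U : m → B) (U' : n → B) (t : G ⊗[ℂ] G) :
    rowMul U (Matrix.vecMul U' (dress ι σ t))
      = Matrix.vecMul (rowMul U U') (dress ι (tensorRepHom τ σ)
        ((Algebra.TensorProduct.assoc ℂ ℂ ℂ G G G).symm (1 ⊗ₜ t))) := by
  have h : ∀ p q : m × n, dress ι (tensorRepHom τ σ)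
      ((Algebra.TensorProduct.assoc ℂ ℂ ℂ G G G).symm (1 ⊗ₜ t)) p q
      = (1 : Matrix m m ℂ) p.1 q.1 • dress ι σ t p.2 q.2 := by
    intro p q
    induction t using TensorProduct.induction_on with
    | zero => simp
    | add s t hs ht => simp [TensorProduct.tmul_add, hs, ht]
    | tmul c d => simp [Matrix.kroneckerMap_apply, mul_smul]
  ext p
  simp [rowMul, Matrix.vecMul, dotProduct, h, Fintype.sum_prod_type, Matrix.one_apply,
    Finset.mul_sum, mul_assoc]

/-- The identity `(id ⊗ Δ)(R⁻¹) R₂₃⁻¹ = (Δ ⊗ id)(R⁻¹) R₁₂⁻¹`. -/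
def IsCocycle (Δ : G →ₐ[ℂ] G ⊗[ℂ] G) (r : G ⊗[ℂ] G) : Prop :=
  (Algebra.TensorProduct.assoc ℂ ℂ ℂ G G G).symm
      (Algebra.TensorProduct.map (AlgHom.id ℂ G) Δ r)
    * (Algebra.TensorProduct.assoc ℂ ℂ ℂ G G G).symm (1 ⊗ₜ r)
  = Algebra.TensorProduct.map Δ (AlgHom.id ℂ G) r * (r ⊗ₜ 1)

/-- Collecting both dressings on the right produces (id ⊗ Δ)(r)r₂₃. The cocycle identity replaces it
by (Δ ⊗ id)(r)r₁₂, so the product row is dressed as a single row of the representation (τ ⊗ σ)∘Δ, up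
to a scalar matrix. -/
theorem rowMul_dress {ι : G →ₐ[ℂ] B} {Δ : G →ₐ[ℂ] G ⊗[ℂ] G} {τ : G →ₐ[ℂ] Matrix m m ℂ}
    {σ : G →ₐ[ℂ] Matrix n n ℂ} {U : m → B} {U' : n → B} (h : IsCovariant ι Δ σ U')
    {r : G ⊗[ℂ] G} (hr : IsCocycle Δ r) :
    rowMul (Matrix.vecMul U (dress ι τ r)) (Matrix.vecMul U' (dress ι σ r))
      = Matrix.vecMul (rowMul U U') (dress ι ((tensorRepHom τ σ).comp Δ) r
          * (tensorRepHom τ σ r).map (algebraMap ℂ B)) := by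
  rw [rowMul_dress_right ι τ σ, rowMul_dress_left h, Matrix.vecMul_vecMul, ← map_mul, hr, map_mul,
    dress_map_left, dress_includeLeft]

end Dress

/-! ### Generators and the *-operation of ⨂ₓ Aₓ -/

section PiTensorFacts

variable {V : Type*} {A : V → Type*} [∀ x, Ring (A x)] [∀ x, Algebra ℂ (A x)]

theorem pi_algHom_ext [Finite V] {D : Type*} [Ring D] [Algebra ℂ D]
    {f g : (⨂[ℂ] x, A x) →ₐ[ℂ] D} (h : ∀ x a, f (single x a) = g (single x a)) : f = g := by
  classical
  refine PiTensorProduct.algHom_ext fun x => AlgHom.ext fun a => ?_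
  exact h x a

/-- A subalgebra of `⨂ₓ Aₓ` that contains all factors is the whole algebra. -/
theorem mem_of_single_mem [Fintype V] (P : Subalgebra ℂ (⨂[ℂ] x, A x))
    (h : ∀ x a, single x a ∈ P) (ξ : ⨂[ℂ] x, A x) : ξ ∈ P := by
  -- The universal property maps the tensor product into P. Followed by the inclusion of P this is
  -- the identity, since it is so on every factor.
  let f : (⨂[ℂ] x, A x) →ₐ[ℂ] P := piLift (fun x => (single x).codRestrict P (h x))
    (fun x y hxy a b => Subtype.ext (commute_single hxy a b).eq)
  have hf : P.val.comp f = AlgHom.id ℂ _ := pi_algHom_ext fun x a =>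
    congrArg Subtype.val (piLift_single _ _ x a)
  have := DFunLike.congr_fun hf ξ
  rw [AlgHom.id_apply] at this
  rw [← this]
  exact (f ξ).2

variable [∀ x, StarRing (A x)] [∀ x, StarModule ℂ (A x)]

theorem piStar_tprod (a : ∀ x, A x) : piStar (PiTensorProduct.tprod ℂ a)
    = PiTensorProduct.tprod ℂ (fun x => star (a x)) := by
  simpa using piStar_smul_tprod 1 a

theorem piStar_smul (c : ℂ) (ξ : ⨂[ℂ] x, A x) : piStar (c • ξ) = star c • piStar ξ := by
  induction ξ using PiTensorProduct.induction_on with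
  | smul_tprod r a => rw [smul_smul, piStar_smul_tprod, piStar_smul_tprod, smul_smul, star_mul']
  | add s t hs ht => simp only [smul_add, map_add, hs, ht]

theorem piStar_mul (ξ ζ : ⨂[ℂ] x, A x) : piStar (ξ * ζ) = piStar ζ * piStar ξ := by
  induction ξ using PiTensorProduct.induction_on with
  | add s t hs ht => simp only [add_mul, mul_add, map_add, hs, ht]
  | smul_tprod r a =>
    induction ζ using PiTensorProduct.induction_on with
    | add s t hs ht => simp only [add_mul, mul_add, map_add, hs, ht]
    | smul_tprod r' b =>
      simp only [piStar_smul, smul_mul_assoc, mul_smul_comm, PiTensorProduct.tprod_mul_tprod,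
        piStar_tprod]
      rw [smul_comm]
      congr 3
      funext x
      simp

theorem piStar_one : piStar (1 : ⨂[ℂ] x, A x) = 1 := by
  rw [PiTensorProduct.one_def, piStar_tprod]
  simp [Pi.one_def]

theorem piStar_algebraMap (c : ℂ) : piStar (algebraMap ℂ (⨂[ℂ] x, A x) c)
    = algebraMap ℂ (⨂[ℂ] x, A x) (star c) := by
  rw [Algebra.algebraMap_eq_smul_one, Algebra.algebraMap_eq_smul_one, piStar_smul, piStar_one]

theorem piStar_single (x : V) (a : A x) : piStar (single x a) = single x (star a) := by
  classical
  unfold single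
  simp only [PiTensorProduct.singleAlgHom_apply, piStar_tprod]
  congr 1
  funext y
  by_cases hy : y = x
  · subst hy; simp
  · simp [hy]

end PiTensorFacts

/-! ### The cocycle identity for R⁻¹ -/

section Legs

variable (G : Type*) [Ring G] [Algebra ℂ G]

/-- `s ⊗ t ↦ s ⊗ 1 ⊗ t`, with values in `(G ⊗ G) ⊗ G`. -/
def leg₁₃ : (G ⊗[ℂ] G) →ₐ[ℂ] (G ⊗[ℂ] G) ⊗[ℂ] G :=
  Algebra.TensorProduct.map (legL G) (AlgHom.id ℂ G)

/-- `s ⊗ t ↦ 1 ⊗ s ⊗ t`, with values in `(G ⊗ G) ⊗ G`. -/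
def leg₂₃ : (G ⊗[ℂ] G) →ₐ[ℂ] (G ⊗[ℂ] G) ⊗[ℂ] G :=
  Algebra.TensorProduct.map (legR G) (AlgHom.id ℂ G)

/-- `s ⊗ t ↦ s ⊗ t ⊗ 1`, with values in `(G ⊗ G) ⊗ G`. -/
def leg₁₂ : (G ⊗[ℂ] G) →ₐ[ℂ] (G ⊗[ℂ] G) ⊗[ℂ] G := Algebra.TensorProduct.includeLeft

variable {G}

/-- `(id ⊗ Δ)`, with values in `(G ⊗ G) ⊗ G`. -/
def idComul (Δ : G →ₐ[ℂ] G ⊗[ℂ] G) : (G ⊗[ℂ] G) →ₐ[ℂ] (G ⊗[ℂ] G) ⊗[ℂ] G :=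
  (Algebra.TensorProduct.assoc ℂ ℂ ℂ G G G).symm.toAlgHom.comp
    (Algebra.TensorProduct.map (AlgHom.id ℂ G) Δ)

/-- `(Δ ⊗ id)`, with values in `(G ⊗ G) ⊗ G`. -/
def comulId (Δ : G →ₐ[ℂ] G ⊗[ℂ] G) : (G ⊗[ℂ] G) →ₐ[ℂ] (G ⊗[ℂ] G) ⊗[ℂ] G :=
  Algebra.TensorProduct.map Δ (AlgHom.id ℂ G)

theorem assoc_symm_map_legR (t : G ⊗[ℂ] G) : (Algebra.TensorProduct.assoc ℂ ℂ ℂ G G G).symm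
    (Algebra.TensorProduct.map (AlgHom.id ℂ G) (legR G) t) = leg₁₃ _ t := by
  induction t using TensorProduct.induction_on with
  | zero => simp
  | add s t hs ht => simp only [map_add, hs, ht]
  | tmul a b => simp [legR, legL, leg₁₃]

theorem assoc_symm_map_legL (t : G ⊗[ℂ] G) : (Algebra.TensorProduct.assoc ℂ ℂ ℂ G G G).symm
    (Algebra.TensorProduct.map (AlgHom.id ℂ G) (legL G) t) = leg₁₂ _ t := by
  induction t using TensorProduct.induction_on with
  | zero => simp
  | add s t hs ht => simp only [map_add, hs, ht]
  | tmul a b => simp [legL, leg₁₂]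

/-- R₁₂(Δ ⊗ id)(R) = (Δ' ⊗ id)(R)R₁₂ = R₂₃R₁₃R₁₂ = R₂₃(id ⊗ Δ)(R), and the inverses of the two ends
are the two sides of the identity. -/
theorem isCocycle_inv {Δ : G →ₐ[ℂ] G ⊗[ℂ] G} {r : (G ⊗[ℂ] G)ˣ}
    (hr : ∀ ξ, (r : G ⊗[ℂ] G) * Δ ξ = swap (Δ ξ) * r)
    (h₁ : comulId Δ r = leg₁₃ _ (r : G ⊗[ℂ] G) * leg₂₃ _ (r : G ⊗[ℂ] G))
    (h₂ : idComul Δ r = leg₁₃ _ (r : G ⊗[ℂ] G) * leg₁₂ _ (r : G ⊗[ℂ] G)) :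
    IsCocycle Δ ((r⁻¹ : (G ⊗[ℂ] G)ˣ) : G ⊗[ℂ] G) := by
  let j₂₃ : (G ⊗[ℂ] G) →ₐ[ℂ] (G ⊗[ℂ] G) ⊗[ℂ] G :=
    (Algebra.TensorProduct.assoc ℂ ℂ ℂ _ _ _).symm.toAlgHom.comp
      Algebra.TensorProduct.includeRight
  have ej : ∀ t, j₂₃ t = leg₂₃ _ t := by
    intro t
    induction t using TensorProduct.induction_on with
    | zero => simp
    | add s t hs ht => simp only [map_add, hs, ht]
    | tmul a b => simp [j₂₃, leg₂₃, legR]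
  have h : leg₂₃ _ (r : G ⊗[ℂ] G) * idComul Δ r = leg₁₂ _ (r : G ⊗[ℂ] G) * comulId Δ r := by
    let sw : (G ⊗[ℂ] G) ⊗[ℂ] G →ₐ[ℂ] (G ⊗[ℂ] G) ⊗[ℂ] G :=
      Algebra.TensorProduct.map swap (AlgHom.id ℂ _)
    have e₁ : ∀ t, leg₁₂ _ (r : G ⊗[ℂ] G) * comulId Δ t
        = sw (comulId Δ t) * leg₁₂ _ (r : G ⊗[ℂ] G) := by
      intro t
      induction t using TensorProduct.induction_on with
      | zero => simp
      | add s t hs ht => simp only [map_add, mul_add, add_mul, hs, ht]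
      | tmul a b => simp [leg₁₂, comulId, sw, hr]
    have e₂ : ∀ t, sw (leg₁₃ _ t) = leg₂₃ _ t := by
      intro t
      induction t using TensorProduct.induction_on with
      | zero => simp
      | add s t hs ht => simp only [map_add, hs, ht]
      | tmul a b => simp [leg₁₃, leg₂₃, sw, legL, legR]
    have e₃ : ∀ t, sw (leg₂₃ _ t) = leg₁₃ _ t := by
      intro t
      induction t using TensorProduct.induction_on with
      | zero => simp
      | add s t hs ht => simp only [map_add, hs, ht]
      | tmul a b => simp [leg₁₃, leg₂₃, sw, legL, legR]
    rw [e₁, h₁, map_mul, e₂, e₃, h₂, mul_assoc]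
  have inv : ∀ f : (G ⊗[ℂ] G) →ₐ[ℂ] (G ⊗[ℂ] G) ⊗[ℂ] G,
      f r * f ((r⁻¹ : (G ⊗[ℂ] G)ˣ) : G ⊗[ℂ] G) = 1
        ∧ f ((r⁻¹ : (G ⊗[ℂ] G)ˣ) : G ⊗[ℂ] G) * f r = 1 := by
    intro f
    rw [← map_mul, ← map_mul]; simp
  have l : (idComul Δ ((r⁻¹ : (G ⊗[ℂ] G)ˣ) : G ⊗[ℂ] G)
      * leg₂₃ _ ((r⁻¹ : (G ⊗[ℂ] G)ˣ) : G ⊗[ℂ] G)) * (leg₂₃ _ (r : G ⊗[ℂ] G) * idComul Δ r) = 1 := by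
    rw [mul_assoc, ← mul_assoc (leg₂₃ _ _), (inv _).2, one_mul, (inv _).2]
  have r' : (leg₁₂ _ (r : G ⊗[ℂ] G) * comulId Δ r) * (comulId Δ ((r⁻¹ : (G ⊗[ℂ] G)ˣ) : G ⊗[ℂ] G)
      * leg₁₂ _ ((r⁻¹ : (G ⊗[ℂ] G)ˣ) : G ⊗[ℂ] G)) = 1 := by
    rw [mul_assoc, ← mul_assoc (comulId _ _), (inv _).1, one_mul, (inv _).1]
  rw [h] at l
  have := left_inv_eq_right_inv l r'
  rw [← ej] at this
  exact this

end Legs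

/-! ### Quasitriangularity of 𝒢, from vertex to global -/

section GaugeFacts

variable {V : Type*} [Fintype V] {𝒢 : V → Type*} [∀ x, Ring (𝒢 x)] [∀ x, HopfAlgebra ℂ (𝒢 x)]

theorem gaugeComul_single (x : V) (a : 𝒢 x) :
    gaugeComul 𝒢 (single x a) = single₂ 𝒢 x (Coalgebra.comul (R := ℂ) a) := by
  exact piLift_single _ _ x a

theorem single₂_tmul (x : V) (a b : 𝒢 x) :
    single₂ 𝒢 x (a ⊗ₜ b) = single x a ⊗ₜ single x b := by
  simp [single₂]

theorem swap_single₂ (x : V) (t : 𝒢 x ⊗[ℂ] 𝒢 x) :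
    swap (single₂ 𝒢 x t) = single₂ 𝒢 x (swap t) := by
  induction t using TensorProduct.induction_on with
  | zero => simp
  | add s t hs ht => simp [hs, ht]
  | tmul a b => simp [single₂_tmul]

variable [∀ x, StarRing (𝒢 x)] [∀ x, StarModule ℂ (𝒢 x)] [∀ x, RibbonHopfStar (𝒢 x)]

local notation "Rg" => (gaugeR 𝒢 : Gauge 𝒢 ⊗[ℂ] Gauge 𝒢)
local notation "Rgi" => (((gaugeR 𝒢)⁻¹ : (Gauge 𝒢 ⊗[ℂ] Gauge 𝒢)ˣ) : Gauge 𝒢 ⊗[ℂ] Gauge 𝒢)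

variable (𝒢) in
/-- The image of `Rₓ` in `𝒢 ⊗ 𝒢`. -/
def vertexR (x : V) : (Gauge 𝒢 ⊗[ℂ] Gauge 𝒢)ˣ :=
  Units.map (single₂ 𝒢 x : (𝒢 x ⊗[ℂ] 𝒢 x) →* (Gauge 𝒢 ⊗[ℂ] Gauge 𝒢)) (Rmat (𝒢 x))

theorem coe_vertexR (x : V) : (vertexR 𝒢 x : Gauge 𝒢 ⊗[ℂ] Gauge 𝒢) = single₂ 𝒢 x (Rmat (𝒢 x)) := rfl

theorem coe_vertexR_inv (x : V) :
    (((vertexR 𝒢 x)⁻¹ : (Gauge 𝒢 ⊗[ℂ] Gauge 𝒢)ˣ) : Gauge 𝒢 ⊗[ℂ] Gauge 𝒢)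
      = single₂ 𝒢 x (((Rmat (𝒢 x))⁻¹ : (𝒢 x ⊗[ℂ] 𝒢 x)ˣ) : 𝒢 x ⊗[ℂ] 𝒢 x) := rfl

theorem commute_vertexR {x y : V} (h : x ≠ y) : Commute (vertexR 𝒢 x) (vertexR 𝒢 y) :=
  Units.ext (commute_single₂ 𝒢 h _ _).eq

theorem gaugeR_eq : gaugeR 𝒢 = Finset.univ.noncommProd (vertexR 𝒢)
    (fun _ _ _ _ h => commute_vertexR h) := rfl

theorem gaugeR_eq_vertexR_mul [DecidableEq V] (x : V) :
    gaugeR 𝒢 = vertexR 𝒢 x * (Finset.univ.erase x).noncommProd (vertexR 𝒢)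
      (fun _ _ _ _ h => commute_vertexR h) := by
  exact (Finset.mul_noncommProd_erase _ (Finset.mem_univ x) _ _).symm

/-- Elements ξ that satisfy the relation form a subalgebra, so ξ may be taken in one factor 𝒢ₓ.
There all R_y with y ≠ x commute with Δ(ξ), and the relation for Rₓ remains. -/
theorem gaugeR_comul (ξ : Gauge 𝒢) :
    Rg * gaugeComul 𝒢 ξ = swap (gaugeComul 𝒢 ξ) * Rg := by
  classical
  let P : Subalgebra ℂ (Gauge 𝒢) :=
    { carrier := {ξ | Rg * gaugeComul 𝒢 ξ = swap (gaugeComul 𝒢 ξ) * Rg}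
      mul_mem' := by
        intro a b ha hb
        simp only [Set.mem_ofPred_eq, map_mul] at *
        rw [← mul_assoc, ha, mul_assoc, hb, mul_assoc]
      add_mem' := by
        intro a b ha hb
        simp only [Set.mem_ofPred_eq, map_add] at *
        rw [mul_add, add_mul, ha, hb]
      algebraMap_mem' := by
        intro c
        simp only [Set.mem_ofPred_eq, AlgHom.commutes]
        exact (Algebra.commutes _ _).symm }
  refine mem_of_single_mem P (fun x a => ?_) ξ
  change Rg * gaugeComul 𝒢 (single x a) = swap (gaugeComul 𝒢 (single x a)) * Rg
  rw [gaugeR_eq_vertexR_mul x, gaugeComul_single, swap_single₂]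
  set u := (Finset.univ.erase x).noncommProd (vertexR 𝒢) (fun _ _ _ _ h => commute_vertexR h)
    with hu
  have hc : ∀ t : 𝒢 x ⊗[ℂ] 𝒢 x, Commute (single₂ 𝒢 x t) (u : Gauge 𝒢 ⊗[ℂ] Gauge 𝒢) := by
    intro t
    have e : (u : Gauge 𝒢 ⊗[ℂ] Gauge 𝒢) = (Finset.univ.erase x).noncommProd
        (fun y => (vertexR 𝒢 y : Gauge 𝒢 ⊗[ℂ] Gauge 𝒢))
        (fun _ _ _ _ h => commute_single₂ 𝒢 h _ _) :=
      Finset.map_noncommProd _ _ _ (Units.coeHom _)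
    rw [e]
    refine Finset.noncommProd_commute _ _ _ _ fun y hy => ?_
    exact commute_single₂ 𝒢 (Finset.ne_of_mem_erase hy).symm _ _
  rw [Units.val_mul, coe_vertexR, mul_assoc, ← (hc _).eq, ← mul_assoc, ← map_mul, Rmat_comul,
    map_mul, mul_assoc]

theorem map_gaugeR {D : Type*} [Ring D] [Algebra ℂ D] (f : (Gauge 𝒢 ⊗[ℂ] Gauge 𝒢) →ₐ[ℂ] D) :
    f Rg = Finset.univ.noncommProd (fun x => f (single₂ 𝒢 x (Rmat (𝒢 x))))
      (fun _ _ _ _ h => (commute_single₂ 𝒢 h _ _).map f) := by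
  have e : Rg = Finset.univ.noncommProd
      (fun y => (vertexR 𝒢 y : Gauge 𝒢 ⊗[ℂ] Gauge 𝒢))
      (fun _ _ _ _ h => commute_single₂ 𝒢 h _ _) :=
    Finset.map_noncommProd _ _ _ (Units.coeHom _)
  rw [e]
  exact Finset.map_noncommProd _ _ _ f

/-- Regrouping the factors of different vertices, which commute, deduces product formulas for R from
those for the Rₓ; it is used for both identities on (Δ ⊗ id)(R) and (id ⊗ Δ)(R). -/
theorem map_gaugeR_eq_mul {D : Type*} [Ring D] [Algebra ℂ D]
    (f g h : (Gauge 𝒢 ⊗[ℂ] Gauge 𝒢) →ₐ[ℂ] D)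
    (e : ∀ x, f (single₂ 𝒢 x (Rmat (𝒢 x))) = g (single₂ 𝒢 x (Rmat (𝒢 x)))
      * h (single₂ 𝒢 x (Rmat (𝒢 x))))
    (c : ∀ x y, x ≠ y → Commute (h (single₂ 𝒢 x (Rmat (𝒢 x)))) (g (single₂ 𝒢 y (Rmat (𝒢 y))))) :
    f Rg = g Rg * h Rg := by
  rw [map_gaugeR, map_gaugeR g, map_gaugeR h]
  exact (Finset.noncommProd_congr rfl (fun x _ => e x) _).trans
    (Finset.noncommProd_mul_distrib _ _ _ _ (fun x _ y _ hxy => c x y hxy))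

theorem map_gaugeR_eq_one {D : Type*} [Ring D] [Algebra ℂ D]
    (f : (Gauge 𝒢 ⊗[ℂ] Gauge 𝒢) →ₐ[ℂ] D) (e : ∀ x, f (single₂ 𝒢 x (Rmat (𝒢 x))) = 1) :
    f Rg = 1 := by
  rw [map_gaugeR]
  exact (Finset.noncommProd_eq_pow_card _ _ _ 1 fun x _ => e x).trans (one_pow _)

theorem leg_commute {x y : V} (h : x ≠ y) (s : 𝒢 x ⊗[ℂ] 𝒢 x) (t : 𝒢 y ⊗[ℂ] 𝒢 y) :
    Commute (leg₂₃ _ (single₂ 𝒢 x s)) (leg₁₃ _ (single₂ 𝒢 y t)) ∧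
    Commute (leg₁₂ _ (single₂ 𝒢 x s)) (leg₁₃ _ (single₂ 𝒢 y t)) := by
  induction s using TensorProduct.induction_on with
  | zero => simp
  | add s s' hs hs' =>
    simp only [map_add]
    exact ⟨hs.1.add_left hs'.1, hs.2.add_left hs'.2⟩
  | tmul a b =>
    induction t using TensorProduct.induction_on with
    | zero => simp
    | add s s' hs hs' =>
      simp only [map_add]
      exact ⟨hs.1.add_right hs'.1, hs.2.add_right hs'.2⟩
    | tmul c d =>
      constructor
      · simp [leg₂₃, leg₁₃, single₂_tmul, legL, legR, Commute, SemiconjBy,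
          (commute_single h b d).eq]
      · simp [leg₁₂, leg₁₃, single₂_tmul, legL, Commute, SemiconjBy, (commute_single h a c).eq]

theorem comulId_gaugeR :
    comulId (gaugeComul 𝒢) Rg = leg₁₃ _ Rg * leg₂₃ _ Rg := by
  refine map_gaugeR_eq_mul _ _ _ (fun x => ?_) fun x y h => (leg_commute h _ _).1
  have h := RibbonHopfStar.comul_id_R (A := 𝒢 x)
  have h' := congrArg (Algebra.TensorProduct.map (single₂ 𝒢 x) (single x)) h
  rw [map_mul] at h'
  have e : ∀ (f : Gauge 𝒢 →ₐ[ℂ] Gauge 𝒢 ⊗[ℂ] Gauge 𝒢) (g : 𝒢 x →ₐ[ℂ] 𝒢 x ⊗[ℂ] 𝒢 x)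
      (_ : ∀ a, f (single x a) = single₂ 𝒢 x (g a)) (t : 𝒢 x ⊗[ℂ] 𝒢 x),
      Algebra.TensorProduct.map (single₂ 𝒢 x) (single x)
        (Algebra.TensorProduct.map g (AlgHom.id ℂ (𝒢 x)) t)
      = Algebra.TensorProduct.map f (AlgHom.id ℂ (Gauge 𝒢)) (single₂ 𝒢 x t) := by
    intro f g hfg t
    induction t using TensorProduct.induction_on with
    | zero => simp
    | add s t hs ht => simp only [map_add, hs, ht]
    | tmul a b => simp [single₂_tmul, hfg]
  rw [e (gaugeComul 𝒢) _ (fun a => gaugeComul_single x a),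
    e (legL _) _ (fun a => by simp [legL, single₂_tmul]),
    e (legR _) _ (fun a => by simp [legR, single₂_tmul])] at h'
  exact h'

theorem idComul_gaugeR :
    idComul (gaugeComul 𝒢) Rg = leg₁₃ _ Rg * leg₁₂ _ Rg := by
  refine map_gaugeR_eq_mul _ _ _ (fun x => ?_) fun x y h => (leg_commute h _ _).2
  have h := RibbonHopfStar.id_comul_R (A := 𝒢 x)
  have h' := congrArg (fun t => (Algebra.TensorProduct.assoc ℂ ℂ ℂ _ _ _).symm
    (Algebra.TensorProduct.map (single x) (single₂ 𝒢 x) t)) h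
  simp only [map_mul] at h'
  have e : ∀ (f : Gauge 𝒢 →ₐ[ℂ] Gauge 𝒢 ⊗[ℂ] Gauge 𝒢) (g : 𝒢 x →ₐ[ℂ] 𝒢 x ⊗[ℂ] 𝒢 x)
      (_ : ∀ a, f (single x a) = single₂ 𝒢 x (g a)) (t : 𝒢 x ⊗[ℂ] 𝒢 x),
      Algebra.TensorProduct.map (single x) (single₂ 𝒢 x)
        (Algebra.TensorProduct.map (AlgHom.id ℂ (𝒢 x)) g t)
      = Algebra.TensorProduct.map (AlgHom.id ℂ (Gauge 𝒢)) f (single₂ 𝒢 x t) := by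
    intro f g hfg t
    induction t using TensorProduct.induction_on with
    | zero => simp
    | add s t hs ht => simp only [map_add, hs, ht]
    | tmul a b => simp [single₂_tmul, hfg]
  rw [e (gaugeComul 𝒢) _ (fun a => gaugeComul_single x a),
    e (legL _) (legL _) (fun a => by simp [legL, single₂_tmul]),
    e (legR _) (legR _) (fun a => by simp [legR, single₂_tmul]), assoc_symm_map_legL,
    assoc_symm_map_legR] at h'
  exact h'

theorem isCocycle_gaugeR_inv : IsCocycle (gaugeComul 𝒢) Rgi :=
  isCocycle_inv gaugeR_comul comulId_gaugeR idComul_gaugeR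

end GaugeFacts

/-! ### Unitarity of the vertex representations -/

section VertexReps

variable {V : Type*} {𝒢 : V → Type*} [∀ x, Ring (𝒢 x)] [∀ x, HopfAlgebra ℂ (𝒢 x)]
  [∀ x, StarRing (𝒢 x)] [∀ x, StarModule ℂ (𝒢 x)] [∀ x, RibbonHopfStar (𝒢 x)]
  {H : Type*} [Ring H] [HopfAlgebra ℂ H] [StarRing H] [StarModule ℂ H] [RibbonHopfStar H]
  {Lab : Type*} (T : ∀ x, TwistEquiv (𝒢 x) H) (ρ : UnitaryIrreps H Lab)

theorem vertexRep_star (I : Lab) (x : V) (a : 𝒢 x) :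
    vertexRep T ρ I x (star a) = (vertexRep T ρ I x a).conjTranspose := by
  change (ρ.rep I) ((T x).ι (star a)) = ((ρ.rep I) ((T x).ι a)).conjTranspose
  rw [map_star, map_star]
  rfl

end VertexReps

/-! ### Unitarity of tensor products -/

section StarTensor

variable {A : Type*} [Ring A] [Algebra ℂ A] [StarRing A] [StarModule ℂ A]
  {m n : Type*} [Fintype m] [DecidableEq m] [Fintype n] [DecidableEq n]

theorem tensorRepHom_star (τ : A →ₐ[ℂ] Matrix m m ℂ) (σ : A →ₐ[ℂ] Matrix n n ℂ)
    (hτ : ∀ a, τ (star a) = (τ a).conjTranspose) (hσ : ∀ a, σ (star a) = (σ a).conjTranspose)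
    (t : A ⊗[ℂ] A) : tensorRepHom τ σ (star t) = (tensorRepHom τ σ t).conjTranspose := by
  induction t using TensorProduct.induction_on with
  | zero => simp
  | add s t hs ht => simp [hs, ht]
  | tmul a b => rw [TensorProduct.star_tmul, tensorRepHom_tmul, tensorRepHom_tmul, hτ, hσ,
      Matrix.conjTranspose_kronecker]

end StarTensor

/-! ### Unitarity of R and F in terms of the componentwise star -/

section RStar

variable {A : Type*} [Ring A] [HopfAlgebra ℂ A] [StarRing A] [StarModule ℂ A] [RibbonHopfStar A]

theorem star_swap (t : A ⊗[ℂ] A) : star (swap t) = swap (star t) := by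
  induction t using TensorProduct.induction_on with
  | zero => simp
  | add s t hs ht => simp [hs, ht]
  | tmul a b => simp [TensorProduct.star_tmul]

/-- Adjoint matrices correspond to the componentwise star, whereas unitarity of R and F refers to
the star that reverses the factors. The exchange `swap` accounts for the difference. -/
theorem star_eq_swap_of_flipStar {u : (A ⊗[ℂ] A)ˣ}
    (h : flipStar (u : A ⊗[ℂ] A) = ((u⁻¹ : (A ⊗[ℂ] A)ˣ) : A ⊗[ℂ] A)) :
    star (u : A ⊗[ℂ] A) = swap ((u⁻¹ : (A ⊗[ℂ] A)ˣ) : A ⊗[ℂ] A) ∧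
      star ((u⁻¹ : (A ⊗[ℂ] A)ˣ) : A ⊗[ℂ] A) = swap (u : A ⊗[ℂ] A) := by
  have h₁ : star (u : A ⊗[ℂ] A) = swap ((u⁻¹ : (A ⊗[ℂ] A)ˣ) : A ⊗[ℂ] A) := by
    rw [← h, flipStar, swap_swap]
  refine ⟨h₁, ?_⟩
  have h₂ := congrArg swap (congrArg star h₁)
  rw [star_star, star_swap, swap_swap] at h₂
  exact h₂.symm

theorem star_Rmat : star (Rmat A : A ⊗[ℂ] A)
    = swap (((Rmat A)⁻¹ : (A ⊗[ℂ] A)ˣ) : A ⊗[ℂ] A) :=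
  (star_eq_swap_of_flipStar RibbonHopfStar.R_star).1

theorem star_Rmat_inv : star (((Rmat A)⁻¹ : (A ⊗[ℂ] A)ˣ) : A ⊗[ℂ] A)
    = swap (Rmat A : A ⊗[ℂ] A) :=
  (star_eq_swap_of_flipStar RibbonHopfStar.R_star).2

end RStar

/-! ### Link representations, complex conjugation and η -/

section LinkReps

variable {V L : Type*} [Fintype V] {𝒢 : V → Type*} [∀ x, Ring (𝒢 x)] [∀ x, HopfAlgebra ℂ (𝒢 x)]
  [∀ x, StarRing (𝒢 x)] [∀ x, StarModule ℂ (𝒢 x)] [∀ x, RibbonHopfStar (𝒢 x)]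
  {H : Type*} [Ring H] [HopfAlgebra ℂ H] [StarRing H] [StarModule ℂ H] [RibbonHopfStar H]
  {Lab : Type*} (Γ : CiliatedGraph V L) (T : ∀ x, TwistEquiv (𝒢 x) H) (ρ : UnitaryIrreps H Lab)

theorem source_rev (i : L) : Γ.source (Γ.rev i) = Γ.target i := by
  rw [CiliatedGraph.source, Γ.rev_rev]

theorem target_rev (i : L) : Γ.target (Γ.rev i) = Γ.source i := rfl

theorem source_ne_target (i : L) : Γ.source i ≠ Γ.target i := Γ.no_loop i

theorem linkRep_single (I : Lab) (i : L) (z : V) (a : 𝒢 z) :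
    linkRep Γ T ρ I i (single z a) = linkRepAt Γ T ρ I i z a := piLift_single _ _ z a

/-- The identity appears as a transpose to fit the shape ᵗA ⊗ B of `kronecker_eq_stMat` and
`kronecker_mul_cgMat`. -/
theorem linkRep_single_target (I : Lab) (i : L) {z : V} (hz : z = Γ.target i) (a : 𝒢 z) :
    linkRep Γ T ρ I i (single z a) = (1 : Matrix _ _ ℂ).transpose ⊗ₖ vertexRep T ρ I z a := by
  rw [linkRep_single, linkRepAt, if_pos hz, Matrix.transpose_one]
  rfl

theorem linkRep_single_source (I : Lab) (i : L) {z : V} (hz : z = Γ.source i) (a : 𝒢 z) :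
    linkRep Γ T ρ I i (single z a)
      = (vertexRep T ρ I z (HopfAlgebra.antipode ℂ a)).transpose ⊗ₖ 1 := by
  rw [linkRep_single, linkRepAt, if_neg (hz ▸ source_ne_target Γ i), if_pos hz]
  rfl

theorem linkRep_single_other (I : Lab) (i : L) {z : V} (hz : z ≠ Γ.target i)
    (hz' : z ≠ Γ.source i) (a : 𝒢 z) :
    linkRep Γ T ρ I i (single z a) = Coalgebra.counit (R := ℂ) a • 1 := by
  rw [linkRep_single, linkRepAt, if_neg hz, if_neg hz', ← Algebra.algebraMap_eq_smul_one]
  rfl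

/-- The matrix `η^{I,i}`. -/
def etaMat (I : Lab) (i : L) : Matrix (Fin (ρ.dim I) × Fin (ρ.dim I))
    (Fin (ρ.dim I) × Fin (ρ.dim I)) ℂ := Matrix.of (linkEta Γ T ρ I i)

theorem etaMat_apply (I : Lab) (i : L) (β α : Fin (ρ.dim I) × Fin (ρ.dim I)) :
    etaMat Γ T ρ I i β α = (1 : Matrix _ _ ℂ) β.2 α.1
      * vertexRep T ρ I (Γ.target i) (antipodeDrinfeld _) α.2 β.1 := rfl

/-- Entrywise complex conjugation of matrices. -/
abbrev conjMat (n : Type*) [Fintype n] [DecidableEq n] : Matrix n n ℂ →+* Matrix n n ℂ :=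
  (starRingEnd ℂ).mapMatrix

/-- By unitarity the conjugate of τ(a) is the transpose of τ(a^*). At the target the claim becomes
a^*w = w𝒮²(a^*), which is the reason for the factor 𝒮(u) in η; at the source it only needs that 𝒮
commutes with the star, and elsewhere that ε does and is 𝒮-invariant. -/
theorem etaMat_conj (I : Lab) (i : L) (z : V) (a : 𝒢 z) :
    etaMat Γ T ρ I i * conjMat _ (linkRep Γ T ρ I i (single z a))
      = linkRep Γ T ρ I (Γ.rev i) (single z (HopfAlgebra.antipode ℂ (star a)))
        * etaMat Γ T ρ I i := by
  by_cases h₁ : z = Γ.target i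
  · subst h₁
    rw [linkRep_single_target Γ T ρ I i rfl, linkRep_single_source Γ T ρ I _ (source_rev Γ i).symm]
    have h := congrArg (vertexRep T ρ I _) (mul_antipodeDrinfeld (star a))
    simp only [map_mul, vertexRep_star] at h
    ext β α
    have h' := congrFun (congrFun h α.2) β.1
    simp only [Matrix.mul_apply, Matrix.conjTranspose_apply] at h'
    simp only [Matrix.mul_apply, Fintype.sum_prod_type, etaMat_apply, RingHom.mapMatrix_apply,
      Matrix.map_apply, Matrix.kroneckerMap_apply, Matrix.transpose_one, Matrix.transpose_apply,
      Matrix.one_apply]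
    by_cases hβ : β.2 = α.1
    · simpa [hβ, mul_comm] using h'
    · simp [hβ]
  · by_cases h₂ : z = Γ.source i
    · subst h₂
      rw [linkRep_single_source Γ T ρ I i rfl, linkRep_single_target Γ T ρ I _ (target_rev Γ i).symm,
        RibbonHopfStar.antipode_star, vertexRep_star]
      ext β α
      simp only [Matrix.mul_apply, Fintype.sum_prod_type, etaMat_apply, RingHom.mapMatrix_apply,
        Matrix.map_apply, Matrix.kroneckerMap_apply, Matrix.transpose_one, Matrix.transpose_apply,
        Matrix.one_apply, Matrix.conjTranspose_apply]
      simp [apply_ite (starRingEnd ℂ), mul_comm]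
    · rw [linkRep_single_other Γ T ρ I i h₁ h₂, linkRep_single_other Γ T ρ I _ h₂
        (by rwa [source_rev]), HopfAlgebra.counit_antipode, RibbonHopfStar.counit_star]
      ext β α
      simp [Matrix.mul_apply, Matrix.one_apply, apply_ite (starRingEnd ℂ), mul_comm]

variable {ρ} in
/-- The representation `τ^{I,i} ⊗ τ^{J,j}` of `𝒢 ⊗ 𝒢`. -/
abbrev linkRep₂ (I J : Lab) (i j : L) : (Gauge 𝒢 ⊗[ℂ] Gauge 𝒢) →ₐ[ℂ] Matrix
    ((Fin (ρ.dim I) × Fin (ρ.dim I)) × (Fin (ρ.dim J) × Fin (ρ.dim J)))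
    ((Fin (ρ.dim I) × Fin (ρ.dim I)) × (Fin (ρ.dim J) × Fin (ρ.dim J))) ℂ :=
  tensorRepHom (linkRep Γ T ρ I i) (linkRep Γ T ρ J j)

/-- `q` and `q'` are exchanged by complex conjugation and `η`. -/
def EtaConj (I J : Lab) (i j : L) (q q' : Gauge 𝒢 ⊗[ℂ] Gauge 𝒢) : Prop :=
  (etaMat Γ T ρ I i ⊗ₖ etaMat Γ T ρ J j) * conjMat _ (linkRep₂ Γ T (ρ := ρ) I J i j q)
    = linkRep₂ Γ T (ρ := ρ) I J (Γ.rev i) (Γ.rev j) q' * (etaMat Γ T ρ I i ⊗ₖ etaMat Γ T ρ J j)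

variable {Γ T ρ}

theorem EtaConj.mul {I J : Lab} {i j : L} {q₁ q₁' q₂ q₂' : Gauge 𝒢 ⊗[ℂ] Gauge 𝒢}
    (h₁ : EtaConj Γ T ρ I J i j q₁ q₁') (h₂ : EtaConj Γ T ρ I J i j q₂ q₂') :
    EtaConj Γ T ρ I J i j (q₁ * q₂) (q₁' * q₂') := by
  unfold EtaConj at *
  rw [map_mul, map_mul, ← mul_assoc, h₁, mul_assoc, h₂, map_mul, mul_assoc]

theorem EtaConj.one {I J : Lab} {i j : L} : EtaConj Γ T ρ I J i j 1 1 := by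
  unfold EtaConj
  rw [map_one, map_one, map_one, one_mul, mul_one]

/-- The two legs are independent, so `etaMat_conj` applies to each. -/
theorem etaConj_single₂ (I J : Lab) (i j : L) (z : V) (t : 𝒢 z ⊗[ℂ] 𝒢 z) :
    EtaConj Γ T ρ I J i j (single₂ 𝒢 z t) (single₂ 𝒢 z (antipode₂ _ (star t))) := by
  unfold EtaConj
  induction t using TensorProduct.induction_on with
  | zero => simp
  | add s t hs ht => simp only [star_add, map_add, mul_add, add_mul, hs, ht]
  | tmul a b =>
    have e : ∀ (M : Matrix (Fin (ρ.dim I) × Fin (ρ.dim I)) (Fin (ρ.dim I) × Fin (ρ.dim I)) ℂ)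
        (N : Matrix (Fin (ρ.dim J) × Fin (ρ.dim J)) (Fin (ρ.dim J) × Fin (ρ.dim J)) ℂ),
        conjMat _ (M ⊗ₖ N) = conjMat _ M ⊗ₖ conjMat _ N := by
      intro M N
      ext p q
      simp
    rw [TensorProduct.star_tmul, antipode₂_tmul, single₂_tmul, single₂_tmul, tensorRepHom_tmul,
      tensorRepHom_tmul, e, ← Matrix.mul_kronecker_mul, ← Matrix.mul_kronecker_mul, etaMat_conj,
      etaMat_conj]

/-- The predicate lives on units so that it may speak of R and R⁻¹ together; commutation of the two
factors is supplied because inversion reverses products. -/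
theorem gaugeR_induction (P : (Gauge 𝒢 ⊗[ℂ] Gauge 𝒢)ˣ → Prop) (one : P 1)
    (vertex : ∀ x, P (vertexR 𝒢 x)) (mul : ∀ a b, Commute a b → P a → P b → P (a * b)) :
    P (gaugeR 𝒢) := by
  classical
  rw [gaugeR_eq]
  suffices h : ∀ s : Finset V, P (s.noncommProd (vertexR 𝒢)
      (fun _ _ _ _ h => commute_vertexR h)) from h _
  intro s
  induction s using Finset.induction_on with
  | empty => exact (Finset.noncommProd_empty (vertexR 𝒢) _).symm ▸ one
  | insert x s hx ih =>
    have e := Finset.noncommProd_insert_of_notMem s x (vertexR 𝒢)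
      (fun _ _ _ _ h => commute_vertexR h) hx
    refine e ▸ mul _ _ ?_ (vertex x) ih
    refine Finset.noncommProd_commute _ _ _ _ fun y hy => ?_
    exact commute_vertexR (fun h => hx (h ▸ hy))

/-- At each vertex the componentwise star of Rₓ is (Rₓ⁻¹)', and 𝒮 ⊗ 𝒮 leaves it fixed. -/
theorem etaConj_gaugeR (I J : Lab) (i j : L) : EtaConj Γ T ρ I J i j
    (gaugeR 𝒢 : Gauge 𝒢 ⊗[ℂ] Gauge 𝒢)
    (swap (((gaugeR 𝒢)⁻¹ : (Gauge 𝒢 ⊗[ℂ] Gauge 𝒢)ˣ) : Gauge 𝒢 ⊗[ℂ] Gauge 𝒢)) := by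
  refine gaugeR_induction (𝒢 := 𝒢) (fun u => EtaConj Γ T ρ I J i j (u : Gauge 𝒢 ⊗[ℂ] Gauge 𝒢)
    (swap ((u⁻¹ : (Gauge 𝒢 ⊗[ℂ] Gauge 𝒢)ˣ) : Gauge 𝒢 ⊗[ℂ] Gauge 𝒢))) ?_ (fun x => ?_) ?_
  · simpa using EtaConj.one
  · rw [coe_vertexR, coe_vertexR_inv, swap_single₂, ← antipode₂_Rmat_inv, ← antipode₂_swap,
      ← star_Rmat]
    exact etaConj_single₂ I J i j x _
  · intro a b hab ha hb
    have : (a * b)⁻¹ = a⁻¹ * b⁻¹ := by rw [hab.eq, mul_inv_rev]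
    rw [this, Units.val_mul, Units.val_mul, map_mul]
    exact ha.mul hb

end LinkReps

/-! ### Matrices that act separately on source and target indices -/

section StMat

variable {m n k : Type*} [Fintype m] [DecidableEq m] [Fintype n] [DecidableEq n]

/-- The matrix `ᵗX ⊗ Y` on `(ℂᵐ ⊗ ℂᵐ) ⊗ (ℂⁿ ⊗ ℂⁿ)`, with `X` acting on the first and `Y` on the
second index of each pair. -/
def stMat (X Y : Matrix (m × n) (m × n) ℂ) : Matrix ((m × m) × (n × n)) ((m × m) × (n × n)) ℂ :=
  Matrix.of fun p q => X (q.1.1, q.2.1) (p.1.1, p.2.1) * Y (p.1.2, p.2.2) (q.1.2, q.2.2)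

theorem stMat_apply (X Y : Matrix (m × n) (m × n) ℂ) (p q : (m × m) × (n × n)) :
    stMat X Y p q = X (q.1.1, q.2.1) (p.1.1, p.2.1) * Y (p.1.2, p.2.2) (q.1.2, q.2.2) := rfl

/-- Regrouping of indices. -/
theorem sum_regroup {M : Type*} [AddCommMonoid M] (f : (m × m) × (n × n) → M) :
    ∑ p, f p = ∑ u : m × n, ∑ v : m × n, f ((u.1, v.1), (u.2, v.2)) := by
  rw [← Fintype.sum_prod_type']
  exact Fintype.sum_equiv (Equiv.prodProdProdComm m m n n) _ _ fun p => rfl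

theorem stMat_mul (X Y X' Y' : Matrix (m × n) (m × n) ℂ) :
    stMat X Y * stMat X' Y' = stMat (X' * X) (Y * Y') := by
  ext p q
  rw [Matrix.mul_apply, sum_regroup, stMat_apply, Matrix.mul_apply, Matrix.mul_apply,
    Finset.sum_mul_sum]
  refine Finset.sum_congr rfl fun u _ => Finset.sum_congr rfl fun v _ => ?_
  simp only [stMat_apply]
  ring

theorem stMat_one : stMat (1 : Matrix (m × n) (m × n) ℂ) 1 = 1 := by
  ext ⟨⟨a, b⟩, ⟨c, d⟩⟩ ⟨⟨a', b'⟩, ⟨c', d'⟩⟩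
  simp only [stMat_apply, Matrix.one_apply, Prod.mk.injEq]
  split_ifs <;> first | rfl | simp_all

theorem stMat_add_left (X X' Y : Matrix (m × n) (m × n) ℂ) :
    stMat (X + X') Y = stMat X Y + stMat X' Y := by
  ext p q; simp [stMat_apply, add_mul]

theorem stMat_add_right (X Y Y' : Matrix (m × n) (m × n) ℂ) :
    stMat X (Y + Y') = stMat X Y + stMat X Y' := by
  ext p q; simp [stMat_apply, mul_add]

theorem stMat_zero_left (Y : Matrix (m × n) (m × n) ℂ) : stMat 0 Y = 0 := by
  ext p q; simp [stMat_apply]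

theorem stMat_zero_right (X : Matrix (m × n) (m × n) ℂ) : stMat X 0 = 0 := by
  ext p q; simp [stMat_apply]

theorem kronecker_eq_stMat (A B : Matrix m m ℂ) (A' B' : Matrix n n ℂ) :
    (A.transpose ⊗ₖ B) ⊗ₖ (A'.transpose ⊗ₖ B') = stMat (A ⊗ₖ A') (B ⊗ₖ B') := by
  ext p q
  simp only [Matrix.kroneckerMap_apply, stMat_apply, Matrix.transpose_apply]
  ring

/-- The matrix with entries `D_{p, γ₁} C_{γ₂, p'}`. -/
def cgMat (D : Matrix (m × n) k ℂ) (C : Matrix k (m × n) ℂ) :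
    Matrix (k × k) ((m × m) × (n × n)) ℂ :=
  Matrix.of fun γ p => D (p.1.1, p.2.1) γ.1 * C γ.2 (p.1.2, p.2.2)

theorem cgMat_apply (D : Matrix (m × n) k ℂ) (C : Matrix k (m × n) ℂ) (γ : k × k)
    (p : (m × m) × (n × n)) :
    cgMat D C γ p = D (p.1.1, p.2.1) γ.1 * C γ.2 (p.1.2, p.2.2) := rfl

theorem cgMat_mul_stMat (D : Matrix (m × n) k ℂ) (C : Matrix k (m × n) ℂ)
    (X Y : Matrix (m × n) (m × n) ℂ) :
    cgMat D C * stMat X Y = cgMat (X * D) (C * Y) := by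
  ext γ q
  rw [Matrix.mul_apply, sum_regroup, cgMat_apply, Matrix.mul_apply, Matrix.mul_apply,
    Finset.sum_mul_sum]
  refine Finset.sum_congr rfl fun u _ => Finset.sum_congr rfl fun v _ => ?_
  simp only [stMat_apply, cgMat_apply]
  ring

theorem kronecker_mul_cgMat [Fintype k] (M N : Matrix k k ℂ) (D : Matrix (m × n) k ℂ)
    (C : Matrix k (m × n) ℂ) :
    (M.transpose ⊗ₖ N) * cgMat D C = cgMat (D * M) (N * C) := by
  ext γ q
  rw [Matrix.mul_apply, Fintype.sum_prod_type, cgMat_apply, Matrix.mul_apply, Matrix.mul_apply,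
    Finset.sum_mul_sum]
  refine Finset.sum_congr rfl fun u _ => Finset.sum_congr rfl fun v _ => ?_
  simp only [Matrix.kroneckerMap_apply, cgMat_apply, Matrix.transpose_apply]
  ring

end StMat

/-! ### The R-matrix in pairs of link representations -/

section LinkRep₂

variable {V L : Type*} [Fintype V] {𝒢 : V → Type*} [∀ x, Ring (𝒢 x)] [∀ x, HopfAlgebra ℂ (𝒢 x)]
  [∀ x, StarRing (𝒢 x)] [∀ x, StarModule ℂ (𝒢 x)] [∀ x, RibbonHopfStar (𝒢 x)]
  {H : Type*} [Ring H] [HopfAlgebra ℂ H] [StarRing H] [StarModule ℂ H] [RibbonHopfStar H]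
  {Lab : Type*} (Γ : CiliatedGraph V L) (T : ∀ x, TwistEquiv (𝒢 x) H) {ρ : UnitaryIrreps H Lab}

variable (ρ) in
/-- The representation `τ^I_x ⊗ τ^J_x`. -/
abbrev vertexRep₂ (I J : Lab) (x : V) : (𝒢 x ⊗[ℂ] 𝒢 x) →ₐ[ℂ] Matrix
    (Fin (ρ.dim I) × Fin (ρ.dim J)) (Fin (ρ.dim I) × Fin (ρ.dim J)) ℂ :=
  tensorRepHom (vertexRep T ρ I x) (vertexRep T ρ J x)

theorem linkRep₂_target (I J : Lab) {i j : L} {z : V} (hi : z = Γ.target i) (hj : z = Γ.target j)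
    (t : 𝒢 z ⊗[ℂ] 𝒢 z) : linkRep₂ Γ T (ρ := ρ) I J i j (single₂ 𝒢 z t)
      = stMat 1 (vertexRep₂ T ρ I J z t) := by
  induction t using TensorProduct.induction_on with
  | zero => simp only [map_zero, stMat_zero_right]
  | add s t hs ht => simp only [map_add, stMat_add_right, hs, ht]
  | tmul a b =>
    rw [single₂_tmul, tensorRepHom_tmul, linkRep_single_target Γ T ρ I i hi,
      linkRep_single_target Γ T ρ J j hj, kronecker_eq_stMat, tensorRepHom_tmul,
      Matrix.one_kronecker_one]

theorem linkRep₂_source (I J : Lab) {i j : L} {z : V} (hi : z = Γ.source i) (hj : z = Γ.source j)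
    (t : 𝒢 z ⊗[ℂ] 𝒢 z) : linkRep₂ Γ T (ρ := ρ) I J i j (single₂ 𝒢 z t)
      = stMat (vertexRep₂ T ρ I J z (antipode₂ _ t)) 1 := by
  induction t using TensorProduct.induction_on with
  | zero => simp only [map_zero, stMat_zero_left]
  | add s t hs ht => simp only [map_add, stMat_add_left, hs, ht]
  | tmul a b =>
    have e : ∀ (M : Matrix (Fin (ρ.dim I)) (Fin (ρ.dim I)) ℂ)
        (N : Matrix (Fin (ρ.dim J)) (Fin (ρ.dim J)) ℂ),
        (M.transpose ⊗ₖ (1 : Matrix (Fin (ρ.dim I)) (Fin (ρ.dim I)) ℂ))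
          ⊗ₖ (N.transpose ⊗ₖ (1 : Matrix (Fin (ρ.dim J)) (Fin (ρ.dim J)) ℂ))
        = stMat (M ⊗ₖ N) 1 := by
      intro M N
      rw [kronecker_eq_stMat, Matrix.one_kronecker_one]
    rw [single₂_tmul, tensorRepHom_tmul, linkRep_single_source Γ T ρ I i hi,
      linkRep_single_source Γ T ρ J j hj, e, antipode₂_tmul, tensorRepHom_tmul]

/-- Away from the endpoints of i the first leg acts by the co-unit, and (ε ⊗ id)(R) = 1. Hence only
common endpoints of i and j contribute to the braid matrix. -/
theorem linkRep₂_other_left (I J : Lab) {i : L} (j : L) {z : V} (hi : z ≠ Γ.target i)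
    (hi' : z ≠ Γ.source i) :
    linkRep₂ Γ T (ρ := ρ) I J i j (single₂ 𝒢 z (Rmat (𝒢 z))) = 1 := by
  obtain ⟨s, hs⟩ := exists_sum_Rmat (𝒢 z)
  have h := congrArg (fun a => (1 : Matrix (Fin (ρ.dim I) × Fin (ρ.dim I))
    (Fin (ρ.dim I) × Fin (ρ.dim I)) ℂ) ⊗ₖ linkRep Γ T ρ J j (single z a))
    (counit_id_Rmat hs)
  simp only [map_one, Matrix.one_kronecker_one] at h
  rw [← h, hs]
  simp only [map_sum, map_smul, single₂_tmul, tensorRepHom_tmul,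
    linkRep_single_other Γ T ρ I i hi hi']
  ext p q
  simp only [Matrix.sum_apply, Matrix.kroneckerMap_apply, Matrix.smul_apply, smul_eq_mul,
    Finset.mul_sum]
  exact Finset.sum_congr rfl fun p _ => by ring

theorem linkRep₂_other_right (I J : Lab) (i : L) {j : L} {z : V} (hj : z ≠ Γ.target j)
    (hj' : z ≠ Γ.source j) :
    linkRep₂ Γ T (ρ := ρ) I J i j (single₂ 𝒢 z (Rmat (𝒢 z))) = 1 := by
  obtain ⟨s, hs⟩ := exists_sum_Rmat (𝒢 z)
  have h := congrArg (fun a => linkRep Γ T ρ I i (single z a) ⊗ₖ (1 : Matrix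
    (Fin (ρ.dim J) × Fin (ρ.dim J)) (Fin (ρ.dim J) × Fin (ρ.dim J)) ℂ)) (id_counit_Rmat hs)
  simp only [map_one, Matrix.one_kronecker_one] at h
  rw [← h, hs]
  simp only [map_sum, map_smul, single₂_tmul, tensorRepHom_tmul,
    linkRep_single_other Γ T ρ J j hj hj']
  ext p q
  simp only [Matrix.sum_apply, Matrix.kroneckerMap_apply, Matrix.smul_apply, smul_eq_mul,
    Finset.sum_mul]
  exact Finset.sum_congr rfl fun p _ => by ring

theorem map_gaugeR_of_vertex {D : Type*} [Ring D] [Algebra ℂ D]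
    (f : (Gauge 𝒢 ⊗[ℂ] Gauge 𝒢) →ₐ[ℂ] D) (x : V)
    (h : ∀ z, z ≠ x → f (single₂ 𝒢 z (Rmat (𝒢 z))) = 1) :
    f (gaugeR 𝒢 : Gauge 𝒢 ⊗[ℂ] Gauge 𝒢) = f (single₂ 𝒢 x (Rmat (𝒢 x))) := by
  classical
  rw [map_gaugeR]
  refine (Finset.mul_noncommProd_erase Finset.univ (Finset.mem_univ x) _ _).symm.trans ?_
  refine (congrArg _ ((Finset.noncommProd_eq_pow_card _ _ _ 1 fun z hz =>
    h z (Finset.ne_of_mem_erase hz)).trans (one_pow _))).trans (mul_one _)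

theorem map_gaugeR_of_vertices {D : Type*} [Ring D] [Algebra ℂ D]
    (f : (Gauge 𝒢 ⊗[ℂ] Gauge 𝒢) →ₐ[ℂ] D) {x y : V} (hxy : x ≠ y)
    (h : ∀ z, z ≠ x → z ≠ y → f (single₂ 𝒢 z (Rmat (𝒢 z))) = 1) :
    f (gaugeR 𝒢 : Gauge 𝒢 ⊗[ℂ] Gauge 𝒢)
      = f (single₂ 𝒢 x (Rmat (𝒢 x))) * f (single₂ 𝒢 y (Rmat (𝒢 y))) := by
  classical
  rw [map_gaugeR]
  refine (Finset.mul_noncommProd_erase Finset.univ (Finset.mem_univ x) _ _).symm.trans ?_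
  refine congrArg _ ((Finset.mul_noncommProd_erase (Finset.univ.erase x)
    (Finset.mem_erase.2 ⟨hxy.symm, Finset.mem_univ y⟩) _ _).symm.trans ?_)
  refine (congrArg _ ((Finset.noncommProd_eq_pow_card _ _ _ 1 fun z hz => ?_).trans
    (one_pow _))).trans (mul_one _)
  have hz' := Finset.mem_erase.1 hz
  exact h z (Finset.ne_of_mem_erase hz'.2) hz'.1

theorem map_gaugeR_inv_of_vertices {D : Type*} [Ring D] [Algebra ℂ D]
    (f : (Gauge 𝒢 ⊗[ℂ] Gauge 𝒢) →ₐ[ℂ] D) {x y : V} (hxy : x ≠ y)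
    (h : ∀ z, z ≠ x → z ≠ y → f (single₂ 𝒢 z (Rmat (𝒢 z))) = 1) :
    f (((gaugeR 𝒢)⁻¹ : (Gauge 𝒢 ⊗[ℂ] Gauge 𝒢)ˣ) : Gauge 𝒢 ⊗[ℂ] Gauge 𝒢)
      = f (single₂ 𝒢 x (((Rmat (𝒢 x))⁻¹ : (𝒢 x ⊗[ℂ] 𝒢 x)ˣ) : 𝒢 x ⊗[ℂ] 𝒢 x))
        * f (single₂ 𝒢 y (((Rmat (𝒢 y))⁻¹ : (𝒢 y ⊗[ℂ] 𝒢 y)ˣ) : 𝒢 y ⊗[ℂ] 𝒢 y)) := by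
  have c : Commute (f (single₂ 𝒢 x (Rmat (𝒢 x)))) (f (single₂ 𝒢 y (Rmat (𝒢 y)))) :=
    (commute_single₂ 𝒢 hxy _ _).map f
  have e : ∀ z, f (single₂ 𝒢 z (Rmat (𝒢 z)))
      * f (single₂ 𝒢 z (((Rmat (𝒢 z))⁻¹ : (𝒢 z ⊗[ℂ] 𝒢 z)ˣ) : 𝒢 z ⊗[ℂ] 𝒢 z)) = 1 := by
    intro z
    rw [← map_mul, ← map_mul, Units.mul_inv, map_one, map_one]
  have h₁ : f (((gaugeR 𝒢)⁻¹ : (Gauge 𝒢 ⊗[ℂ] Gauge 𝒢)ˣ) : Gauge 𝒢 ⊗[ℂ] Gauge 𝒢)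
      * f (gaugeR 𝒢 : Gauge 𝒢 ⊗[ℂ] Gauge 𝒢) = 1 := by
    rw [← map_mul, Units.inv_mul, map_one]
  refine left_inv_eq_right_inv h₁ ?_
  rw [map_gaugeR_of_vertices f hxy h, c.eq, mul_assoc, ← mul_assoc (f (single₂ 𝒢 x _)), e, one_mul,
    e]

/-- `(τ^{I,i} ⊗ τ^{J,i})(R)` -/
theorem linkRep₂_gaugeR (I J : Lab) {i j : L} (ht : Γ.target i = Γ.target j)
    (hs : Γ.source i = Γ.source j) :
    linkRep₂ Γ T (ρ := ρ) I J i j (gaugeR 𝒢 : Gauge 𝒢 ⊗[ℂ] Gauge 𝒢)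
      = stMat (vertexRep₂ T ρ I J (Γ.source i) (Rmat (𝒢 (Γ.source i))))
        (vertexRep₂ T ρ I J (Γ.target i) (Rmat (𝒢 (Γ.target i)))) := by
  rw [map_gaugeR_of_vertices _ (source_ne_target Γ i)
    (fun z h₁ h₂ => linkRep₂_other_left Γ T I J j h₂ h₁), linkRep₂_source Γ T I J rfl hs,
    linkRep₂_target Γ T I J rfl ht, antipode₂_Rmat, stMat_mul, one_mul, one_mul]

theorem linkRep₂_gaugeR_inv (I J : Lab) {i j : L} (ht : Γ.target i = Γ.target j)
    (hs : Γ.source i = Γ.source j) :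
    linkRep₂ Γ T (ρ := ρ) I J i j
        (((gaugeR 𝒢)⁻¹ : (Gauge 𝒢 ⊗[ℂ] Gauge 𝒢)ˣ) : Gauge 𝒢 ⊗[ℂ] Gauge 𝒢)
      = stMat (vertexRep₂ T ρ I J (Γ.source i) (((Rmat (𝒢 (Γ.source i)))⁻¹ :
          (𝒢 (Γ.source i) ⊗[ℂ] 𝒢 (Γ.source i))ˣ) : 𝒢 (Γ.source i) ⊗[ℂ] 𝒢 (Γ.source i)))
        (vertexRep₂ T ρ I J (Γ.target i) (((Rmat (𝒢 (Γ.target i)))⁻¹ :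
          (𝒢 (Γ.target i) ⊗[ℂ] 𝒢 (Γ.target i))ˣ) : 𝒢 (Γ.target i) ⊗[ℂ] 𝒢 (Γ.target i))) := by
  rw [map_gaugeR_inv_of_vertices _ (source_ne_target Γ i)
    (fun z h₁ h₂ => linkRep₂_other_left Γ T I J j h₂ h₁), linkRep₂_source Γ T I J rfl hs,
    linkRep₂_target Γ T I J rfl ht, antipode₂_Rmat_inv, stMat_mul, one_mul, one_mul]

/-- The factorization of `(τ^{I,i} ⊗ τ^{J,j})(R)` for two links with the same target. -/
theorem exists_stMat (I J : Lab) {i j : L} (ht : Γ.target i = Γ.target j) :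
    ∃ X Y Y', Y * Y' = 1 ∧
      linkRep₂ Γ T (ρ := ρ) I J i j (gaugeR 𝒢 : Gauge 𝒢 ⊗[ℂ] Gauge 𝒢) = stMat X Y ∧
      linkRep₂ Γ T (ρ := ρ) I J (Γ.rev i) (Γ.rev j) (gaugeR 𝒢 : Gauge 𝒢 ⊗[ℂ] Gauge 𝒢)
        = stMat Y X := by
  have hY : vertexRep₂ T ρ I J (Γ.target i) (Rmat (𝒢 (Γ.target i)))
      * vertexRep₂ T ρ I J (Γ.target i) (((Rmat (𝒢 (Γ.target i)))⁻¹ :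
          (𝒢 (Γ.target i) ⊗[ℂ] 𝒢 (Γ.target i))ˣ) : 𝒢 (Γ.target i) ⊗[ℂ] 𝒢 (Γ.target i)) = 1 := by
    rw [← map_mul, Units.mul_inv, map_one]
  -- As there are no loops, the common target is not a source of i or j. The only other vertex that
  -- can contribute is a common source; if there is none, the source matrix is 1. Reversal of both
  -- links interchanges the two matrices, because 𝒮 ⊗ 𝒮 fixes R.
  by_cases hs : Γ.source i = Γ.source j
  · refine ⟨_, _, _, hY, linkRep₂_gaugeR Γ T I J ht hs, ?_⟩
    rw [map_gaugeR_of_vertices _ (source_ne_target Γ i) (fun z h₁ h₂ =>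
      linkRep₂_other_left Γ T I J _ (by rwa [target_rev]) (by rwa [source_rev])),
      linkRep₂_target Γ T I J (i := Γ.rev i) (j := Γ.rev j) (target_rev Γ i).symm
        (hs.trans (target_rev Γ j).symm), linkRep₂_source Γ T I J (source_rev Γ i).symm
        (ht.trans (source_rev Γ j).symm), antipode₂_Rmat, stMat_mul, mul_one, mul_one]
  · refine ⟨1, _, _, hY, ?_, ?_⟩
    · rw [map_gaugeR_of_vertex _ (Γ.target i), linkRep₂_target Γ T I J rfl ht]
      intro z hz
      by_cases hzi : z = Γ.source i
      · refine linkRep₂_other_right Γ T I J i (ht ▸ hz) ?_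
        rwa [hzi]
      · exact linkRep₂_other_left Γ T I J j hz hzi
    · rw [map_gaugeR_of_vertex _ (Γ.target i), linkRep₂_source Γ T I J (source_rev Γ i).symm
        (ht.trans (source_rev Γ j).symm), antipode₂_Rmat]
      intro z hz
      by_cases hzi : z = Γ.source i
      · refine linkRep₂_other_right Γ T I J _ (by rwa [target_rev, hzi]) ?_
        rw [source_rev]
        exact ht ▸ hz
      · exact linkRep₂_other_left Γ T I J _ (by rwa [target_rev]) (by rwa [source_rev])

end LinkRep₂

/-! ### Clebsch-Gordan maps and their braiding -/

section Core

variable {H : Type*} [Ring H] [HopfAlgebra ℂ H] [StarRing H] [StarModule ℂ H] [RibbonHopfStar H]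
  {Lab : Type*} {ρ : UnitaryIrreps H Lab}

local notation "RH" => (Rmat H : H ⊗[ℂ] H)
local notation "RHi" => (((Rmat H)⁻¹ : (H ⊗[ℂ] H)ˣ) : H ⊗[ℂ] H)

variable (ρ) in
/-- The representation `τ^I ⊗ τ^J`. -/
abbrev rep₂ (I J : Lab) : (H ⊗[ℂ] H) →ₐ[ℂ] Matrix
    (Fin (ρ.dim I) × Fin (ρ.dim J)) (Fin (ρ.dim I) × Fin (ρ.dim J)) ℂ :=
  tensorRepHom (ρ.τ I) (ρ.τ J)

theorem rep_star (I : Lab) (a : H) : ρ.τ I (star a) = (ρ.τ I a).conjTranspose :=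
  map_star (ρ.rep I) a

theorem rep₂_star (I J : Lab) (t : H ⊗[ℂ] H) :
    rep₂ ρ I J (star t) = (rep₂ ρ I J t).conjTranspose :=
  tensorRepHom_star _ _ (rep_star I) (rep_star J) t

theorem rep₂_submatrix (I J : Lab) (t : H ⊗[ℂ] H) :
    (rep₂ ρ J I t).submatrix (Equiv.prodComm _ _) (Equiv.prodComm _ _) = rep₂ ρ I J (swap t) := by
  ext p q
  rw [tensorRepHom_swap]
  rfl

variable (cg : ClebschGordan ρ)

/-- v is unitary, so κ_I² is an invertible scalar on a non-zero space. -/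
theorem kappa_ne_zero (I : Lab) : cg.κ I ≠ 0 := by
  intro h
  have h₁ := cg.κ_sq I
  rw [h, zero_pow two_ne_zero, zero_smul] at h₁
  have h₂ := congrArg (ρ.τ I) (RibbonHopfStar.v_star_mul (A := H))
  rw [map_mul, map_one] at h₂
  change _ * ρ.τ I (ribbon H) = 1 at h₂
  rw [h₁, mul_zero] at h₂
  have hd : ρ.dim I ≠ 0 := (ρ.irrep I).1
  have := congrFun (congrFun h₂ ⟨0, Nat.pos_of_ne_zero hd⟩) ⟨0, Nat.pos_of_ne_zero hd⟩
  simp at this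

/-- The intertwiner `C^a[JI|K] R⁻¹ P : V^I ⊗ V^J → V^K`. -/
def braidedCG (I J K : Lab) (a : Fin (cg.N J I K)) :
    Matrix (Fin (ρ.dim K)) (Fin (ρ.dim I) × Fin (ρ.dim J)) ℂ :=
  (cg.C J I K a * rep₂ ρ J I RHi).submatrix (Equiv.refl _) (Equiv.prodComm _ _)

/-- The flip P turns Δ into Δ', and R⁻¹Δ' = ΔR⁻¹ restores the co-product that C^a[JI|K] intertwines.
-/
theorem braidedCG_intertwine (I J K : Lab) (a : Fin (cg.N J I K)) (ξ : H) :
    braidedCG cg I J K a * rep₂ ρ I J (Coalgebra.comul (R := ℂ) ξ)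
      = ρ.τ K ξ * braidedCG cg I J K a := by
  have h := cg.intertwine J I K a ξ
  rw [tensorRep_eq] at h
  have hR : RHi * swap (Coalgebra.comul (R := ℂ) ξ) = Coalgebra.comul (R := ℂ) ξ * RHi := by
    have := congrArg (fun t => RHi * t * RHi) (Rmat_comul ξ)
    simpa [← mul_assoc, mul_assoc _ RH RHi] using this.symm
  conv_lhs => rw [braidedCG, ← swap_swap (Coalgebra.comul (R := ℂ) ξ), ← rep₂_submatrix,
    Matrix.submatrix_mul_equiv, Matrix.mul_assoc, ← map_mul, hR, map_mul, ← Matrix.mul_assoc, h]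
  conv_rhs => rw [braidedCG, ← Matrix.submatrix_id_id (ρ.τ K ξ), ← Equiv.coe_refl,
    Matrix.submatrix_mul_equiv, ← Matrix.mul_assoc]

theorem braidedCG_conjTranspose (I J K : Lab) (a : Fin (cg.N J I K)) :
    (braidedCG cg I J K a).conjTranspose
      = (rep₂ ρ J I (swap RH) * (cg.C J I K a).conjTranspose).submatrix
        (Equiv.prodComm _ _) (Equiv.refl _) := by
  rw [braidedCG, Matrix.conjTranspose_submatrix, Matrix.conjTranspose_mul, ← rep₂_star,
    star_Rmat_inv]

/-- With PR'P = R and (R⁻¹)^* = R' the product collapses: CR⁻¹ · R · R'C^* = CR'C^*. The value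
κ_Iκ_J/κ_K is symmetric in I and J, so the braided maps have the normalization of the C^b[IJ|K]. -/
theorem braidedCG_pairing (I J K : Lab) (a b : Fin (cg.N J I K)) :
    braidedCG cg I J K a * rep₂ ρ I J (swap RH) * (braidedCG cg I J K b).conjTranspose
      = if a = b then (cg.κ I * cg.κ J / cg.κ K) • 1 else 0 := by
  have h := cg.normalized J I K a b
  rw [tensorRep_eq] at h
  rw [braidedCG_conjTranspose, braidedCG, ← rep₂_submatrix, Matrix.submatrix_mul_equiv,
    Matrix.submatrix_mul_equiv]
  have e : cg.C J I K a * rep₂ ρ J I RHi * rep₂ ρ J I RH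
      * (rep₂ ρ J I (swap RH) * (cg.C J I K b).conjTranspose)
      = cg.C J I K a * rep₂ ρ J I (swap RH) * (cg.C J I K b).conjTranspose := by
    rw [Matrix.mul_assoc (cg.C J I K a), ← map_mul, Units.inv_mul, map_one, Matrix.mul_one,
      Matrix.mul_assoc]
  rw [e, h, mul_comm (cg.κ J)]
  rfl

/-- M is the matrix of coefficients in the basis C^b[IJ|K]. Both families have the same Gram matrix,
a non-zero multiple of 1, for the sesquilinear pairing (A, B) ↦ AR'B^*, and this forces MM^* = 1. -/
theorem exists_braiding (I J K : Lab) :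
    ∃ M : Matrix (Fin (cg.N J I K)) (Fin (cg.N I J K)) ℂ,
      (∀ a, braidedCG cg I J K a = ∑ b, M a b • cg.C I J K b) ∧ M * M.conjTranspose = 1 := by
  have hspan : ∀ a, ∃ c : Fin (cg.N I J K) → ℂ, ∑ b, c b • cg.C I J K b = braidedCG cg I J K a := by
    intro a
    refine (Submodule.mem_span_range_iff_exists_fun ℂ).1 (cg.span I J K _ fun ξ => ?_)
    rw [tensorRep_eq]
    exact braidedCG_intertwine cg I J K a ξ
  choose M hM using hspan
  refine ⟨Matrix.of M, fun a => (hM a).symm, ?_⟩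
  ext a b
  have h := braidedCG_pairing cg I J K a b
  rw [← hM a, ← hM b] at h
  simp only [Matrix.conjTranspose_sum, Matrix.sum_mul, Matrix.mul_sum,
    Matrix.conjTranspose_smul, Matrix.smul_mul, Matrix.mul_smul] at h
  have hn : ∀ c d, cg.C I J K c * rep₂ ρ I J (swap RH) * (cg.C I J K d).conjTranspose
      = if c = d then (cg.κ I * cg.κ J / cg.κ K) • 1 else 0 := by
    intro c d
    rw [← cg.normalized I J K c d, tensorRep_eq]
  simp only [hn, smul_ite, smul_zero] at h
  have hd : ρ.dim K ≠ 0 := (ρ.irrep K).1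
  have h' := congrFun (congrFun h ⟨0, Nat.pos_of_ne_zero hd⟩) ⟨0, Nat.pos_of_ne_zero hd⟩
  have hκ : cg.κ I * cg.κ J / cg.κ K ≠ 0 :=
    div_ne_zero (mul_ne_zero (kappa_ne_zero cg I) (kappa_ne_zero cg J)) (kappa_ne_zero cg K)
  simp only [Finset.sum_ite_eq', Finset.mem_univ, if_true, Matrix.sum_apply,
    Matrix.smul_apply, Matrix.one_apply_eq, smul_eq_mul, mul_one] at h'
  rw [Matrix.mul_apply, Matrix.one_apply]
  simp only [Matrix.conjTranspose_apply, Matrix.of_apply]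
  refine mul_right_cancel₀ hκ ?_
  rw [Finset.sum_mul]
  by_cases hab : a = b
  · simp only [hab, if_true, Matrix.smul_apply, Matrix.one_apply_eq, smul_eq_mul, mul_one] at h' ⊢
    rw [one_mul]
    exact Eq.trans (Finset.sum_congr rfl fun c _ => by ring) h'
  · simp only [hab, if_false, Matrix.zero_apply] at h' ⊢
    rw [zero_mul]
    exact Eq.trans (Finset.sum_congr rfl fun c _ => by ring) h'

/-- MM^* = 1 has full rank, so M has at least as many columns as rows. Exchange of I and J gives
equality of the fusion numbers. -/
theorem fusion_le (I J K : Lab) : cg.N J I K ≤ cg.N I J K := by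
  obtain ⟨M, -, hM⟩ := exists_braiding cg I J K
  have h := Matrix.rank_mul_le_left M M.conjTranspose
  rw [hM, Matrix.rank_one, Fintype.card_fin] at h
  exact h.trans ((Matrix.rank_le_card_width M).trans (by simp))

/-- M is square, so MM^* = 1 implies M^*M = 1, and ∑ C^* ⊗ C does not change under a unitary change
of basis. -/
theorem braidedCG_sum (I J K : Lab) (u v : Fin (ρ.dim I) × Fin (ρ.dim J))
    (γ γ' : Fin (ρ.dim K)) :
    ∑ a, (braidedCG cg I J K a).conjTranspose u γ * braidedCG cg I J K a γ' v
      = ∑ b, (cg.C I J K b).conjTranspose u γ * cg.C I J K b γ' v := by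
  obtain ⟨M, hM, hMM⟩ := exists_braiding cg I J K
  have hM' : M.conjTranspose * M = 1 :=
    (Matrix.mul_eq_one_comm_of_card_eq _ _ ℂ
      (by simpa using le_antisymm (fusion_le cg I J K) (fusion_le cg J I K))).1 hMM
  have h : ∀ b c, ∑ a, star (M a b) * M a c = if b = c then 1 else 0 := by
    intro b c
    rw [← Matrix.one_apply, ← hM', Matrix.mul_apply]
    rfl
  calc _ = ∑ b, ∑ c, (∑ a, star (M a b) * M a c) *
        ((cg.C I J K b).conjTranspose u γ * cg.C I J K c γ' v) := by
        simp only [hM, Finset.sum_mul, Matrix.conjTranspose_sum, Matrix.conjTranspose_smul,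
          Matrix.sum_apply, Matrix.smul_apply, smul_eq_mul, Finset.mul_sum]
        rw [Finset.sum_comm]
        conv_lhs => enter [2, c]; rw [Finset.sum_comm]
        rw [Finset.sum_comm]
        refine Finset.sum_congr rfl fun b _ => Finset.sum_congr rfl fun c _ =>
          Finset.sum_congr rfl fun a _ => by ring
    _ = _ := by
        simp only [h, ite_mul, one_mul, zero_mul, Finset.sum_ite_eq, Finset.mem_univ, if_true]

end Core

/-! ### Twisted Clebsch-Gordan maps at the vertices -/

section VertexCG

variable {V : Type*} {𝒢 : V → Type*} [∀ x, Ring (𝒢 x)] [∀ x, HopfAlgebra ℂ (𝒢 x)]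
  [∀ x, StarRing (𝒢 x)] [∀ x, StarModule ℂ (𝒢 x)] [∀ x, RibbonHopfStar (𝒢 x)]
  {H : Type*} [Ring H] [HopfAlgebra ℂ H] [StarRing H] [StarModule ℂ H] [RibbonHopfStar H]
  {Lab : Type*} (T : ∀ x, TwistEquiv (𝒢 x) H) {ρ : UnitaryIrreps H Lab} (cg : ClebschGordan ρ)

/-- `ι_x ⊗ ι_x` -/
abbrev twistMap (x : V) : (𝒢 x ⊗[ℂ] 𝒢 x) →ₐ[ℂ] (H ⊗[ℂ] H) :=
  Algebra.TensorProduct.map ((T x).ι.toAlgEquiv : 𝒢 x →ₐ[ℂ] H) ((T x).ι.toAlgEquiv : 𝒢 x →ₐ[ℂ] H)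

theorem vertexRep₂_eq (I J : Lab) (x : V) (t : 𝒢 x ⊗[ℂ] 𝒢 x) :
    vertexRep₂ T ρ I J x t = rep₂ ρ I J (twistMap T x t) := by
  induction t using TensorProduct.induction_on with
  | zero => simp only [map_zero]
  | add s t hs ht => simp only [map_add, hs, ht]
  | tmul a b => simp only [Algebra.TensorProduct.map_tmul, tensorRepHom_tmul]; rfl

theorem vertexRep₂_star (I J : Lab) (x : V) (t : 𝒢 x ⊗[ℂ] 𝒢 x) :
    vertexRep₂ T ρ I J x (star t) = (vertexRep₂ T ρ I J x t).conjTranspose :=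
  tensorRepHom_star _ _ (vertexRep_star T ρ I x) (vertexRep_star T ρ J x) t

theorem vertexCG_eq (I J K : Lab) (a : Fin (cg.N I J K)) (x : V) :
    vertexCG T cg I J K a x = cg.C I J K a * rep₂ ρ I J ((T x).F : H ⊗[ℂ] H) := by
  rw [vertexCG, tensorRep_eq]

theorem vertexCG_conjTranspose (I J K : Lab) (a : Fin (cg.N I J K)) (x : V) :
    (vertexCG T cg I J K a x).conjTranspose
      = rep₂ ρ I J (swap (((T x).F⁻¹ : (H ⊗[ℂ] H)ˣ) : H ⊗[ℂ] H))
        * (cg.C I J K a).conjTranspose := by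
  rw [vertexCG_eq, Matrix.conjTranspose_mul, ← rep₂_star,
    (star_eq_swap_of_flipStar (T x).F_star).1]

theorem vertexCG_intertwine (I J K : Lab) (a : Fin (cg.N I J K)) (x : V) (ξ : 𝒢 x) :
    vertexCG T cg I J K a x * vertexRep₂ T ρ I J x (Coalgebra.comul (R := ℂ) ξ)
      = vertexRep T ρ K x ξ * vertexCG T cg I J K a x := by
  have h := cg.intertwine I J K a ((T x).ι ξ)
  rw [tensorRep_eq] at h
  rw [vertexCG_eq, vertexRep₂_eq, (T x).comul_eq, Matrix.mul_assoc, ← map_mul, ← mul_assoc,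
    ← mul_assoc, Units.mul_inv, one_mul, map_mul, ← Matrix.mul_assoc, h, Matrix.mul_assoc]
  rfl

/-- Taking adjoints of the intertwining property at ξ^* yields Δ', since the star on A ⊗ A that is
compatible with Δ reverses the factors. -/
theorem vertexCG_conjTranspose_intertwine (I J K : Lab) (a : Fin (cg.N I J K)) (x : V)
    (ξ : 𝒢 x) : vertexRep₂ T ρ I J x (swap (Coalgebra.comul (R := ℂ) ξ))
        * (vertexCG T cg I J K a x).conjTranspose
      = (vertexCG T cg I J K a x).conjTranspose * vertexRep T ρ K x ξ := by
  have h := congrArg Matrix.conjTranspose (vertexCG_intertwine T cg I J K a x (star ξ))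
  rw [Matrix.conjTranspose_mul, Matrix.conjTranspose_mul, ← vertexRep₂_star, ← vertexRep_star,
    star_star, RibbonHopfStar.comul_star, flipStar, star_swap, star_star] at h
  exact h

/-- `C_x^a[JI|K] R_x⁻¹ = (C^a[JI|K] R⁻¹ P) F_x P` -/
theorem vertexCG_Rmat_inv (I J K : Lab) (a : Fin (cg.N J I K)) (x : V) :
    vertexCG T cg J I K a x * vertexRep₂ T ρ J I x
        (((Rmat (𝒢 x))⁻¹ : (𝒢 x ⊗[ℂ] 𝒢 x)ˣ) : 𝒢 x ⊗[ℂ] 𝒢 x)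
      = (braidedCG cg I J K a * rep₂ ρ I J ((T x).F : H ⊗[ℂ] H)).submatrix
        (Equiv.refl _) (Equiv.prodComm _ _) := by
  -- This is the inverse of Rₓ = Fₓ'⁻¹RFₓ; multiplied by the Fₓ in Cₓ it leaves R⁻¹Fₓ', a twist on
  -- the outside only.
  have hR : twistMap T x (((Rmat (𝒢 x))⁻¹ : (𝒢 x ⊗[ℂ] 𝒢 x)ˣ) : 𝒢 x ⊗[ℂ] 𝒢 x)
      = (((T x).F⁻¹ : (H ⊗[ℂ] H)ˣ) : H ⊗[ℂ] H) * (((Rmat H)⁻¹ : (H ⊗[ℂ] H)ˣ) : H ⊗[ℂ] H)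
        * swap ((T x).F : H ⊗[ℂ] H) := by
    refine (left_inv_eq_right_inv (a := twistMap T x (Rmat (𝒢 x) : 𝒢 x ⊗[ℂ] 𝒢 x)) ?_ ?_).symm
    · rw [(T x).R_eq]
      simp only [mul_assoc]
      rw [← mul_assoc (swap _) (swap _), ← map_mul, Units.mul_inv, map_one, one_mul,
        ← mul_assoc _ (Rmat H : H ⊗[ℂ] H), Units.inv_mul, one_mul, Units.inv_mul]
    · rw [← map_mul, Units.mul_inv, map_one]
  rw [vertexCG_eq, vertexRep₂_eq, hR, Matrix.mul_assoc, ← map_mul, ← mul_assoc, ← mul_assoc,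
    Units.mul_inv, one_mul, map_mul, ← Matrix.mul_assoc, braidedCG]
  have hF : rep₂ ρ I J ((T x).F : H ⊗[ℂ] H)
      = (rep₂ ρ J I (swap ((T x).F : H ⊗[ℂ] H))).submatrix
        (Equiv.prodComm _ _) (Equiv.prodComm _ _) := by
    rw [rep₂_submatrix, swap_swap]
  rw [hF, Matrix.submatrix_mul_equiv]
  rfl

/-- `R_x' C_x^a[JI|K]^* = P F_x'⁻¹ (C^a[JI|K] R⁻¹ P)^*` -/
theorem Rmat_vertexCG_conjTranspose (I J K : Lab) (a : Fin (cg.N J I K)) (x : V) :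
    vertexRep₂ T ρ J I x (swap (Rmat (𝒢 x) : 𝒢 x ⊗[ℂ] 𝒢 x))
        * (vertexCG T cg J I K a x).conjTranspose
      = (rep₂ ρ I J (swap (((T x).F⁻¹ : (H ⊗[ℂ] H)ˣ) : H ⊗[ℂ] H))
        * (braidedCG cg I J K a).conjTranspose).submatrix
        (Equiv.prodComm _ _) (Equiv.refl _) := by
  have h := congrArg Matrix.conjTranspose (vertexCG_Rmat_inv T cg I J K a x)
  rw [Matrix.conjTranspose_mul, ← vertexRep₂_star, star_Rmat_inv,
    Matrix.conjTranspose_submatrix, Matrix.conjTranspose_mul, ← rep₂_star,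
    (star_eq_swap_of_flipStar (T x).F_star).1] at h
  exact h

/-- The twists at x and y appear only as outer factors around the identity `braidedCG_sum` of 𝒢_*,
so the two ends may carry unrelated twists. -/
theorem vertexCG_sum (I J K : Lab) (x y : V) (u v : Fin (ρ.dim J) × Fin (ρ.dim I))
    (γ γ' : Fin (ρ.dim K)) :
    ∑ a, (vertexRep₂ T ρ J I y (swap (Rmat (𝒢 y) : 𝒢 y ⊗[ℂ] 𝒢 y))
        * (vertexCG T cg J I K a y).conjTranspose) u γ
      * (vertexCG T cg J I K a x * vertexRep₂ T ρ J I x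
        (((Rmat (𝒢 x))⁻¹ : (𝒢 x ⊗[ℂ] 𝒢 x)ˣ) : 𝒢 x ⊗[ℂ] 𝒢 x)) γ' v
    = ∑ b, (vertexCG T cg I J K b y).conjTranspose u.swap γ * vertexCG T cg I J K b x γ' v.swap := by
  simp only [Rmat_vertexCG_conjTranspose, vertexCG_Rmat_inv]
  simp only [vertexCG_conjTranspose]
  simp only [vertexCG_eq, Matrix.submatrix_apply, Matrix.mul_apply, Equiv.prodComm_apply,
    Equiv.refl_apply, Finset.sum_mul_sum]
  rw [Finset.sum_comm]
  conv_rhs => rw [Finset.sum_comm]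
  refine Finset.sum_congr rfl fun p _ => ?_
  rw [Finset.sum_comm]
  conv_rhs => rw [Finset.sum_comm]
  refine Finset.sum_congr rfl fun q _ => ?_
  have h := congrArg (fun z => rep₂ ρ I J (swap (((T y).F⁻¹ : (H ⊗[ℂ] H)ˣ) : H ⊗[ℂ] H)) u.swap p * z
    * rep₂ ρ I J ((T x).F : H ⊗[ℂ] H) q v.swap) (braidedCG_sum cg I J K p q γ γ')
  simp only [Finset.mul_sum, Finset.sum_mul] at h
  refine Eq.trans (Finset.sum_congr rfl fun a _ => ?_) (h.trans
    (Finset.sum_congr rfl fun a _ => ?_))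
  · ring
  · ring

end VertexCG

/-! ### Two consequences for w and ε -/

section Drinfeld

variable {A : Type*} [Ring A] [HopfAlgebra ℂ A] [StarRing A] [StarModule ℂ A] [RibbonHopfStar A]

/-- Insert w ⊗ w = R'RΔ(w) and use RΔ(w) = Δ'(w)R. In this form w can be moved through an adjoint
Clebsch-Gordan map, which intertwines Δ'. -/
theorem antipodeDrinfeld_tmul_mul_Rmat_inv :
    (antipodeDrinfeld A ⊗ₜ[ℂ] antipodeDrinfeld A)
        * (((Rmat A)⁻¹ : (A ⊗[ℂ] A)ˣ) : A ⊗[ℂ] A)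
      = swap (Rmat A : A ⊗[ℂ] A) * swap (Coalgebra.comul (R := ℂ) (antipodeDrinfeld A)) := by
  rw [← comul_antipodeDrinfeld, mul_assoc (swap _), Rmat_comul, mul_assoc, mul_assoc,
    Units.mul_inv, mul_one]

theorem pairing_counit_comul (a : A) :
    pairing (Coalgebra.counit (R := ℂ)) (Coalgebra.counit (R := ℂ)) (Coalgebra.comul (R := ℂ) a)
      = Coalgebra.counit (R := ℂ) a := by
  have h := congrArg (Coalgebra.counit (R := ℂ)) (congrArg (TensorProduct.lid ℂ A)
    (Coalgebra.rTensor_counit_comul (R := ℂ) a))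
  rw [TensorProduct.lid_tmul, one_smul] at h
  rw [← h]
  generalize Coalgebra.comul (R := ℂ) a = t
  induction t using TensorProduct.induction_on with
  | zero => simp
  | add s t hs ht => simp only [map_add, hs, ht]
  | tmul a b => simp

end Drinfeld

/-! ### Clebsch-Gordan maps of links and their conjugates -/

section LinkCG

variable {V L : Type*} [Fintype V] {𝒢 : V → Type*} [∀ x, Ring (𝒢 x)] [∀ x, HopfAlgebra ℂ (𝒢 x)]
  [∀ x, StarRing (𝒢 x)] [∀ x, StarModule ℂ (𝒢 x)] [∀ x, RibbonHopfStar (𝒢 x)]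
  {H : Type*} [Ring H] [HopfAlgebra ℂ H] [StarRing H] [StarModule ℂ H] [RibbonHopfStar H]
  {Lab : Type*} (Γ : CiliatedGraph V L) (T : ∀ x, TwistEquiv (𝒢 x) H) {ρ : UnitaryIrreps H Lab}
  (cg : ClebschGordan ρ)

/-- The matrix `C^a[IJ|K]^i`. -/
def linkCGMat (I J K : Lab) (a : Fin (cg.N I J K)) (i : L) :
    Matrix (Fin (ρ.dim K) × Fin (ρ.dim K))
      ((Fin (ρ.dim I) × Fin (ρ.dim I)) × (Fin (ρ.dim J) × Fin (ρ.dim J))) ℂ :=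
  cgMat (vertexCG T cg I J K a (Γ.source i)).conjTranspose (vertexCG T cg I J K a (Γ.target i))

theorem linkRep₂_other (I J : Lab) {i j : L} {z : V} (hi : z ≠ Γ.target i)
    (hi' : z ≠ Γ.source i) (hj : z ≠ Γ.target j) (hj' : z ≠ Γ.source j) (t : 𝒢 z ⊗[ℂ] 𝒢 z) :
    linkRep₂ Γ T (ρ := ρ) I J i j (single₂ 𝒢 z t)
      = pairing (Coalgebra.counit (R := ℂ)) (Coalgebra.counit (R := ℂ)) t • 1 := by
  induction t using TensorProduct.induction_on with
  | zero => simp only [map_zero, zero_smul]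
  | add s t hs ht => simp only [map_add, add_smul, hs, ht]
  | tmul a b =>
    rw [single₂_tmul, tensorRepHom_tmul, linkRep_single_other Γ T ρ I i hi hi',
      linkRep_single_other Γ T ρ J j hj hj', Matrix.smul_kronecker, Matrix.kronecker_smul,
      Matrix.one_kronecker_one, smul_smul, pairing_tmul]

/-- One vertex at a time: at the target C_y intertwines Δ. At the source C_x^* intertwines Δ', which
is what the contragredient requires, 𝒮 being anti-comultiplicative. -/
theorem linkCGMat_intertwine (I J K : Lab) (a : Fin (cg.N I J K)) (i : L) (ξ : Gauge 𝒢) :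
    linkCGMat Γ T cg I J K a i * linkRep₂ Γ T (ρ := ρ) I J i i (gaugeComul 𝒢 ξ)
      = linkRep Γ T ρ K i ξ * linkCGMat Γ T cg I J K a i := by
  let P : Subalgebra ℂ (Gauge 𝒢) :=
    { carrier := {ξ | linkCGMat Γ T cg I J K a i * linkRep₂ Γ T (ρ := ρ) I J i i (gaugeComul 𝒢 ξ)
        = linkRep Γ T ρ K i ξ * linkCGMat Γ T cg I J K a i}
      mul_mem' := by
        intro ξ ζ hξ hζ
        rw [Set.mem_ofPred_eq] at *
        rw [map_mul, map_mul, map_mul, ← Matrix.mul_assoc, hξ, Matrix.mul_assoc, hζ,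
          Matrix.mul_assoc]
      add_mem' := by
        intro ξ ζ hξ hζ
        rw [Set.mem_ofPred_eq] at *
        rw [map_add, map_add, map_add, Matrix.mul_add, hξ, hζ, Matrix.add_mul]
      algebraMap_mem' := by
        intro c
        rw [Set.mem_ofPred_eq]
        simp only [Algebra.algebraMap_eq_smul_one, map_smul, map_one, Matrix.mul_smul,
          Matrix.smul_mul, Matrix.mul_one, Matrix.one_mul] }
  refine mem_of_single_mem P (fun z b => ?_) ξ
  change linkCGMat Γ T cg I J K a i * linkRep₂ Γ T (ρ := ρ) I J i i (gaugeComul 𝒢 (single z b))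
    = linkRep Γ T ρ K i (single z b) * linkCGMat Γ T cg I J K a i
  rw [gaugeComul_single]
  by_cases h₁ : z = Γ.target i
  · subst h₁
    rw [linkRep₂_target Γ T I J rfl rfl, linkRep_single_target Γ T ρ K i rfl, linkCGMat,
      cgMat_mul_stMat, kronecker_mul_cgMat, vertexCG_intertwine, Matrix.one_mul, Matrix.mul_one]
  · by_cases h₂ : z = Γ.source i
    · subst h₂
      rw [linkRep₂_source Γ T I J rfl rfl, linkRep_single_source Γ T ρ K i rfl, linkCGMat,
        cgMat_mul_stMat, kronecker_mul_cgMat, ← vertexCG_conjTranspose_intertwine, comul_antipode,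
        antipode₂_swap, swap_swap, Matrix.mul_one, Matrix.one_mul]
    · rw [linkRep₂_other Γ T I J h₁ h₂ h₁ h₂, linkRep_single_other Γ T ρ K i h₁ h₂,
        pairing_counit_comul, Matrix.mul_smul, Matrix.smul_mul, Matrix.mul_one, Matrix.one_mul]

theorem cgMat_mul_etaMat (I J K : Lab) (i : L)
    (D : Matrix (Fin (ρ.dim J) × Fin (ρ.dim I)) (Fin (ρ.dim K)) ℂ)
    (C : Matrix (Fin (ρ.dim K)) (Fin (ρ.dim J) × Fin (ρ.dim I)) ℂ)
    (γ : Fin (ρ.dim K) × Fin (ρ.dim K))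
    (p : (Fin (ρ.dim J) × Fin (ρ.dim J)) × (Fin (ρ.dim I) × Fin (ρ.dim I))) :
    (cgMat D C * (etaMat Γ T ρ J i ⊗ₖ etaMat Γ T ρ I i)) γ p
      = (vertexRep₂ T ρ J I (Γ.target i) (antipodeDrinfeld _ ⊗ₜ antipodeDrinfeld _) * D)
          (p.1.2, p.2.2) γ.1 * C γ.2 (p.1.1, p.2.1) := by
  rw [Matrix.mul_apply, sum_regroup, Matrix.mul_apply, Finset.sum_mul]
  refine Finset.sum_congr rfl fun u _ => ?_
  rw [Finset.sum_eq_single (p.1.1, p.2.1)]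
  · simp only [cgMat_apply, Matrix.kroneckerMap_apply, etaMat_apply, tensorRepHom_tmul,
      Matrix.one_apply_eq]
    ring
  · intro v _ hv
    simp only [cgMat_apply, Matrix.kroneckerMap_apply, etaMat_apply, Matrix.one_apply]
    by_cases h₁ : v.1 = p.1.1
    · have h₂ : v.2 ≠ p.2.1 := fun h₂ => hv (Prod.ext h₁ h₂)
      simp [h₂]
    · simp [h₁]
  · simp

theorem etaMat_mul_conj_cgMat (I J K : Lab) (i : L)
    (D : Matrix (Fin (ρ.dim I) × Fin (ρ.dim J)) (Fin (ρ.dim K)) ℂ)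
    (C : Matrix (Fin (ρ.dim K)) (Fin (ρ.dim I) × Fin (ρ.dim J)) ℂ)
    (γ : Fin (ρ.dim K) × Fin (ρ.dim K))
    (p : (Fin (ρ.dim I) × Fin (ρ.dim I)) × (Fin (ρ.dim J) × Fin (ρ.dim J))) :
    (etaMat Γ T ρ K i * (cgMat D C).map (starRingEnd ℂ)) γ p
      = D.conjTranspose γ.2 (p.1.1, p.2.1)
        * (C.conjTranspose * vertexRep T ρ K (Γ.target i) (antipodeDrinfeld _))
          (p.1.2, p.2.2) γ.1 := by
  rw [Matrix.mul_apply, Fintype.sum_prod_type, Finset.sum_eq_single γ.2]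
  · rw [Matrix.mul_apply, Finset.mul_sum]
    refine Finset.sum_congr rfl fun u _ => ?_
    simp only [cgMat_apply, Matrix.map_apply, etaMat_apply, Matrix.one_apply_eq, map_mul,
      Matrix.conjTranspose_apply, starRingEnd_apply]
    ring
  · intro v _ hv
    refine Finset.sum_eq_zero fun u _ => ?_
    simp only [etaMat_apply, Matrix.one_apply]
    simp [hv.symm]
  · simp

/-- This is the matrix identity behind functoriality of θ. Once w has been moved through the
Clebsch-Gordan maps, the two sides differ by the passage from JI to IJ, which `vertexCG_sum`
performs. -/
theorem linkCGMat_etaMat (I J K : Lab) (i : L) (γ : Fin (ρ.dim K) × Fin (ρ.dim K))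
    (p : (Fin (ρ.dim J) × Fin (ρ.dim J)) × (Fin (ρ.dim I) × Fin (ρ.dim I))) :
    ∑ a, (linkCGMat Γ T cg J I K a (Γ.rev i) * linkRep₂ Γ T (ρ := ρ) J I (Γ.rev i) (Γ.rev i)
        (((gaugeR 𝒢)⁻¹ : (Gauge 𝒢 ⊗[ℂ] Gauge 𝒢)ˣ) : Gauge 𝒢 ⊗[ℂ] Gauge 𝒢)
        * (etaMat Γ T ρ J i ⊗ₖ etaMat Γ T ρ I i)) γ p
      = ∑ b, (etaMat Γ T ρ K i * (linkCGMat Γ T cg I J K b i).map (starRingEnd ℂ)) γ p.swap := by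
  -- Let i go from x to y, so that -i has source y and target x. At y the factors combine to (w ⊗
  -- w)R_y⁻¹C_y^* = R_y'Δ'(w)C_y^* = R_y'C_y^*τ^K(w), while x carries C_xR_x⁻¹.
  have h₁ : ∀ a, (linkCGMat Γ T cg J I K a (Γ.rev i)
        * linkRep₂ Γ T (ρ := ρ) J I (Γ.rev i) (Γ.rev i)
        (((gaugeR 𝒢)⁻¹ : (Gauge 𝒢 ⊗[ℂ] Gauge 𝒢)ˣ) : Gauge 𝒢 ⊗[ℂ] Gauge 𝒢)
        * (etaMat Γ T ρ J i ⊗ₖ etaMat Γ T ρ I i)) γ p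
      = ∑ m, vertexRep T ρ K (Γ.target i) (antipodeDrinfeld _) m γ.1
        * ((vertexRep₂ T ρ J I (Γ.target i) (swap (Rmat (𝒢 (Γ.target i)) :
            𝒢 (Γ.target i) ⊗[ℂ] 𝒢 (Γ.target i)))
          * (vertexCG T cg J I K a (Γ.target i)).conjTranspose) (p.1.2, p.2.2) m
        * (vertexCG T cg J I K a (Γ.source i) * vertexRep₂ T ρ J I (Γ.source i)
          (((Rmat (𝒢 (Γ.source i)))⁻¹ : (𝒢 (Γ.source i) ⊗[ℂ] 𝒢 (Γ.source i))ˣ) :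
            𝒢 (Γ.source i) ⊗[ℂ] 𝒢 (Γ.source i))) γ.2 (p.1.1, p.2.1)) := by
    intro a
    rw [linkRep₂_gaugeR_inv Γ T J I rfl rfl, linkCGMat, cgMat_mul_stMat, target_rev, source_rev,
      cgMat_mul_etaMat, ← Matrix.mul_assoc, ← map_mul, antipodeDrinfeld_tmul_mul_Rmat_inv, map_mul,
      Matrix.mul_assoc, vertexCG_conjTranspose_intertwine, ← Matrix.mul_assoc,
      Matrix.mul_apply (N := vertexRep T ρ K (Γ.target i) (antipodeDrinfeld _)), Finset.sum_mul]
    exact Finset.sum_congr rfl fun m _ => by ring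
  simp only [h₁]
  rw [Finset.sum_comm]
  simp only [← Finset.mul_sum, vertexCG_sum]
  simp only [linkCGMat, etaMat_mul_conj_cgMat, Matrix.conjTranspose_conjTranspose]
  simp only [Finset.mul_sum, Matrix.mul_apply]
  rw [Finset.sum_comm]
  refine Finset.sum_congr rfl fun b _ => Finset.sum_congr rfl fun m _ => ?_
  simp only [Prod.swap]
  ring

end LinkCG

/-! ### Exchange relations of dressed rows -/

section Rows

variable {X G B : Type*} [Ring X] [Algebra ℂ X] [Ring G] [Algebra ℂ G] [Ring B] [Algebra ℂ B]
  {m n k l : Type*} [Fintype m] [DecidableEq m] [Fintype n] [DecidableEq n]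

theorem vecMul_map_apply (U : m → B) (M : Matrix m k ℂ) (α : k) :
    Matrix.vecMul U (M.map (algebraMap ℂ B)) α = ∑ β, M β α • U β := by
  simp only [Matrix.vecMul, dotProduct, Matrix.map_apply]
  exact Finset.sum_congr rfl fun β _ => by rw [← Algebra.commutes, Algebra.smul_def]

theorem rowMul_vecMul_map (U : m → B) (U' : n → B) (M : Matrix m k ℂ) (N : Matrix n l ℂ) :
    rowMul (Matrix.vecMul U (M.map (algebraMap ℂ B))) (Matrix.vecMul U' (N.map (algebraMap ℂ B)))
      = Matrix.vecMul (rowMul U U') ((M ⊗ₖ N).map (algebraMap ℂ B)) := by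
  ext p
  simp only [rowMul, vecMul_map_apply, Fintype.sum_prod_type, Matrix.kroneckerMap_apply,
    Finset.sum_mul_sum, smul_mul_smul_comm]

theorem vecMul_map_mul_right (U : m → B) (M : Matrix m k ℂ) (b : B) :
    Matrix.vecMul (fun β => U β * b) (M.map (algebraMap ℂ B))
      = fun α => Matrix.vecMul U (M.map (algebraMap ℂ B)) α * b := by
  ext α
  simp only [vecMul_map_apply, Finset.sum_mul, smul_mul_assoc]

theorem vecMul_dress_one_tmul (ι : G →ₐ[ℂ] B) (τ : X →ₐ[ℂ] Matrix n n ℂ) (U : n → B) (ξ : G) :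
    Matrix.vecMul U (dress ι τ (1 ⊗ₜ ξ)) = fun β => U β * ι ξ := by
  ext β
  simp [Matrix.vecMul, dotProduct, Matrix.one_apply]

theorem map_mul_dress_mul_map_tmul (ι : G →ₐ[ℂ] B) (σ : X →ₐ[ℂ] Matrix n n ℂ) (M : Matrix k n ℂ)
    (N : Matrix n l ℂ) (x : X) (ξ : G) :
    M.map (algebraMap ℂ B) * dress ι σ (x ⊗ₜ ξ) * N.map (algebraMap ℂ B)
      = Matrix.of fun i j => (M * σ x * N) i j • ι ξ := by
  ext i j
  simp only [Matrix.mul_apply, Matrix.map_apply, dress_tmul, Matrix.of_apply, Finset.sum_smul,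
    Finset.sum_mul]
  refine Finset.sum_congr rfl fun a _ => Finset.sum_congr rfl fun b _ => ?_
  rw [← Algebra.commutes, ← Algebra.smul_def, ← Algebra.smul_def, smul_smul, smul_smul]
  congr 1
  ring

/-- Identities between matrices carry over to `dress`. -/
theorem map_mul_dress_mul_map {n' : Type*} [Fintype n'] [DecidableEq n'] (ι : G →ₐ[ℂ] B)
    {σ : X →ₐ[ℂ] Matrix n n ℂ} {σ' : X →ₐ[ℂ] Matrix n' n' ℂ} {M : Matrix k n ℂ} {N : Matrix n l ℂ}
    {M' : Matrix k n' ℂ} {N' : Matrix n' l ℂ} (h : ∀ x, M * σ x * N = M' * σ' x * N')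
    (t : X ⊗[ℂ] G) :
    M.map (algebraMap ℂ B) * dress ι σ t * N.map (algebraMap ℂ B)
      = M'.map (algebraMap ℂ B) * dress ι σ' t * N'.map (algebraMap ℂ B) := by
  induction t using TensorProduct.induction_on with
  | zero => simp only [map_zero, Matrix.mul_zero, Matrix.zero_mul]
  | add s t hs ht => simp only [map_add, Matrix.mul_add, Matrix.add_mul, hs, ht]
  | tmul x ξ => rw [map_mul_dress_mul_map_tmul, map_mul_dress_mul_map_tmul, h]

theorem map_one_algebraMap : (1 : Matrix m m ℂ).map (algebraMap ℂ B) = 1 :=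
  Matrix.map_one _ (map_zero _) (map_one _)

/-- The exchange of the factors of the index set of a row. -/
def flipRow (F : m × n → B) : n × m → B := fun p => F p.swap

theorem flipRow_apply (F : m × n → B) (p : n × m) : flipRow F p = F p.swap := rfl

theorem flipRow_flipRow (F : m × n → B) : flipRow (flipRow F) = F := rfl

theorem flipRow_vecMul (F : m × n → B) (M : Matrix (m × n) (m × n) B) :
    flipRow (Matrix.vecMul F M)
      = Matrix.vecMul (flipRow F) (M.submatrix (Equiv.prodComm n m) (Equiv.prodComm n m)) := by
  ext p
  simp only [flipRow, Matrix.vecMul, dotProduct, Matrix.submatrix_apply]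
  exact (Fintype.sum_equiv (Equiv.prodComm n m) _ _ fun q => rfl).symm

theorem kronecker_submatrix_prodComm (M : Matrix m m ℂ) (N : Matrix n n ℂ) :
    (M ⊗ₖ N).submatrix (Equiv.prodComm n m) (Equiv.prodComm n m) = N ⊗ₖ M := by
  ext p q
  exact mul_comm _ _

theorem tensorRepHom_submatrix (τ : G →ₐ[ℂ] Matrix m m ℂ) (σ : G →ₐ[ℂ] Matrix n n ℂ)
    (t : G ⊗[ℂ] G) : (tensorRepHom τ σ t).submatrix (Equiv.prodComm n m) (Equiv.prodComm n m)
      = tensorRepHom σ τ (swap t) := by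
  ext p q
  rw [tensorRepHom_swap]
  rfl

/-- The exchange of the tensor factors replaces Δ by Δ' = RΔR⁻¹. -/
theorem dress_submatrix (ι : G →ₐ[ℂ] B) {Δ : G →ₐ[ℂ] G ⊗[ℂ] G} {R : (G ⊗[ℂ] G)ˣ}
    (hR : ∀ ξ, (R : G ⊗[ℂ] G) * Δ ξ = swap (Δ ξ) * R)
    (τ : G →ₐ[ℂ] Matrix m m ℂ) (σ : G →ₐ[ℂ] Matrix n n ℂ) (t : G ⊗[ℂ] G) :
    (dress ι ((tensorRepHom τ σ).comp Δ) t).submatrix (Equiv.prodComm n m) (Equiv.prodComm n m)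
      = (tensorRepHom σ τ R).map (algebraMap ℂ B) * dress ι ((tensorRepHom σ τ).comp Δ) t
        * (tensorRepHom σ τ ((R⁻¹ : (G ⊗[ℂ] G)ˣ) : G ⊗[ℂ] G)).map (algebraMap ℂ B) := by
  induction t using TensorProduct.induction_on with
  | zero =>
    simp only [map_zero, Matrix.mul_zero, Matrix.zero_mul]
    rfl
  | add s t hs ht =>
    simp only [map_add, Matrix.mul_add, Matrix.add_mul, ← hs, ← ht]
    rfl
  | tmul x ξ =>
    rw [map_mul_dress_mul_map_tmul]
    ext p q
    have h : tensorRepHom σ τ R * ((tensorRepHom σ τ).comp Δ) x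
        * tensorRepHom σ τ ((R⁻¹ : (G ⊗[ℂ] G)ˣ) : G ⊗[ℂ] G)
        = (tensorRepHom τ σ (Δ x)).submatrix (Equiv.prodComm n m) (Equiv.prodComm n m) := by
      rw [AlgHom.comp_apply, ← map_mul, hR, ← map_mul, mul_assoc, Units.mul_inv, mul_one,
        tensorRepHom_submatrix]
    rw [h, Matrix.submatrix_apply, dress_tmul]
    rfl

/-- Exchange relations of dressed rows. -/
theorem flipRow_rowMul_dress (ι : G →ₐ[ℂ] B) {Δ : G →ₐ[ℂ] G ⊗[ℂ] G} {R : (G ⊗[ℂ] G)ˣ}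
    (hR : ∀ ξ, (R : G ⊗[ℂ] G) * Δ ξ = swap (Δ ξ) * R)
    (hc : IsCocycle Δ ((R⁻¹ : (G ⊗[ℂ] G)ˣ) : G ⊗[ℂ] G))
    {τ : G →ₐ[ℂ] Matrix m m ℂ} {σ : G →ₐ[ℂ] Matrix n n ℂ} {U : m → B} {U' : n → B}
    (hU : IsCovariant ι Δ τ U) (hU' : IsCovariant ι Δ σ U')
    {q q' κ : Matrix (m × n) (m × n) ℂ} {η : Matrix m m ℂ} {η' : Matrix n n ℂ}
    (h₁ : rowMul U U' = Matrix.vecMul (flipRow (rowMul U' U)) (q.map (algebraMap ℂ B)))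
    (h₂ : (η ⊗ₖ η') * κ = q' * (η ⊗ₖ η'))
    (h₃ : ∀ ξ, q * tensorRepHom τ σ (Δ ξ)
        * (tensorRepHom τ σ ((R⁻¹ : (G ⊗[ℂ] G)ˣ) : G ⊗[ℂ] G) * q')
      = tensorRepHom τ σ R * tensorRepHom τ σ (Δ ξ)
        * (tensorRepHom τ σ ((R⁻¹ : (G ⊗[ℂ] G)ˣ) : G ⊗[ℂ] G)
          * tensorRepHom τ σ (swap ((R⁻¹ : (G ⊗[ℂ] G)ˣ) : G ⊗[ℂ] G)))) :
    flipRow (rowMul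
        (Matrix.vecMul (Matrix.vecMul U' (dress ι σ ((R⁻¹ : (G ⊗[ℂ] G)ˣ) : G ⊗[ℂ] G)))
          (η'.map (algebraMap ℂ B)))
        (Matrix.vecMul (Matrix.vecMul U (dress ι τ ((R⁻¹ : (G ⊗[ℂ] G)ˣ) : G ⊗[ℂ] G)))
          (η.map (algebraMap ℂ B))))
      = Matrix.vecMul (rowMul
        (Matrix.vecMul (Matrix.vecMul U (dress ι τ ((R⁻¹ : (G ⊗[ℂ] G)ˣ) : G ⊗[ℂ] G)))
          (η.map (algebraMap ℂ B)))
        (Matrix.vecMul (Matrix.vecMul U' (dress ι σ ((R⁻¹ : (G ⊗[ℂ] G)ˣ) : G ⊗[ℂ] G)))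
          (η'.map (algebraMap ℂ B)))) (κ.map (algebraMap ℂ B)) := by
  have e : ∀ (M N : Matrix (m × n) (m × n) ℂ), (M * N).map (algebraMap ℂ B)
      = M.map (algebraMap ℂ B) * N.map (algebraMap ℂ B) := fun M N => Matrix.map_mul
  -- Both sides become matrices applied to the same flipped row of U'U, with q entering through
  -- `h₁`. Moving κ across η ⊗ η' by `h₂` turns it into q', and the rest is `h₃` applied to the
  -- first leg of R⁻¹.
  rw [rowMul_vecMul_map, rowMul_vecMul_map, rowMul_dress hU hc, rowMul_dress hU' hc,
    flipRow_vecMul, flipRow_vecMul, h₁]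
  simp only [Matrix.vecMul_vecMul]
  congr 1
  rw [← Matrix.submatrix_mul_equiv _ _ _ (Equiv.prodComm m n), dress_submatrix ι hR, Matrix.submatrix_map, Matrix.submatrix_map,
    tensorRepHom_submatrix, kronecker_submatrix_prodComm]
  have h₄ := map_mul_dress_mul_map ι (σ := (tensorRepHom τ σ).comp Δ)
    (σ' := (tensorRepHom τ σ).comp Δ) h₃ ((R⁻¹ : (G ⊗[ℂ] G)ˣ) : G ⊗[ℂ] G)
  simp only [e] at h₄
  have h₅ := congrArg (fun M => M.map (algebraMap ℂ B)) h₂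
  simp only [e] at h₅
  simp only [Matrix.mul_assoc] at h₄ h₅ ⊢
  rw [h₅]
  have h₆ := congrArg (fun M => M * (η ⊗ₖ η').map (algebraMap ℂ B)) h₄
  simp only [Matrix.mul_assoc] at h₆
  exact h₆.symm

end Rows

/-! ### Exchange relations of inverse matrices -/

section Inverse

variable {B : Type*} [Ring B] [Algebra ℂ B]
  {m n : Type*} [Fintype m] [DecidableEq m] [Fintype n] [DecidableEq n]

/-- A form of p⁻¹ = y⁻¹z⁻¹x⁻¹ solved for z⁻¹; no inverse of x is required. -/
theorem eq_of_mul_eq_one {M : Type*} [Monoid M] {p p' x y y' z z' : M} (hp : p' * p = 1)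
    (hz : z * z' = 1) (hy : y * y' = 1) (h : p = x * z * y) : z' = y * p' * x := by
  have h₁ : y * p' * x * z = 1 := by
    calc y * p' * x * z = y * p' * x * z * (y * y') := by rw [hy, mul_one]
      _ = y * (p' * (x * z * y)) * y' := by simp only [mul_assoc]
      _ = 1 := by rw [← h, hp, mul_one, hy]
  exact (left_inv_eq_right_inv h₁ hz).symm

/-- The matrix `M ⊗ 1`. -/
abbrev ampLeft (n : Type*) [DecidableEq n] (M : Matrix m m B) : Matrix (m × n) (m × n) B :=
  Matrix.blockDiagonal fun _ => M

/-- The matrix `1 ⊗ M`. -/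
abbrev ampRight (m : Type*) [DecidableEq m] (M : Matrix n n B) : Matrix (m × n) (m × n) B :=
  (Matrix.blockDiagonal fun _ : m => M).submatrix (Equiv.prodComm m n) (Equiv.prodComm m n)

theorem ampLeft_mul_ampRight (M : Matrix m m B) (N : Matrix n n B) (p q : m × n) :
    (ampLeft n M * ampRight m N) p q = M p.1 q.1 * N p.2 q.2 := by
  rw [Matrix.mul_apply, Fintype.sum_prod_type, Finset.sum_eq_single q.1]
  · rw [Finset.sum_eq_single p.2]
    · simp [Matrix.blockDiagonal_apply]
    · intro b _ hb; simp [Matrix.blockDiagonal_apply, hb.symm]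
    · simp
  · intro b _ hb
    simp [Matrix.blockDiagonal_apply, hb]
  · simp

theorem ampRight_mul_ampLeft (M : Matrix m m B) (N : Matrix n n B) (p q : m × n) :
    (ampRight m N * ampLeft n M) p q = N p.2 q.2 * M p.1 q.1 := by
  rw [Matrix.mul_apply, Fintype.sum_prod_type, Finset.sum_eq_single p.1]
  · rw [Finset.sum_eq_single q.2]
    · simp [Matrix.blockDiagonal_apply]
    · intro b _ hb; simp [Matrix.blockDiagonal_apply, hb]
    · simp
  · intro b _ hb
    simp [Matrix.blockDiagonal_apply, hb.symm]
  · simp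

theorem ampLeft_mul_eq_one {M N : Matrix m m B} (h : M * N = 1) :
    ampLeft n M * ampLeft n N = 1 := by
  rw [← Matrix.blockDiagonal_mul, h]
  exact Matrix.blockDiagonal_one

theorem ampRight_mul_eq_one {M N : Matrix n n B} (h : M * N = 1) :
    ampRight m M * ampRight m N = 1 := by
  rw [Matrix.submatrix_mul_equiv, ← Matrix.blockDiagonal_mul, h]
  change (Matrix.blockDiagonal (1 : m → Matrix n n B)).submatrix _ _ = 1
  rw [Matrix.blockDiagonal_one, Matrix.submatrix_one_equiv]

/-- Regrouping the four indices by source and target turns an exchange relation of rows into M₁N₂ =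
X N₂M₁ Y for M₁ = M ⊗ 1 and N₂ = 1 ⊗ N, which can be inverted. -/
theorem rowMul_eq_iff (M : Matrix m m B) (N : Matrix n n B) (X Y : Matrix (m × n) (m × n) ℂ) :
    rowMul (fun p : m × m => M p.1 p.2) (fun p : n × n => N p.1 p.2)
        = Matrix.vecMul (flipRow (rowMul (fun p : n × n => N p.1 p.2) fun p : m × m => M p.1 p.2))
          ((stMat X Y).map (algebraMap ℂ B))
      ↔ ampLeft n M * ampRight m N = X.map (algebraMap ℂ B) * (ampRight m N * ampLeft n M)
        * Y.map (algebraMap ℂ B) := by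
  have e : ∀ p : (m × m) × (n × n), Matrix.vecMul
      (flipRow (rowMul (fun p : n × n => N p.1 p.2) fun p : m × m => M p.1 p.2))
          ((stMat X Y).map (algebraMap ℂ B)) p
      = (X.map (algebraMap ℂ B) * (ampRight m N * ampLeft n M) * Y.map (algebraMap ℂ B))
        (p.1.1, p.2.1) (p.1.2, p.2.2) := by
    intro p
    rw [vecMul_map_apply, sum_regroup, Finset.sum_comm, Matrix.mul_apply]
    refine Finset.sum_congr rfl fun v _ => ?_
    rw [Matrix.mul_apply, Finset.sum_mul]
    refine Finset.sum_congr rfl fun u _ => ?_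
    rw [ampRight_mul_ampLeft, Matrix.map_apply, Matrix.map_apply, ← Algebra.commutes,
      ← Algebra.smul_def, ← Algebra.smul_def, smul_smul, stMat_apply, mul_comm]
    rfl
  constructor
  · intro h
    ext p q
    have := congrFun h ((p.1, q.1), (p.2, q.2))
    rw [e] at this
    rw [← this, ampLeft_mul_ampRight]
    rfl
  · intro h
    ext p
    rw [e, ← h, ampLeft_mul_ampRight]
    rfl

/-- Exchange relations of matrices imply exchange relations of their inverses. -/
theorem rowMul_inv {M M' : Matrix m m B} {N N' : Matrix n n B} (hM : M * M' = 1) (hM' : M' * M = 1)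
    (hN : N * N' = 1) (hN' : N' * N = 1) {X Y Y' : Matrix (m × n) (m × n) ℂ} (hY : Y * Y' = 1)
    (h : rowMul (fun p : m × m => M p.1 p.2) (fun p : n × n => N p.1 p.2)
        = Matrix.vecMul (flipRow (rowMul (fun p : n × n => N p.1 p.2) fun p : m × m => M p.1 p.2))
          ((stMat X Y).map (algebraMap ℂ B))) :
    rowMul (fun p : m × m => M' p.1 p.2) (fun p : n × n => N' p.1 p.2)
        = Matrix.vecMul (flipRow (rowMul (fun p : n × n => N' p.1 p.2) fun p : m × m => M' p.1 p.2))
          ((stMat Y X).map (algebraMap ℂ B)) := by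
  -- Inversion of M₁N₂ = X N₂M₁ Y gives M'₁N'₂ = Y N'₂M'₁ X: source and target matrices change
  -- places, as they do for reversed links.
  rw [rowMul_eq_iff] at h ⊢
  refine eq_of_mul_eq_one (y' := Y'.map (algebraMap ℂ B)) (z := ampRight m N * ampLeft n M)
    (p := ampLeft n M * ampRight m N) ?_ ?_ ?_ h
  · rw [Matrix.mul_assoc, ← Matrix.mul_assoc (ampLeft n M'), ampLeft_mul_eq_one hM',
      Matrix.one_mul, ampRight_mul_eq_one hN']
  · rw [Matrix.mul_assoc, ← Matrix.mul_assoc (ampLeft n M), ampLeft_mul_eq_one hM,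
      Matrix.one_mul, ampRight_mul_eq_one hN]
  · rw [← Matrix.map_mul, hY, map_one_algebraMap]

end Inverse

/-! ### A Hopf algebra identity for covariance -/

section Hopf

variable {A : Type*} [Ring A] [HopfAlgebra ℂ A]

/-- `∑ ξ₍₂₎ 𝒮(ξ₍₃₎) ⊗ ξ₍₁₎ = 1 ⊗ ξ` -/
theorem sum_swap_comul_mul_antipode {κ : Type*} {s : Finset κ} {f g : κ → A} {a : A}
    (h : Coalgebra.comul (R := ℂ) a = ∑ p ∈ s, f p ⊗ₜ[ℂ] g p) :
    ∑ p ∈ s, swap (Coalgebra.comul (R := ℂ) (f p)) * (HopfAlgebra.antipode ℂ (g p) ⊗ₜ 1)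
      = 1 ⊗ₜ a := by
  -- By coassociativity the contraction a ⊗ b ⊗ c ↦ a ⊗ b𝒮(c) of the double co-product is ξ ⊗ 1; the
  -- exchange of factors is applied at the end.
  let Θ : A ⊗[ℂ] (A ⊗[ℂ] A) →ₗ[ℂ] A ⊗[ℂ] A :=
    (LinearMap.mul' ℂ A ∘ₗ (HopfAlgebra.antipode ℂ).lTensor A).lTensor A
  have e₁ := congrArg Θ (Coalgebra.coassoc_apply (R := ℂ) a)
  have e₂ : Θ (LinearMap.lTensor A (Coalgebra.comul (R := ℂ)) (Coalgebra.comul (R := ℂ) a))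
      = a ⊗ₜ 1 := by
    have h₁ := congrArg ((Algebra.linearMap ℂ A).lTensor A)
      (Coalgebra.lTensor_counit_comul (R := ℂ) a)
    rw [LinearMap.lTensor_tmul, Algebra.linearMap_apply, map_one] at h₁
    rw [← h₁, ← LinearMap.lTensor_comp_apply, ← LinearMap.lTensor_comp_apply, LinearMap.comp_assoc,
      HopfAlgebra.mul_antipode_lTensor_comul]
  rw [e₂, h] at e₁
  have e₃ : ∀ (t : A ⊗[ℂ] A) (b : A), Θ (TensorProduct.assoc ℂ A A A (t ⊗ₜ b))
      = t * (1 ⊗ₜ HopfAlgebra.antipode ℂ b) := by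
    intro t b
    induction t using TensorProduct.induction_on with
    | zero => simp
    | add s t hs ht => simp only [TensorProduct.add_tmul, map_add, hs, ht, add_mul]
    | tmul c d => simp [Θ]
  simp only [map_sum, LinearMap.rTensor_tmul, e₃] at e₁
  have e₄ := congrArg swap e₁
  simpa only [map_sum, map_mul, swap_tmul] using e₄

end Hopf

/-! ### Covariance of dressed rows -/

section Dressed

variable {G B : Type*} [Ring G] [Algebra ℂ G] [Ring B] [Algebra ℂ B]
  {n : Type*} [Fintype n] [DecidableEq n]

/-- Moving ξ through U leaves Δ(ξ)R⁻¹ = R⁻¹Δ'(ξ), so the dressed row is covariant for the opposite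
co-product. -/
theorem mul_vecMul_dress {ι : G →ₐ[ℂ] B} {Δ : G →ₐ[ℂ] G ⊗[ℂ] G} {R : (G ⊗[ℂ] G)ˣ}
    (hR : ∀ ξ, (R : G ⊗[ℂ] G) * Δ ξ = swap (Δ ξ) * R) {τ : G →ₐ[ℂ] Matrix n n ℂ} {U : n → B}
    (hU : IsCovariant ι Δ τ U) (ξ : G) :
    (fun β => ι ξ * Matrix.vecMul U (dress ι τ ((R⁻¹ : (G ⊗[ℂ] G)ˣ) : G ⊗[ℂ] G)) β)
      = Matrix.vecMul (Matrix.vecMul U (dress ι τ ((R⁻¹ : (G ⊗[ℂ] G)ˣ) : G ⊗[ℂ] G)))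
        (dress ι τ (swap (Δ ξ))) := by
  have h : ((R⁻¹ : (G ⊗[ℂ] G)ˣ) : G ⊗[ℂ] G) * swap (Δ ξ)
      = Δ ξ * ((R⁻¹ : (G ⊗[ℂ] G)ˣ) : G ⊗[ℂ] G) := by
    rw [Units.inv_mul_eq_iff_eq_mul, ← mul_assoc, hR, mul_assoc, Units.mul_inv, mul_one]
  rw [Matrix.vecMul_vecMul, ← map_mul, h, map_mul, ← Matrix.vecMul_vecMul]
  ext β
  simp only [Matrix.vecMul, dotProduct, Finset.mul_sum, ← mul_assoc]
  refine Finset.sum_congr rfl fun α _ => ?_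
  rw [hU]
  rfl

theorem slice_entry_mul (τ : G →ₐ[ℂ] Matrix n n ℂ) (s t : G ⊗[ℂ] G) (α γ : n) :
    slice (entry τ α γ) (s * t) = ∑ β, slice (entry τ α β) s * slice (entry τ β γ) t := by
  have h := congrFun (congrFun (map_mul (dress (AlgHom.id ℂ G) τ) s t) α) γ
  simpa only [Matrix.mul_apply, dress_apply, AlgHom.id_apply] using h

end Dressed

/-! ### Covariance and functoriality of the rows U^*(i) -/

section LatticeRep

variable {V L : Type*} [Fintype V] {𝒢 : V → Type*} [∀ x, Ring (𝒢 x)] [∀ x, HopfAlgebra ℂ (𝒢 x)]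
  [∀ x, StarRing (𝒢 x)] [∀ x, StarModule ℂ (𝒢 x)] [∀ x, RibbonHopfStar (𝒢 x)]
  {H : Type*} [Ring H] [HopfAlgebra ℂ H] [StarRing H] [StarModule ℂ H] [RibbonHopfStar H]
  {Lab : Type*} [Fintype Lab] (Γ : CiliatedGraph V L) (T : ∀ x, TwistEquiv (𝒢 x) H)
  {ρ : UnitaryIrreps H Lab} (cg : ClebschGordan ρ) {B : Type*} [Ring B] [Algebra ℂ B]

local notation "Rg" => (gaugeR 𝒢 : Gauge 𝒢 ⊗[ℂ] Gauge 𝒢)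
local notation "Rgi" => (((gaugeR 𝒢)⁻¹ : (Gauge 𝒢 ⊗[ℂ] Gauge 𝒢)ˣ) : Gauge 𝒢 ⊗[ℂ] Gauge 𝒢)

/-- Rows `U^I(i)` that satisfy the relations of the lattice algebra. -/
structure IsLatticeRep (ι : Gauge 𝒢 →ₐ[ℂ] B)
    (U : ∀ I, L → Fin (ρ.dim I) × Fin (ρ.dim I) → B) : Prop where
  covariance : ∀ I i, IsCovariant ι (gaugeComul 𝒢) (linkRep Γ T ρ I i) (U I i)
  functoriality : ∀ I J i, rowMul (U I i) (U J i) = ∑ K, ∑ a, Matrix.vecMul (U K i)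
    ((linkCGMat Γ T cg I J K a i).map (algebraMap ℂ B))
  inverse : ∀ I i a c, ∑ b, U I i (a, b) * U I (Γ.rev i) (b, c) = if a = c then 1 else 0
  braid : ∀ I J i j, Γ.lt i j ∨ Γ.NoCommonEnd i j → rowMul (U I i) (U J j)
    = Matrix.vecMul (flipRow (rowMul (U J j) (U I i)))
      ((linkRep₂ Γ T (ρ := ρ) I J i j Rg).map (algebraMap ℂ B))
  braid_self : ∀ I J i, rowMul (U I i) (U J i)
    = Matrix.vecMul (flipRow (rowMul (U J i) (U I i)))
      ((stMat (vertexRep₂ T ρ I J (Γ.source i) (Rmat (𝒢 (Γ.source i))))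
        (vertexRep₂ T ρ I J (Γ.target i) (swap (((Rmat (𝒢 (Γ.target i)))⁻¹ :
          (𝒢 (Γ.target i) ⊗[ℂ] 𝒢 (Γ.target i))ˣ) : 𝒢 (Γ.target i) ⊗[ℂ] 𝒢 (Γ.target i))))).map
        (algebraMap ℂ B))

variable (ι : Gauge 𝒢 →ₐ[ℂ] B) (U : ∀ I, L → Fin (ρ.dim I) × Fin (ρ.dim I) → B)

/-- The row `U^I(i) (τ^{I,i} ⊗ id)(R⁻¹)`. -/
def dressedHol (I : Lab) (i : L) : Fin (ρ.dim I) × Fin (ρ.dim I) → B :=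
  Matrix.vecMul (U I i) (dress ι (linkRep Γ T ρ I i) Rgi)

/-- The row `U^I(-i) (τ^{I,-i} ⊗ id)(R⁻¹) η^{I,i}`. -/
def starHol (I : Lab) (i : L) : Fin (ρ.dim I) × Fin (ρ.dim I) → B :=
  Matrix.vecMul (dressedHol Γ T ι U I (Γ.rev i)) ((etaMat Γ T ρ I i).map (algebraMap ℂ B))

variable {Γ T cg ι U}

theorem IsLatticeRep.mul_starHol (h : IsLatticeRep Γ T cg ι U) (I : Lab) (i : L) (ξ : Gauge 𝒢) :
    (fun β => ι ξ * starHol Γ T ι U I i β)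
      = Matrix.vecMul (Matrix.vecMul (dressedHol Γ T ι U I (Γ.rev i))
          (dress ι (linkRep Γ T ρ I (Γ.rev i)) (swap (gaugeComul 𝒢 ξ))))
        ((etaMat Γ T ρ I i).map (algebraMap ℂ B)) := by
  have e := mul_vecMul_dress (R := gaugeR 𝒢) gaugeR_comul (h.covariance I (Γ.rev i)) ξ
  rw [dressedHol, ← e]
  ext β
  rw [starHol, vecMul_map_apply, vecMul_map_apply, Finset.mul_sum]
  exact Finset.sum_congr rfl fun γ _ => by rw [mul_smul_comm]; rfl

/-- Passing the conjugated matrix elements through η produces an antipode, and moving the gauge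
element through the dressed row produces Δ'. Together they form ∑ Δ'(f)(𝒮(g) ⊗ 1) over Δ(a^*) = ∑ f
⊗ g, which is 1 ⊗ a^* by `sum_swap_comul_mul_antipode`. -/
theorem IsLatticeRep.starHol_mul_star_single (h : IsLatticeRep Γ T cg ι U) (I : Lab) (i : L)
    (z : V) (a : 𝒢 z) (α : Fin (ρ.dim I) × Fin (ρ.dim I)) :
    starHol Γ T ι U I i α * ι (piStar (single z a))
      = ∑ β, ι (piStar (slice (entry (linkRep Γ T ρ I i) β α) (gaugeComul 𝒢 (single z a))))
        * starHol Γ T ι U I i β := by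
  obtain ⟨s, hs⟩ := TensorProduct.exists_finset (Coalgebra.comul (R := ℂ) a)
  have hs' : Coalgebra.comul (R := ℂ) (star a) = ∑ p ∈ s, star p.2 ⊗ₜ[ℂ] star p.1 := by
    rw [RibbonHopfStar.comul_star, flipStar, hs, star_sum, map_sum]
    exact Finset.sum_congr rfl fun p _ => by rw [TensorProduct.star_tmul, swap_tmul]
  have e₁ : ∀ β, ι (piStar (slice (entry (linkRep Γ T ρ I i) β α) (gaugeComul 𝒢 (single z a))))
      * starHol Γ T ι U I i β = ∑ p ∈ s, conjMat _ (linkRep Γ T ρ I i (single z p.1)) β α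
        • (ι (single z (star p.2)) * starHol Γ T ι U I i β) := by
    intro β
    rw [gaugeComul_single, hs]
    simp only [map_sum, single₂_tmul, slice_tmul, entry_apply, piStar_smul, piStar_single,
      map_smul, Finset.sum_mul, smul_mul_assoc]
    rfl
  simp only [e₁]
  rw [Finset.sum_comm]
  have e₂ : ∀ p ∈ s, ∑ β, conjMat _ (linkRep Γ T ρ I i (single z p.1)) β α
        • (ι (single z (star p.2)) * starHol Γ T ι U I i β)
      = Matrix.vecMul (dressedHol Γ T ι U I (Γ.rev i))
        (dress ι (linkRep Γ T ρ I (Γ.rev i)) (single₂ 𝒢 z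
          (swap (Coalgebra.comul (R := ℂ) (star p.2)) * (HopfAlgebra.antipode ℂ (star p.1) ⊗ₜ 1)))
          * (etaMat Γ T ρ I i).map (algebraMap ℂ B)) α := by
    intro p _
    rw [← vecMul_map_apply, h.mul_starHol, Matrix.vecMul_vecMul, Matrix.vecMul_vecMul,
      ← Matrix.map_mul, etaMat_conj, Matrix.map_mul, ← Matrix.mul_assoc, ← dress_includeLeft ι,
      ← map_mul, gaugeComul_single, swap_single₂, map_mul (single₂ 𝒢 z), single₂_tmul, map_one]
  rw [Finset.sum_congr rfl e₂, ← Finset.sum_apply, ← Matrix.vecMul_sum, ← Finset.sum_mul,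
    ← map_sum, ← map_sum, sum_swap_comul_mul_antipode hs', single₂_tmul, map_one,
    ← Matrix.vecMul_vecMul, vecMul_dress_one_tmul, vecMul_map_mul_right, piStar_single]
  rfl

theorem IsLatticeRep.starHol_mul_star (h : IsLatticeRep Γ T cg ι U) (I : Lab) (i : L)
    (ξ : Gauge 𝒢) (α : Fin (ρ.dim I) × Fin (ρ.dim I)) :
    starHol Γ T ι U I i α * ι (piStar ξ)
      = ∑ β, ι (piStar (slice (entry (linkRep Γ T ρ I i) β α) (gaugeComul 𝒢 ξ)))
        * starHol Γ T ι U I i β := by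
  let P : Subalgebra ℂ (Gauge 𝒢) :=
    { carrier := {ξ | ∀ α, starHol Γ T ι U I i α * ι (piStar ξ)
        = ∑ β, ι (piStar (slice (entry (linkRep Γ T ρ I i) β α) (gaugeComul 𝒢 ξ)))
          * starHol Γ T ι U I i β}
      mul_mem' := by
        intro ξ ζ hξ hζ
        rw [Set.mem_ofPred_eq] at *
        intro α
        simp only [piStar_mul, map_mul, ← mul_assoc, hζ, Finset.sum_mul, slice_entry_mul, map_sum]
        simp only [mul_assoc, hξ, Finset.mul_sum]
        exact Finset.sum_comm
      add_mem' := by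
        intro ξ ζ hξ hζ
        rw [Set.mem_ofPred_eq] at *
        intro α
        simp only [map_add, mul_add, add_mul, Finset.sum_add_distrib, hξ, hζ]
      algebraMap_mem' := by
        intro c
        rw [Set.mem_ofPred_eq]
        intro α
        have e : ∀ β, slice (entry (linkRep Γ T ρ I i) β α)
            (gaugeComul 𝒢 (algebraMap ℂ (Gauge 𝒢) c))
            = algebraMap ℂ (Gauge 𝒢) (c * (1 : Matrix _ _ ℂ) β α) := by
          intro β
          rw [AlgHom.commutes, Algebra.algebraMap_eq_smul_one, map_smul,
            Algebra.TensorProduct.one_def, slice_tmul, entry_apply, map_one, smul_smul,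
            Algebra.algebraMap_eq_smul_one]
        simp only [e]
        simp only [piStar_algebraMap, AlgHom.commutes]
        rw [Finset.sum_eq_single α]
        · rw [Matrix.one_apply_eq, mul_one, Algebra.commutes]
        · intro β _ hβ
          rw [Matrix.one_apply_ne hβ, mul_zero, star_zero, map_zero, zero_mul]
        · simp }
  exact mem_of_single_mem P (fun z a α => h.starHol_mul_star_single I i z a α) ξ α

/-- `rowMul_dress` and functoriality for -i express the left side by the rows U^K(-i). The
Clebsch-Gordan maps, being intertwiners, pass through the dressing (`e₁`, `e₂`), and the comparison
of coefficients is `linkCGMat_etaMat`. -/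
theorem IsLatticeRep.starHol_functoriality (h : IsLatticeRep Γ T cg ι U) (I J : Lab) (i : L) :
    rowMul (starHol Γ T ι U J i) (starHol Γ T ι U I i)
      = flipRow (∑ K, ∑ b, Matrix.vecMul (starHol Γ T ι U K i)
        (((linkCGMat Γ T cg I J K b i).map (starRingEnd ℂ)).map (algebraMap ℂ B))) := by
  have e₁ : ∀ K a, (linkCGMat Γ T cg J I K a (Γ.rev i)).map (algebraMap ℂ B)
      * dress ι ((linkRep₂ Γ T (ρ := ρ) J I (Γ.rev i) (Γ.rev i)).comp (gaugeComul 𝒢)) Rgi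
      = dress ι (linkRep Γ T ρ K (Γ.rev i)) Rgi
        * (linkCGMat Γ T cg J I K a (Γ.rev i)).map (algebraMap ℂ B) := by
    intro K a
    have := map_mul_dress_mul_map ι
      (σ := (linkRep₂ Γ T (ρ := ρ) J I (Γ.rev i) (Γ.rev i)).comp (gaugeComul 𝒢))
      (σ' := linkRep Γ T ρ K (Γ.rev i)) (M := linkCGMat Γ T cg J I K a (Γ.rev i)) (N := 1)
      (M' := 1) (N' := linkCGMat Γ T cg J I K a (Γ.rev i)) (fun ξ => by
        rw [Matrix.mul_one, Matrix.one_mul]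
        exact linkCGMat_intertwine Γ T cg J I K a (Γ.rev i) ξ) Rgi
    simpa only [map_one_algebraMap, Matrix.mul_one, Matrix.one_mul] using this
  have e₂ : ∀ K a, Matrix.vecMul (Matrix.vecMul (Matrix.vecMul (U K (Γ.rev i))
        ((linkCGMat Γ T cg J I K a (Γ.rev i)).map (algebraMap ℂ B)))
        (dress ι ((linkRep₂ Γ T (ρ := ρ) J I (Γ.rev i) (Γ.rev i)).comp (gaugeComul 𝒢)) Rgi
          * (linkRep₂ Γ T (ρ := ρ) J I (Γ.rev i) (Γ.rev i) Rgi).map (algebraMap ℂ B)))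
        ((etaMat Γ T ρ J i ⊗ₖ etaMat Γ T ρ I i).map (algebraMap ℂ B))
      = Matrix.vecMul (dressedHol Γ T ι U K (Γ.rev i))
        ((linkCGMat Γ T cg J I K a (Γ.rev i) * linkRep₂ Γ T (ρ := ρ) J I (Γ.rev i) (Γ.rev i) Rgi
          * (etaMat Γ T ρ J i ⊗ₖ etaMat Γ T ρ I i)).map (algebraMap ℂ B)) := by
    intro K a
    rw [dressedHol, Matrix.vecMul_vecMul, Matrix.vecMul_vecMul, Matrix.vecMul_vecMul]
    simp only [Matrix.map_mul, ← Matrix.mul_assoc, e₁]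
  rw [starHol, starHol, rowMul_vecMul_map, dressedHol, dressedHol,
    rowMul_dress (h.covariance I (Γ.rev i)) isCocycle_gaugeR_inv, h.functoriality]
  simp only [Matrix.sum_vecMul, e₂]
  ext p
  rw [flipRow_apply]
  simp only [Finset.sum_apply]
  refine Finset.sum_congr rfl fun K _ => ?_
  have e₃ : ∀ b, Matrix.vecMul (starHol Γ T ι U K i)
        (((linkCGMat Γ T cg I J K b i).map (starRingEnd ℂ)).map (algebraMap ℂ B))
      = Matrix.vecMul (dressedHol Γ T ι U K (Γ.rev i)) ((etaMat Γ T ρ K i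
        * (linkCGMat Γ T cg I J K b i).map (starRingEnd ℂ)).map (algebraMap ℂ B)) := by
    intro b
    rw [starHol, Matrix.vecMul_vecMul, Matrix.map_mul (f := algebraMap ℂ B)]
  simp only [e₃]
  simp only [vecMul_map_apply]
  rw [Finset.sum_comm]
  conv_rhs => rw [Finset.sum_comm]
  refine Finset.sum_congr rfl fun γ _ => ?_
  rw [← Finset.sum_smul, ← Finset.sum_smul, linkCGMat_etaMat]

end LatticeRep

/-! ### The monodromy elements R_z'R_z -/

section Monodromy

variable {V : Type*} {𝒢 : V → Type*} [∀ x, Ring (𝒢 x)] [∀ x, HopfAlgebra ℂ (𝒢 x)]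
  [∀ x, StarRing (𝒢 x)] [∀ x, StarModule ℂ (𝒢 x)] [∀ x, RibbonHopfStar (𝒢 x)]

local notation "Rg" => (gaugeR 𝒢 : Gauge 𝒢 ⊗[ℂ] Gauge 𝒢)
local notation "Rgi" => (((gaugeR 𝒢)⁻¹ : (Gauge 𝒢 ⊗[ℂ] Gauge 𝒢)ˣ) : Gauge 𝒢 ⊗[ℂ] Gauge 𝒢)

variable (𝒢) in
/-- The image of `R_z' R_z` in `𝒢 ⊗ 𝒢`. -/
def monodromy (z : V) : Gauge 𝒢 ⊗[ℂ] Gauge 𝒢 :=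
  single₂ 𝒢 z (swap (Rmat (𝒢 z) : 𝒢 z ⊗[ℂ] 𝒢 z) * (Rmat (𝒢 z) : 𝒢 z ⊗[ℂ] 𝒢 z))

variable (𝒢) in
/-- The image of `(R_z' R_z)⁻¹` in `𝒢 ⊗ 𝒢`. -/
def monodromyInv (z : V) : Gauge 𝒢 ⊗[ℂ] Gauge 𝒢 :=
  single₂ 𝒢 z ((((Rmat (𝒢 z))⁻¹ : (𝒢 z ⊗[ℂ] 𝒢 z)ˣ) : 𝒢 z ⊗[ℂ] 𝒢 z)
    * swap (((Rmat (𝒢 z))⁻¹ : (𝒢 z ⊗[ℂ] 𝒢 z)ˣ) : 𝒢 z ⊗[ℂ] 𝒢 z))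

theorem monodromyInv_mul_monodromy (z : V) : monodromyInv 𝒢 z * monodromy 𝒢 z = 1 := by
  rw [monodromy, monodromyInv, ← map_mul, mul_assoc, ← mul_assoc (swap _), ← map_mul,
    Units.inv_mul, map_one, one_mul, Units.inv_mul, map_one]

/-- At the vertex z, R'RΔ = R'Δ'R = ΔR'R; co-products at other vertices commute trivially. -/
theorem commute_monodromy_gaugeComul [Fintype V] (z : V) (ξ : Gauge 𝒢) :
    Commute (monodromy 𝒢 z) (gaugeComul 𝒢 ξ) := by
  have h := mem_of_single_mem ((Subalgebra.centralizer ℂ {monodromy 𝒢 z}).comap (gaugeComul 𝒢))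
    (fun y a => ?_) ξ
  · exact (Subalgebra.mem_centralizer_iff ℂ).1 h _ rfl
  · change gaugeComul 𝒢 (single y a) ∈ Subalgebra.centralizer ℂ {monodromy 𝒢 z}
    rw [Subalgebra.mem_centralizer_iff]
    intro c hc
    rw [Set.mem_singleton_iff] at hc
    rw [hc, gaugeComul_single, monodromy]
    by_cases hzy : z = y
    · subst hzy
      rw [← map_mul, ← map_mul]
      congr 1
      have h₁ := Rmat_comul a
      have h₂ := congrArg swap h₁
      rw [map_mul, map_mul, swap_swap] at h₂
      rw [mul_assoc, h₁, ← mul_assoc, h₂, mul_assoc]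
    · exact (commute_single₂ 𝒢 hzy _ _).eq

/-- R'R is R_z'R_z times factors that commute with everything at z, hence commutes with R_z'R_z, and
so does its inverse. -/
theorem commute_monodromy_gaugeR_inv [Fintype V] (z : V) :
    Commute (monodromy 𝒢 z) (Rgi * swap Rgi) := by
  classical
  let c : (Gauge 𝒢 ⊗[ℂ] Gauge 𝒢)ˣ := Units.map (swap (A := Gauge 𝒢) : _ →* _) (gaugeR 𝒢) * gaugeR 𝒢
  have hc : ((c⁻¹ : (Gauge 𝒢 ⊗[ℂ] Gauge 𝒢)ˣ) : Gauge 𝒢 ⊗[ℂ] Gauge 𝒢) = Rgi * swap Rgi := by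
    rw [mul_inv_rev, Units.val_mul]
    rfl
  rw [← hc]
  refine Commute.units_inv_right ?_
  change Commute _ (swap Rg * Rg)
  obtain ⟨r, hr, hr'⟩ : ∃ r, Rg = single₂ 𝒢 z (Rmat (𝒢 z)) * r ∧
      ∀ t, Commute (single₂ 𝒢 z t) r := by
    refine ⟨(((Finset.univ.erase z).noncommProd (vertexR 𝒢)
      (fun _ _ _ _ h => commute_vertexR h) : (Gauge 𝒢 ⊗[ℂ] Gauge 𝒢)ˣ) : Gauge 𝒢 ⊗[ℂ] Gauge 𝒢),
      congrArg Units.val (gaugeR_eq_vertexR_mul (𝒢 := 𝒢) z), fun t => ?_⟩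
    have e := Finset.map_noncommProd (Finset.univ.erase z) (vertexR 𝒢)
      (fun _ _ _ _ h => commute_vertexR h) (Units.coeHom (Gauge 𝒢 ⊗[ℂ] Gauge 𝒢))
    have e' := Finset.noncommProd_commute (Finset.univ.erase z)
      (fun y => (vertexR 𝒢 y : Gauge 𝒢 ⊗[ℂ] Gauge 𝒢)) (fun _ _ _ _ h => commute_single₂ 𝒢 h _ _)
      (single₂ 𝒢 z t) fun y hy => commute_single₂ 𝒢 (Finset.ne_of_mem_erase hy).symm t _
    exact (congrArg (Commute (single₂ 𝒢 z t)) e).mpr e'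
  have hr'' : ∀ t, Commute (single₂ 𝒢 z t) (swap r) := by
    intro t
    have := (hr' (swap t)).map (swap (A := Gauge 𝒢))
    rwa [swap_single₂, swap_swap] at this
  have e : swap Rg * Rg = monodromy 𝒢 z * (swap r * r) := by
    rw [hr, map_mul, swap_single₂, monodromy, map_mul]
    simp only [mul_assoc]
    rw [← mul_assoc (swap r), ← (hr'' _).eq]
    simp only [mul_assoc]
  rw [e]
  exact (Commute.refl _).mul_right ((hr'' _).mul_right (hr' _))

end Monodromy

/-! ### Braid relations of the rows U^*(i) -/

section Braid

variable {V L : Type*} [Fintype V] {𝒢 : V → Type*} [∀ x, Ring (𝒢 x)] [∀ x, HopfAlgebra ℂ (𝒢 x)]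
  [∀ x, StarRing (𝒢 x)] [∀ x, StarModule ℂ (𝒢 x)] [∀ x, RibbonHopfStar (𝒢 x)]
  {H : Type*} [Ring H] [HopfAlgebra ℂ H] [StarRing H] [StarModule ℂ H] [RibbonHopfStar H]
  {Lab : Type*} (Γ : CiliatedGraph V L) (T : ∀ x, TwistEquiv (𝒢 x) H)
  {ρ : UnitaryIrreps H Lab} {cg : ClebschGordan ρ} {B : Type*} [Ring B] [Algebra ℂ B]

local notation "Rg" => (gaugeR 𝒢 : Gauge 𝒢 ⊗[ℂ] Gauge 𝒢)
local notation "Rgi" => (((gaugeR 𝒢)⁻¹ : (Gauge 𝒢 ⊗[ℂ] Gauge 𝒢)ˣ) : Gauge 𝒢 ⊗[ℂ] Gauge 𝒢)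

/-- Since R_y(R_y'R_y)⁻¹ = R_y'⁻¹, the braid matrix of a single link is the image of an element of 𝒢
⊗ 𝒢, and complex conjugation can be handled through η. -/
theorem linkRep₂_gaugeR_mul_target (I J : Lab) (i : L) :
    linkRep₂ Γ T (ρ := ρ) I J i i (Rg * monodromyInv 𝒢 (Γ.target i))
      = stMat (vertexRep₂ T ρ I J (Γ.source i) (Rmat (𝒢 (Γ.source i))))
        (vertexRep₂ T ρ I J (Γ.target i) (swap (((Rmat (𝒢 (Γ.target i)))⁻¹ :
          (𝒢 (Γ.target i) ⊗[ℂ] 𝒢 (Γ.target i))ˣ) : 𝒢 (Γ.target i) ⊗[ℂ] 𝒢 (Γ.target i)))) := by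
  rw [map_mul, linkRep₂_gaugeR Γ T I J rfl rfl, monodromyInv, linkRep₂_target Γ T I J rfl rfl,
    stMat_mul, one_mul, ← map_mul, ← mul_assoc, Units.mul_inv, one_mul]

theorem linkRep₂_gaugeR_mul_source (I J : Lab) (i : L) :
    linkRep₂ Γ T (ρ := ρ) I J i i (Rg * monodromyInv 𝒢 (Γ.source i))
      = stMat (vertexRep₂ T ρ I J (Γ.source i) (swap (((Rmat (𝒢 (Γ.source i)))⁻¹ :
          (𝒢 (Γ.source i) ⊗[ℂ] 𝒢 (Γ.source i))ˣ) : 𝒢 (Γ.source i) ⊗[ℂ] 𝒢 (Γ.source i))))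
        (vertexRep₂ T ρ I J (Γ.target i) (Rmat (𝒢 (Γ.target i)))) := by
  rw [map_mul, linkRep₂_gaugeR Γ T I J rfl rfl, monodromyInv, linkRep₂_source Γ T I J rfl rfl,
    stMat_mul, mul_one, ← map_mul, antipode₂_mul, antipode₂_swap, antipode₂_Rmat_inv, mul_assoc,
    Units.inv_mul, mul_one]

theorem etaConj_gaugeR_mul_monodromyInv (I J : Lab) (i j : L) (z : V) :
    EtaConj Γ T ρ I J i j (Rg * monodromyInv 𝒢 z) (swap Rgi * monodromy 𝒢 z) := by
  refine (etaConj_gaugeR I J i j).mul ?_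
  have h := etaConj_single₂ (Γ := Γ) (T := T) (ρ := ρ) I J i j z
    ((((Rmat (𝒢 z))⁻¹ : (𝒢 z ⊗[ℂ] 𝒢 z)ˣ) : 𝒢 z ⊗[ℂ] 𝒢 z)
    * swap (((Rmat (𝒢 z))⁻¹ : (𝒢 z ⊗[ℂ] 𝒢 z)ˣ) : 𝒢 z ⊗[ℂ] 𝒢 z))
  rw [star_mul, star_swap, star_Rmat_inv, swap_swap, antipode₂_mul, antipode₂_swap,
    antipode₂_Rmat] at h
  exact h

variable [Fintype Lab] {Γ T} {ι : Gauge 𝒢 →ₐ[ℂ] B} {U : ∀ I, L → Fin (ρ.dim I) × Fin (ρ.dim I) → B}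

theorem IsLatticeRep.matrix_mul (h : IsLatticeRep Γ T cg ι U) (I : Lab) (i : L) :
    (Matrix.of fun a b => U I i (a, b)) * (Matrix.of fun a b => U I (Γ.rev i) (a, b)) = 1 := by
  ext a c
  rw [Matrix.mul_apply, Matrix.one_apply]
  exact h.inverse I i a c

theorem IsLatticeRep.matrix_rev_mul (h : IsLatticeRep Γ T cg ι U) (I : Lab) (i : L) :
    (Matrix.of fun a b => U I (Γ.rev i) (a, b)) * (Matrix.of fun a b => U I i (a, b)) = 1 := by
  have := h.matrix_mul I (Γ.rev i)
  rwa [Γ.rev_rev] at this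

/-- For i < j the relation is derived, not imposed: U(-i) and U(-j) are the inverse matrices of U(i)
and U(j). Links without common endpoints keep this property under reversal. -/
theorem IsLatticeRep.braid_rev (h : IsLatticeRep Γ T cg ι U) (I J : Lab) (i j : L)
    (hij : Γ.lt i j ∨ Γ.NoCommonEnd i j) : rowMul (U I (Γ.rev i)) (U J (Γ.rev j))
    = Matrix.vecMul (flipRow (rowMul (U J (Γ.rev j)) (U I (Γ.rev i))))
      ((linkRep₂ Γ T (ρ := ρ) I J (Γ.rev i) (Γ.rev j) Rg).map (algebraMap ℂ B)) := by
  rcases hij with hij | hij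
  · obtain ⟨X, Y, Y', hY, e₁, e₂⟩ := exists_stMat Γ T (ρ := ρ) I J (Γ.lt_target i j hij)
    have hb := h.braid I J i j (Or.inl hij)
    rw [e₁] at hb
    rw [e₂]
    exact rowMul_inv (h.matrix_mul I i) (h.matrix_rev_mul I i) (h.matrix_mul J j)
      (h.matrix_rev_mul J j) hY hb
  · refine h.braid I J _ _ (Or.inr ?_)
    unfold CiliatedGraph.NoCommonEnd
    rw [source_rev, source_rev, target_rev, target_rev]
    exact ⟨hij.2.2.2, hij.2.2.1, hij.2.1, hij.1⟩

/-- Here q = R and q' = (R⁻¹)', for which the two sides of the last condition of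
`flipRow_rowMul_dress` coincide literally. -/
theorem IsLatticeRep.starHol_braid (h : IsLatticeRep Γ T cg ι U) (I J : Lab) (i j : L)
    (hij : Γ.lt i j ∨ Γ.NoCommonEnd i j) :
    flipRow (rowMul (starHol Γ T ι U J j) (starHol Γ T ι U I i))
      = Matrix.vecMul (rowMul (starHol Γ T ι U I i) (starHol Γ T ι U J j))
        ((conjMat _ (linkRep₂ Γ T (ρ := ρ) I J i j Rg)).map (algebraMap ℂ B)) :=
  flipRow_rowMul_dress ι (R := gaugeR 𝒢) gaugeR_comul isCocycle_gaugeR_inv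
    (h.covariance I (Γ.rev i)) (h.covariance J (Γ.rev j)) (h.braid_rev I J i j hij)
    (etaConj_gaugeR I J i j) fun _ => rfl

theorem stMat_submatrix {m n : Type*} (X Y : Matrix (m × n) (m × n) ℂ) :
    (stMat X Y).submatrix (Equiv.prodComm _ _) (Equiv.prodComm _ _)
      = stMat (X.submatrix (Equiv.prodComm n m) (Equiv.prodComm n m))
        (Y.submatrix (Equiv.prodComm n m) (Equiv.prodComm n m)) := rfl

/-- The relation for (J, I) is flipped and solved for the other order of the product. When it is
applied to -i, whose source is the target y of i, the element R(R_y'R_y)⁻¹ is the same as in the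
relation for i. -/
theorem IsLatticeRep.braid_self_flip (h : IsLatticeRep Γ T cg ι U) (I J : Lab) (i : L) :
    rowMul (U I i) (U J i) = Matrix.vecMul (flipRow (rowMul (U J i) (U I i)))
      ((linkRep₂ Γ T (ρ := ρ) I J i i (Rg * monodromyInv 𝒢 (Γ.source i))).map
        (algebraMap ℂ B)) := by
  have hb := congrArg flipRow (h.braid_self J I i)
  rw [flipRow_vecMul, flipRow_flipRow, Matrix.submatrix_map, stMat_submatrix,
    tensorRepHom_submatrix, tensorRepHom_submatrix, swap_swap] at hb
  rw [linkRep₂_gaugeR_mul_source, hb, Matrix.vecMul_vecMul, ← Matrix.map_mul, stMat_mul, ← map_mul,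
    ← map_mul, ← map_mul, Units.inv_mul, Units.inv_mul, map_one, map_one, map_one, stMat_one,
    map_one_algebraMap, Matrix.vecMul_one]

theorem IsLatticeRep.starHol_braid_self (h : IsLatticeRep Γ T cg ι U) (I J : Lab) (i : L) :
    flipRow (rowMul (starHol Γ T ι U J i) (starHol Γ T ι U I i))
      = Matrix.vecMul (rowMul (starHol Γ T ι U I i) (starHol Γ T ι U J i))
        ((conjMat _ (stMat (vertexRep₂ T ρ I J (Γ.source i) (Rmat (𝒢 (Γ.source i))))
        (vertexRep₂ T ρ I J (Γ.target i) (swap (((Rmat (𝒢 (Γ.target i)))⁻¹ :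
          (𝒢 (Γ.target i) ⊗[ℂ] 𝒢 (Γ.target i))ˣ) : 𝒢 (Γ.target i) ⊗[ℂ] 𝒢 (Γ.target i)))))).map
          (algebraMap ℂ B)) := by
  rw [← linkRep₂_gaugeR_mul_target]
  have hb := h.braid_self_flip I J (Γ.rev i)
  rw [source_rev] at hb
  refine flipRow_rowMul_dress ι (R := gaugeR 𝒢) gaugeR_comul isCocycle_gaugeR_inv
    (h.covariance I (Γ.rev i)) (h.covariance J (Γ.rev i)) hb
    (etaConj_gaugeR_mul_monodromyInv Γ T I J i i (Γ.target i)) fun ξ => ?_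
  -- The monodromy at the target commutes with Δ(ξ) and with R⁻¹R'⁻¹, so it can be moved next to its
  -- inverse and cancelled.
  simp only [← map_mul]
  congr 1
  have h₁ := (commute_monodromy_gaugeComul (Γ.target i) ξ).eq
  have h₂ := (commute_monodromy_gaugeR_inv (𝒢 := 𝒢) (Γ.target i)).eq
  have h₃ := monodromyInv_mul_monodromy (𝒢 := 𝒢) (Γ.target i)
  generalize monodromy 𝒢 (Γ.target i) = c at *
  generalize monodromyInv 𝒢 (Γ.target i) = c' at *
  generalize gaugeComul 𝒢 ξ = d at *
  rw [← mul_assoc Rgi, ← h₂, mul_assoc (Rg * c'), ← mul_assoc d, ← h₁, mul_assoc c, mul_assoc Rg,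
    ← mul_assoc c', h₃, one_mul, mul_assoc]

end Braid

/-! ### Contraction of the indices of i with those of -i -/

section PairVec

variable {n : Type*} [Fintype n] [DecidableEq n]

/-- The vector with entries `Z_{γ₂ β₁} Y_{β₂ γ₁}`. -/
def pairVec (Z Y : Matrix n n ℂ) : (n × n) × (n × n) → ℂ := fun q => Z q.2.2 q.1.1 * Y q.1.2 q.2.1

theorem pairVec_add_left (Z Z' Y : Matrix n n ℂ) :
    pairVec (Z + Z') Y = pairVec Z Y + pairVec Z' Y := by
  ext q; simp [pairVec, add_mul]

theorem pairVec_add_right (Z Y Y' : Matrix n n ℂ) :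
    pairVec Z (Y + Y') = pairVec Z Y + pairVec Z Y' := by
  ext q; simp [pairVec, mul_add]

theorem pairVec_smul_left (c : ℂ) (Z Y : Matrix n n ℂ) : pairVec (c • Z) Y = c • pairVec Z Y := by
  ext q; simp [pairVec, mul_assoc]

theorem pairVec_smul_right (c : ℂ) (Z Y : Matrix n n ℂ) : pairVec Z (c • Y) = c • pairVec Z Y := by
  ext q; simp [pairVec, mul_left_comm]

theorem pairVec_zero_left (Y : Matrix n n ℂ) : pairVec 0 Y = 0 := by
  ext q; simp [pairVec]

theorem pairVec_zero_right (Z : Matrix n n ℂ) : pairVec Z 0 = 0 := by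
  ext q; simp [pairVec]

theorem kronecker_mulVec_pairVec (A C A' C' Z Y : Matrix n n ℂ) :
    ((A.transpose ⊗ₖ C) ⊗ₖ (A'.transpose ⊗ₖ C')).mulVec (pairVec Z Y)
      = pairVec (C' * Z * A) (C * Y * A') := by
  ext q
  simp only [Matrix.mulVec, dotProduct, Fintype.sum_prod_type, pairVec, Matrix.mul_apply,
    Matrix.kroneckerMap_apply, Matrix.transpose_apply, Finset.sum_mul, Finset.mul_sum]
  conv_lhs => enter [2, a]; rw [Finset.sum_comm]
  rw [Finset.sum_comm]
  refine Finset.sum_congr rfl fun a _ => ?_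
  rw [Finset.sum_comm]
  exact Finset.sum_congr rfl fun b _ => Finset.sum_congr rfl fun c _ =>
    Finset.sum_congr rfl fun d _ => by ring

/-- Y = 1 contracts the inner indices, so the inverse relation leaves δ in the outer ones and only
the trace of Z survives. -/
theorem sum_pairVec_smul {B : Type*} [Ring B] [Algebra ℂ B] {U U' : n × n → B}
    (h : ∀ a c, ∑ b, U (a, b) * U' (b, c) = if a = c then 1 else 0) (Z : Matrix n n ℂ) :
    ∑ q, pairVec Z 1 q • rowMul U U' q = algebraMap ℂ B Z.trace := by
  have e : ∀ a c, ∑ b, ∑ b', pairVec Z 1 ((a, b), (b', c)) • rowMul U U' ((a, b), (b', c))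
      = if a = c then algebraMap ℂ B (Z c a) else 0 := by
    intro a c
    have : ∀ b, ∑ b', pairVec Z 1 ((a, b), (b', c)) • rowMul U U' ((a, b), (b', c))
        = Z c a • (U (a, b) * U' (b, c)) := by
      intro b
      rw [Finset.sum_eq_single b]
      · simp [pairVec, rowMul]
      · intro b' _ hb; simp [pairVec, hb.symm]
      · simp
    simp only [this]
    rw [← Finset.smul_sum, h, smul_ite, smul_zero, Algebra.algebraMap_eq_smul_one]
  simp only [Fintype.sum_prod_type]
  rw [Matrix.trace, map_sum]
  refine Finset.sum_congr rfl fun a _ => ?_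
  have : ∀ b, ∑ b', ∑ c, pairVec Z 1 ((a, b), (b', c)) • rowMul U U' ((a, b), (b', c))
      = ∑ c, ∑ b', pairVec Z 1 ((a, b), (b', c)) • rowMul U U' ((a, b), (b', c)) :=
    fun b => Finset.sum_comm
  simp only [this]
  rw [Finset.sum_comm]
  simp [e]

end PairVec

/-! ### The co-unit of 𝒢 -/

section Counit

variable {V : Type*} [Fintype V] {𝒢 : V → Type*} [∀ x, Ring (𝒢 x)] [∀ x, HopfAlgebra ℂ (𝒢 x)]

variable (𝒢) in
/-- The co-unit of `𝒢`. -/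
def gaugeCounit : Gauge 𝒢 →ₐ[ℂ] ℂ :=
  piLift (fun x => Bialgebra.counitAlgHom ℂ (𝒢 x)) fun _ _ _ _ _ => Commute.all _ _

theorem gaugeCounit_single (x : V) (a : 𝒢 x) :
    gaugeCounit 𝒢 (single x a) = Coalgebra.counit (R := ℂ) a := by
  exact piLift_single _ _ x a

theorem counit_id_gaugeR_inv [∀ x, StarRing (𝒢 x)] [∀ x, StarModule ℂ (𝒢 x)]
    [∀ x, RibbonHopfStar (𝒢 x)] : slice (gaugeCounit 𝒢).toLinearMap
      (((gaugeR 𝒢)⁻¹ : (Gauge 𝒢 ⊗[ℂ] Gauge 𝒢)ˣ) : Gauge 𝒢 ⊗[ℂ] Gauge 𝒢) = 1 := by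
  let f : (Gauge 𝒢 ⊗[ℂ] Gauge 𝒢) →ₐ[ℂ] Gauge 𝒢 :=
    Algebra.TensorProduct.lift ((Algebra.ofId ℂ (Gauge 𝒢)).comp (gaugeCounit 𝒢))
      (AlgHom.id ℂ (Gauge 𝒢)) fun ξ ζ => Algebra.commute_algebraMap_left (gaugeCounit 𝒢 ξ) ζ
  have hf : ∀ ξ ζ, f (ξ ⊗ₜ ζ) = gaugeCounit 𝒢 ξ • ζ := by
    intro ξ ζ
    rw [Algebra.smul_def]
    exact Algebra.TensorProduct.lift_tmul _ _ _ _ _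
  have hfs : ∀ t, f t = slice (gaugeCounit 𝒢).toLinearMap t := by
    intro t
    induction t using TensorProduct.induction_on with
    | zero => rw [map_zero, map_zero]
    | add s t hs ht => rw [map_add, map_add, hs, ht]
    | tmul a b => rw [hf, slice_tmul]; rfl
  have h₁ : f (gaugeR 𝒢 : Gauge 𝒢 ⊗[ℂ] Gauge 𝒢) = 1 := by
    refine map_gaugeR_eq_one f fun x => ?_
    obtain ⟨s, hs⟩ := exists_sum_Rmat (𝒢 x)
    have h := congrArg (single (A := 𝒢) x) (counit_id_Rmat hs)
    rw [hs, map_sum, map_sum]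
    rw [map_sum, map_one] at h
    rw [← h]
    refine Finset.sum_congr rfl fun p _ => ?_
    rw [single₂_tmul, hf, gaugeCounit_single, map_smul]
  rw [← hfs]
  have h₂ := congrArg f (gaugeR 𝒢).mul_inv
  rwa [map_mul, h₁, one_mul, map_one] at h₂

end Counit

/-! ### The inverse relation for the rows U^*(i) -/

section Inverse

variable {V L : Type*} [Fintype V] {𝒢 : V → Type*} [∀ x, Ring (𝒢 x)] [∀ x, HopfAlgebra ℂ (𝒢 x)]
  [∀ x, StarRing (𝒢 x)] [∀ x, StarModule ℂ (𝒢 x)] [∀ x, RibbonHopfStar (𝒢 x)]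
  {H : Type*} [Ring H] [HopfAlgebra ℂ H] [StarRing H] [StarModule ℂ H] [RibbonHopfStar H]
  {Lab : Type*} (Γ : CiliatedGraph V L) (T : ∀ x, TwistEquiv (𝒢 x) H)
  {ρ : UnitaryIrreps H Lab} {cg : ClebschGordan ρ} {B : Type*} [Ring B] [Algebra ℂ B]

local notation "Rgi" => (((gaugeR 𝒢)⁻¹ : (Gauge 𝒢 ⊗[ℂ] Gauge 𝒢)ˣ) : Gauge 𝒢 ⊗[ℂ] Gauge 𝒢)

theorem linkRep₂_rev_target (I : Lab) (i : L) (Z : Matrix (Fin (ρ.dim I)) (Fin (ρ.dim I)) ℂ)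
    (p : 𝒢 (Γ.target i)) (t : 𝒢 (Γ.target i) ⊗[ℂ] 𝒢 (Γ.target i)) :
    (linkRep₂ Γ T (ρ := ρ) I I i (Γ.rev i) (single₂ 𝒢 (Γ.target i) t)).mulVec
        (pairVec Z (vertexRep T ρ I (Γ.target i) p))
      = pairVec Z (vertexRep T ρ I (Γ.target i) (sandwich p t)) := by
  induction t using TensorProduct.induction_on with
  | zero => simp only [map_zero, Matrix.zero_mulVec, pairVec_zero_right]
  | add s t hs ht => simp only [map_add, Matrix.add_mulVec, pairVec_add_right, hs, ht]
  | tmul a b =>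
    rw [single₂_tmul, tensorRepHom_tmul, linkRep_single_target Γ T ρ I i rfl,
      linkRep_single_source Γ T ρ I _ (source_rev Γ i).symm, kronecker_mulVec_pairVec,
      sandwich_tmul, map_mul, map_mul, Matrix.one_mul, Matrix.mul_one]

/-- A tensor a ⊗ b at the source sends Z to τ(b)Zτ(𝒮(a)). Only its trace is controlled, which
suffices for the contraction, and cyclicity brings the two factors together as 𝒮(a)b. -/
theorem linkRep₂_rev_source (I : Lab) (i : L) (Z Y : Matrix (Fin (ρ.dim I)) (Fin (ρ.dim I)) ℂ)
    (t : 𝒢 (Γ.source i) ⊗[ℂ] 𝒢 (Γ.source i)) :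
    ∃ Z', (linkRep₂ Γ T (ρ := ρ) I I i (Γ.rev i) (single₂ 𝒢 (Γ.source i) t)).mulVec (pairVec Z Y)
        = pairVec Z' Y ∧
      Z'.trace = (Z * vertexRep T ρ I (Γ.source i)
        (LinearMap.mul' ℂ _ (LinearMap.rTensor _ (HopfAlgebra.antipode ℂ) t))).trace := by
  induction t using TensorProduct.induction_on with
  | zero => exact ⟨0, by simp only [map_zero, Matrix.zero_mulVec, pairVec_zero_left], by simp⟩
  | add s t hs ht =>
    obtain ⟨Z₁, h₁, h₁'⟩ := hs
    obtain ⟨Z₂, h₂, h₂'⟩ := ht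
    refine ⟨Z₁ + Z₂, ?_, ?_⟩
    · simp only [map_add, Matrix.add_mulVec, pairVec_add_left, h₁, h₂]
    · simp only [map_add, Matrix.mul_add, Matrix.trace_add, h₁', h₂']
  | tmul a b =>
    refine ⟨vertexRep T ρ I (Γ.source i) b * Z
      * vertexRep T ρ I (Γ.source i) (HopfAlgebra.antipode ℂ a), ?_, ?_⟩
    · rw [single₂_tmul, tensorRepHom_tmul, linkRep_single_source Γ T ρ I i rfl,
        linkRep_single_target Γ T ρ I _ (target_rev Γ i).symm, kronecker_mulVec_pairVec,
        Matrix.one_mul, Matrix.mul_one]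
    · rw [LinearMap.rTensor_tmul, LinearMap.mul'_apply, map_mul, Matrix.mul_assoc,
        Matrix.trace_mul_comm, Matrix.mul_assoc]

/-- The evaluation of `V ⊗ V^*` is an intertwiner. -/
theorem linkRep₂_rev_comul (I : Lab) (i : L) (ξ : Gauge 𝒢)
    (Z : Matrix (Fin (ρ.dim I)) (Fin (ρ.dim I)) ℂ) :
    ∃ Z', (linkRep₂ Γ T (ρ := ρ) I I i (Γ.rev i) (gaugeComul 𝒢 ξ)).mulVec (pairVec Z 1)
        = pairVec Z' 1 ∧ Z'.trace = gaugeCounit 𝒢 ξ * Z.trace := by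
  let P : Subalgebra ℂ (Gauge 𝒢) :=
    { carrier := {ξ | ∀ Z : Matrix (Fin (ρ.dim I)) (Fin (ρ.dim I)) ℂ,
        ∃ Z', (linkRep₂ Γ T (ρ := ρ) I I i (Γ.rev i) (gaugeComul 𝒢 ξ)).mulVec (pairVec Z 1)
          = pairVec Z' 1 ∧ Z'.trace = gaugeCounit 𝒢 ξ * Z.trace}
      mul_mem' := by
        intro ξ ζ hξ hζ
        rw [Set.mem_ofPred_eq] at *
        intro Z
        obtain ⟨Z₁, h₁, h₁'⟩ := hζ Z
        obtain ⟨Z₂, h₂, h₂'⟩ := hξ Z₁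
        refine ⟨Z₂, ?_, ?_⟩
        · rw [map_mul, map_mul, ← Matrix.mulVec_mulVec, h₁, h₂]
        · rw [h₂', h₁', map_mul, mul_assoc]
      add_mem' := by
        intro ξ ζ hξ hζ
        rw [Set.mem_ofPred_eq] at *
        intro Z
        obtain ⟨Z₁, h₁, h₁'⟩ := hζ Z
        obtain ⟨Z₂, h₂, h₂'⟩ := hξ Z
        refine ⟨Z₂ + Z₁, ?_, ?_⟩
        · rw [map_add, map_add, Matrix.add_mulVec, pairVec_add_left, h₁, h₂]
        · rw [Matrix.trace_add, h₂', h₁', map_add, add_mul]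
      algebraMap_mem' := by
        intro c
        rw [Set.mem_ofPred_eq]
        intro Z
        refine ⟨c • Z, ?_, ?_⟩
        · simp only [Algebra.algebraMap_eq_smul_one, map_smul, map_one, Matrix.smul_mulVec,
            Matrix.one_mulVec, pairVec_smul_left]
        · rw [Matrix.trace_smul, AlgHom.commutes]
          rfl }
  refine mem_of_single_mem P (fun z a => ?_) ξ Z
  change ∀ Z : Matrix (Fin (ρ.dim I)) (Fin (ρ.dim I)) ℂ, ∃ Z',
    (linkRep₂ Γ T (ρ := ρ) I I i (Γ.rev i) (gaugeComul 𝒢 (single z a))).mulVec (pairVec Z 1)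
          = pairVec Z' 1 ∧ Z'.trace = gaugeCounit 𝒢 (single z a) * Z.trace
  intro Z
  rw [gaugeComul_single, gaugeCounit_single]
  by_cases h₁ : z = Γ.target i
  · subst h₁
    refine ⟨Coalgebra.counit (R := ℂ) a • Z, ?_, Matrix.trace_smul _ _⟩
    have h := linkRep₂_rev_target Γ T (ρ := ρ) I i Z 1 (Coalgebra.comul (R := ℂ) a)
    rw [map_one] at h
    rw [h, sandwich_comul, AlgHom.commutes, Algebra.algebraMap_eq_smul_one, pairVec_smul_right,
      pairVec_smul_left]
  · by_cases h₂ : z = Γ.source i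
    · subst h₂
      obtain ⟨Z', hZ, hZ'⟩ := linkRep₂_rev_source Γ T (ρ := ρ) I i Z 1 (Coalgebra.comul (R := ℂ) a)
      refine ⟨Z', hZ, ?_⟩
      rw [hZ', HopfAlgebra.mul_antipode_rTensor_comul_apply, AlgHom.commutes,
        Algebra.algebraMap_eq_smul_one, Matrix.mul_smul, Matrix.mul_one, Matrix.trace_smul]
      rfl
    · refine ⟨Coalgebra.counit (R := ℂ) a • Z, ?_, Matrix.trace_smul _ _⟩
      rw [linkRep₂_other Γ T I I h₁ h₂ (by rwa [target_rev]) (by rwa [source_rev]),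
        pairing_counit_comul, Matrix.smul_mulVec, Matrix.one_mulVec, pairVec_smul_left]

theorem sum_etaMat_mul_etaMat (I : Lab) (i : L) (a c : Fin (ρ.dim I))
    (q : (Fin (ρ.dim I) × Fin (ρ.dim I)) × (Fin (ρ.dim I) × Fin (ρ.dim I))) :
    ∑ b, (etaMat Γ T ρ I (Γ.rev i) ⊗ₖ etaMat Γ T ρ I i) q ((b, c), (a, b))
      = pairVec (Matrix.single a c 1 * vertexRep T ρ I (Γ.source i) (antipodeDrinfeld _))
        (vertexRep T ρ I (Γ.target i) (antipodeDrinfeld _)) q := by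
  rw [Finset.sum_eq_single q.1.2]
  · obtain ⟨⟨q₁, q₂⟩, q₃, q₄⟩ := q
    simp only [Matrix.kroneckerMap_apply, etaMat_apply, target_rev, pairVec, Matrix.one_apply_eq]
    by_cases h : q₄ = a
    · subst h
      simp only [Matrix.one_apply_eq, Matrix.single_mul_apply_same, one_mul, mul_one]
      rfl
    · simp [h, Matrix.single_mul_apply_of_ne]
  · intro b _ hb
    simp [etaMat_apply, Matrix.one_apply_ne hb.symm]
  · simp

/-- The two factors η put one w at each end of the link, and there they cancel R⁻¹: through
`sandwich_antipodeDrinfeld` at the target and, under the trace, through `antipodeDrinfeld_mul` at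
the source. -/
theorem linkRep₂_rev_gaugeR_inv (I : Lab) (i : L) (a c : Fin (ρ.dim I)) :
    ∃ Z : Matrix (Fin (ρ.dim I)) (Fin (ρ.dim I)) ℂ,
      (linkRep₂ Γ T (ρ := ρ) I I i (Γ.rev i) Rgi).mulVec
        (pairVec (Matrix.single a c 1 * vertexRep T ρ I (Γ.source i) (antipodeDrinfeld _))
          (vertexRep T ρ I (Γ.target i) (antipodeDrinfeld _))) = pairVec Z 1 ∧
      Z.trace = if a = c then 1 else 0 := by
  rw [map_gaugeR_inv_of_vertices _ (source_ne_target Γ i)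
    (fun z h₁ h₂ => linkRep₂_other_left Γ T I I _ h₂ h₁), ← Matrix.mulVec_mulVec,
    linkRep₂_rev_target, sandwich_antipodeDrinfeld, map_one]
  obtain ⟨Z, h, h'⟩ := linkRep₂_rev_source Γ T (ρ := ρ) I i
    (Matrix.single a c 1 * vertexRep T ρ I (Γ.source i) (antipodeDrinfeld _)) 1
    (((Rmat (𝒢 (Γ.source i)))⁻¹ : (𝒢 (Γ.source i) ⊗[ℂ] 𝒢 (Γ.source i))ˣ) :
      𝒢 (Γ.source i) ⊗[ℂ] 𝒢 (Γ.source i))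
  refine ⟨Z, h, ?_⟩
  rw [h', Matrix.mul_assoc, ← map_mul, antipodeDrinfeld_mul, map_one, Matrix.mul_one]
  by_cases hac : a = c
  · subst hac; simp
  · simp [hac, Matrix.trace_single_eq_of_ne]

variable [Fintype Lab] {Γ T} {ι : Gauge 𝒢 →ₐ[ℂ] B}
  {U : ∀ I, L → Fin (ρ.dim I) × Fin (ρ.dim I) → B}

/-- Contraction with `pairVec Z 1` is an evaluation, on which Δ(ξ) acts by ε(ξ) as far as traces are
concerned. For t = R⁻¹ the dressing therefore disappears, by (ε ⊗ id)(R⁻¹) = 1. -/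
theorem IsLatticeRep.sum_pairVec_dress (h : IsLatticeRep Γ T cg ι U) (I : Lab) (i : L)
    (Z : Matrix (Fin (ρ.dim I)) (Fin (ρ.dim I)) ℂ) (t : Gauge 𝒢 ⊗[ℂ] Gauge 𝒢) :
    ∑ q, pairVec Z 1 q • Matrix.vecMul (rowMul (U I i) (U I (Γ.rev i)))
        (dress ι ((linkRep₂ Γ T (ρ := ρ) I I i (Γ.rev i)).comp (gaugeComul 𝒢)) t) q
      = Z.trace • ι (slice (gaugeCounit 𝒢).toLinearMap t) := by
  induction t using TensorProduct.induction_on with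
  | zero => simp only [map_zero, Matrix.vecMul_zero, Pi.zero_apply, smul_zero,
      Finset.sum_const_zero]
  | add s t hs ht => simp only [map_add, Matrix.vecMul_add, Pi.add_apply, smul_add,
      Finset.sum_add_distrib, hs, ht]
  | tmul ξ ζ =>
    obtain ⟨Z', hZ, hZ'⟩ := linkRep₂_rev_comul Γ T (ρ := ρ) I i ξ Z
    have e := sum_pairVec_smul (h.inverse I i) Z'
    rw [hZ', ← hZ] at e
    have e' := congrArg (· * ι ζ) e
    simp only [Finset.sum_mul, ← Algebra.smul_def, Matrix.mulVec, dotProduct] at e'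
    rw [slice_tmul, map_smul, smul_smul, mul_comm Z.trace]
    refine Eq.trans ?_ e'
    simp only [Matrix.vecMul, dotProduct, dress_tmul, Finset.smul_sum, Finset.sum_smul,
      Finset.sum_mul, AlgHom.comp_apply]
    rw [Finset.sum_comm]
    refine Finset.sum_congr rfl fun p _ => Finset.sum_congr rfl fun q _ => ?_
    rw [mul_smul_comm, smul_smul, mul_comm, smul_mul_assoc]

theorem IsLatticeRep.starHol_inverse (h : IsLatticeRep Γ T cg ι U) (I : Lab) (i : L)
    (a c : Fin (ρ.dim I)) :
    ∑ b, starHol Γ T ι U I (Γ.rev i) (b, c) * starHol Γ T ι U I i (a, b)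
      = if a = c then 1 else 0 := by
  have e₁ : ∀ p, rowMul (starHol Γ T ι U I (Γ.rev i)) (starHol Γ T ι U I i) p
      = ∑ q, (etaMat Γ T ρ I (Γ.rev i) ⊗ₖ etaMat Γ T ρ I i) q p • ∑ r,
        linkRep₂ Γ T (ρ := ρ) I I i (Γ.rev i) Rgi r q •
          Matrix.vecMul (rowMul (U I i) (U I (Γ.rev i)))
          (dress ι ((linkRep₂ Γ T (ρ := ρ) I I i (Γ.rev i)).comp (gaugeComul 𝒢)) Rgi) r := by
    intro p
    rw [starHol, starHol, rowMul_vecMul_map, dressedHol, dressedHol, Γ.rev_rev,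
      rowMul_dress (h.covariance I (Γ.rev i)) isCocycle_gaugeR_inv, vecMul_map_apply]
    simp only [← Matrix.vecMul_vecMul, vecMul_map_apply]
  obtain ⟨Z, hZ, hZ'⟩ := linkRep₂_rev_gaugeR_inv Γ T (ρ := ρ) I i a c
  have e₂ := h.sum_pairVec_dress I i Z Rgi
  rw [counit_id_gaugeR_inv, map_one, hZ', ← hZ] at e₂
  calc _ = ∑ b, rowMul (starHol Γ T ι U I (Γ.rev i)) (starHol Γ T ι U I i) ((b, c), (a, b)) := rfl
    _ = (if a = c then (1 : ℂ) else 0) • (1 : B) := by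
      rw [← e₂]
      simp only [e₁]
      rw [Finset.sum_comm]
      simp only [← Finset.sum_smul, sum_etaMat_mul_etaMat]
      simp only [Matrix.mulVec, dotProduct, Finset.smul_sum, Finset.sum_smul, smul_smul]
      rw [Finset.sum_comm]
      refine Finset.sum_congr rfl fun r _ => Finset.sum_congr rfl fun q _ => ?_
      rw [mul_comm]
    _ = _ := by split_ifs <;> simp

end Inverse

/-! ### Semilinear maps out of a free algebra -/

section FreeAlgebra

/-- Homomorphisms of rings from a free algebra, semilinear with respect to a homomorphism from the
scalars to the centre. -/
theorem exists_freeAlgebra_ringHom {R X D : Type*} [CommRing R] [Ring D] (g : R →+* D)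
    (hg : ∀ c d, g c * d = d * g c) (f : X → D) : ∃ F : FreeAlgebra R X →+* D,
      (∀ c, F (algebraMap R _ c) = g c) ∧ ∀ x, F (FreeAlgebra.ι R x) = f x := by
  -- D is made an algebra through g, which turns a semilinear map into a linear one and lets the
  -- universal property apply. Below, g is complex conjugation followed by the scalars of ℬᵒᵖ.
  letI : Algebra R D := g.toAlgebra' hg
  refine ⟨(FreeAlgebra.lift R f : FreeAlgebra R X →ₐ[R] D).toRingHom, fun c => ?_, fun x => ?_⟩
  · exact (FreeAlgebra.lift R f : FreeAlgebra R X →ₐ[R] D).commutes c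
  · exact FreeAlgebra.lift_ι_apply f x

end FreeAlgebra

/-! ### Construction and uniqueness of θ -/

section Theta

variable {V L : Type*} [Fintype V] {𝒢 : V → Type*} [∀ x, Ring (𝒢 x)] [∀ x, HopfAlgebra ℂ (𝒢 x)]
  [∀ x, StarRing (𝒢 x)] [∀ x, StarModule ℂ (𝒢 x)] [∀ x, RibbonHopfStar (𝒢 x)]
  {H : Type*} [Ring H] [HopfAlgebra ℂ H] [StarRing H] [StarModule ℂ H] [RibbonHopfStar H]
  {Lab : Type*} [Fintype Lab] (Γ : CiliatedGraph V L) (T : ∀ x, TwistEquiv (𝒢 x) H)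
  {ρ : UnitaryIrreps H Lab} (cg : ClebschGordan ρ)

open MulOpposite

theorem isLatticeRep_hol : IsLatticeRep Γ T cg (ofGauge Γ T cg) (hol Γ T cg) where
  covariance I i := by
    intro ξ α
    have h := RingQuot.mkAlgHom_rel ℂ (Rel.covariance (Γ := Γ) (T := T) (cg := cg) ξ I i α)
    rw [map_mul, map_sum] at h
    simp only [map_mul] at h
    simp only [Matrix.vecMul, dotProduct, dress_apply]
    exact h
  functoriality I J i := by
    ext p
    have h := RingQuot.mkAlgHom_rel ℂ
      (Rel.functoriality (Γ := Γ) (T := T) (cg := cg) I J i p.1 p.2)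
    simp only [map_mul, map_sum, map_smul] at h
    simp only [Finset.sum_apply, vecMul_map_apply]
    exact h
  inverse I i a c := by
    have h := RingQuot.mkAlgHom_rel ℂ (Rel.inverse (Γ := Γ) (T := T) (cg := cg) I i a c)
    rw [map_sum, apply_ite (RingQuot.mkAlgHom ℂ (Rel Γ T cg)), map_one, map_zero] at h
    simp only [map_mul] at h
    exact h
  braid I J i j hij := by
    ext p
    have h := RingQuot.mkAlgHom_rel ℂ
      (Rel.braid (Γ := Γ) (T := T) (cg := cg) I J i j hij p.1 p.2)
    simp only [map_mul, map_sum, map_smul] at h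
    rw [vecMul_map_apply, Fintype.sum_prod_type, Finset.sum_comm]
    simp only [tensorRepHom_apply]
    exact h
  braid_self I J i := by
    ext p
    have h := RingQuot.mkAlgHom_rel ℂ
      (Rel.braid_self (Γ := Γ) (T := T) (cg := cg) I J i p.1.1 p.1.2 p.2.1 p.2.2)
    simp only [map_mul, map_sum, map_smul, tensorRep_eq] at h
    rw [vecMul_map_apply]
    simp only [Fintype.sum_prod_type]
    exact h

theorem starHol_eq (I : Lab) (i : L) (α : Fin (ρ.dim I) × Fin (ρ.dim I)) :
    starHol Γ T (ofGauge Γ T cg) (hol Γ T cg) I i α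
      = ∑ γ, ∑ β, linkEta Γ T ρ I i β α • (hol Γ T cg I (Γ.rev i) γ * ofGauge Γ T cg
        (slice (entry (linkRep Γ T ρ I (Γ.rev i)) γ β)
          (((gaugeR 𝒢)⁻¹ : (Gauge 𝒢 ⊗[ℂ] Gauge 𝒢)ˣ) : Gauge 𝒢 ⊗[ℂ] Gauge 𝒢))) := by
  rw [starHol, vecMul_map_apply, Finset.sum_comm]
  refine Finset.sum_congr rfl fun β _ => ?_
  simp only [dressedHol, Matrix.vecMul, dotProduct, dress_apply, Finset.smul_sum]
  rfl

/-- The images of the generators under the anti-homomorphism `θ`. -/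
def thetaGen : Gen (Gauge 𝒢) L Lab ρ.dim → (LatticeAlg Γ T cg)ᵐᵒᵖ
  | Gen.gauge ξ => op (ofGauge Γ T cg (piStar ξ))
  | Gen.hol I i α => op (starHol Γ T (ofGauge Γ T cg) (hol Γ T cg) I i α)

/-- Each relation, read in ℬᵒᵖ with conjugated coefficients, is one of the identities for `starHol`;
products appear in reverse order there, which is why those identities are stated with `flipRow` or
with the factors exchanged. -/
theorem thetaGen_rel {F : FreeLattice 𝒢 L ρ →+* (LatticeAlg Γ T cg)ᵐᵒᵖ}
    (hc : ∀ c, F (algebraMap ℂ _ c) = op (algebraMap ℂ _ (star c)))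
    (hF : ∀ x, F (FreeAlgebra.ι ℂ x) = thetaGen Γ T cg x) {x y : FreeLattice 𝒢 L ρ}
    (hxy : Rel Γ T cg x y) : F x = F y := by
  have h := isLatticeRep_hol Γ T cg
  have hξ : ∀ ξ, F (fξ ρ ξ) = op (ofGauge Γ T cg (piStar ξ)) := fun ξ => hF _
  have hU : ∀ I i α, F (fU 𝒢 ρ I i α)
      = op (starHol Γ T (ofGauge Γ T cg) (hol Γ T cg) I i α) := fun I i α => hF _
  have hs : ∀ (c : ℂ) x, F (c • x) = op (star c • unop (F x)) := by
    intro c x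
    rw [Algebra.smul_def, map_mul, hc, Algebra.smul_def, Algebra.commutes]
    rfl
  cases hxy with
  | gauge_scalar c => rw [hξ, hc, piStar_algebraMap, AlgHom.commutes]
  | gauge_add ξ ζ => rw [map_add, hξ, hξ, hξ, map_add, map_add, op_add]
  | gauge_mul ξ ζ => rw [map_mul, hξ, hξ, hξ, piStar_mul, map_mul, op_mul]
  | covariance ξ I i α =>
    simp only [map_mul, map_sum, hξ, hU, ← op_mul, ← Finset.op_sum]
    rw [h.starHol_mul_star]
  | functoriality I J i α β =>
    simp only [map_mul, map_sum, hs, hU, ← op_mul, ← Finset.op_sum, unop_op]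
    have e := congrFun (h.starHol_functoriality I J i) (β, α)
    rw [flipRow_apply] at e
    simp only [Finset.sum_apply, vecMul_map_apply] at e
    exact congrArg op e
  | inverse I i a c =>
    simp only [map_mul, map_sum, hU, ← op_mul, ← Finset.op_sum]
    rw [h.starHol_inverse, apply_ite F, map_one, map_zero, apply_ite op, op_one, op_zero]
  | braid I J i j hij α β =>
    simp only [map_mul, map_sum, hs, hU, ← op_mul, ← Finset.op_sum, unop_op]
    have e := congrFun (h.starHol_braid I J i j hij) (α, β)
    rw [vecMul_map_apply, Fintype.sum_prod_type, Finset.sum_comm] at e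
    simp only [RingHom.mapMatrix_apply, Matrix.map_apply, tensorRepHom_apply] at e
    exact congrArg op e
  | braid_self I J i a b c d =>
    simp only [map_mul, map_sum, hs, hU, ← op_mul, ← Finset.op_sum, unop_op, tensorRep_eq]
    have e := congrFun (h.starHol_braid_self I J i) ((a, b), (c, d))
    rw [vecMul_map_apply] at e
    simp only [Fintype.sum_prod_type] at e
    exact congrArg op e

theorem exists_theta : ∃ θ : LatticeAlg Γ T cg →+* (LatticeAlg Γ T cg)ᵐᵒᵖ, IsTheta Γ T cg θ := by
  obtain ⟨F, hc, hF⟩ := exists_freeAlgebra_ringHom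
    (((algebraMap ℂ (LatticeAlg Γ T cg)ᵐᵒᵖ)).comp (starRingEnd ℂ))
    (fun c d => Algebra.commutes ((starRingEnd ℂ) c) d) (thetaGen Γ T cg)
  let θ : LatticeAlg Γ T cg →+* (LatticeAlg Γ T cg)ᵐᵒᵖ :=
    RingQuot.lift ⟨F, fun _ _ hxy => thetaGen_rel Γ T cg hc hF hxy⟩
  have hθ : ∀ x, θ (RingQuot.mkAlgHom ℂ (Rel Γ T cg) x) = F x := by
    intro x
    have e : RingQuot.mkAlgHom ℂ (Rel Γ T cg) x = RingQuot.mkRingHom (Rel Γ T cg) x := by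
      rw [← RingQuot.mkAlgHom_coe ℂ]
      rfl
    rw [e]
    exact RingQuot.lift_mkRingHom_apply F _ x
  refine ⟨θ, fun ξ => ?_, fun I i α => ?_⟩
  · exact (hθ _).trans (hF _)
  · rw [← starHol_eq]
    exact (hθ _).trans (hF _)

variable {Γ T cg}

/-- Scalars of ℬ come from 𝒢, where θ is the star. Hence conjugate-linearity need not be assumed,
and uniqueness holds among all ring anti-homomorphisms. -/
theorem IsTheta.map_algebraMap {θ : LatticeAlg Γ T cg →+* (LatticeAlg Γ T cg)ᵐᵒᵖ}
    (h : IsTheta Γ T cg θ) (c : ℂ) :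
    θ (algebraMap ℂ _ c) = algebraMap ℂ _ ((starRingEnd ℂ) c) := by
  rw [← AlgHom.commutes (ofGauge Γ T cg), h.1, piStar_algebraMap, AlgHom.commutes]
  rfl

theorem IsTheta.map_smul {θ : LatticeAlg Γ T cg →+* (LatticeAlg Γ T cg)ᵐᵒᵖ}
    (h : IsTheta Γ T cg θ) (c : ℂ) (b : LatticeAlg Γ T cg) :
    θ (c • b) = (starRingEnd ℂ) c • θ b := by
  rw [Algebra.smul_def, map_mul, h.map_algebraMap, Algebra.smul_def]

theorem IsTheta.unique {θ θ' : LatticeAlg Γ T cg →+* (LatticeAlg Γ T cg)ᵐᵒᵖ}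
    (h : IsTheta Γ T cg θ) (h' : IsTheta Γ T cg θ') : θ' = θ := by
  have key : ∀ x : FreeLattice 𝒢 L ρ, θ' (RingQuot.mkAlgHom ℂ (Rel Γ T cg) x)
      = θ (RingQuot.mkAlgHom ℂ (Rel Γ T cg) x) := by
    intro x
    induction x using FreeAlgebra.induction with
    | grade0 c => rw [AlgHom.commutes, h.map_algebraMap, h'.map_algebraMap]
    | grade1 x =>
      cases x with
      | gauge ξ => exact (h'.1 ξ).trans (h.1 ξ).symm
      | hol I i α => exact (h'.2 I i α).trans (h.2 I i α).symm
    | mul x y hx hy => rw [map_mul, map_mul, map_mul, hx, hy]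
    | add x y hx hy => rw [map_add, map_add, map_add, hx, hy]
  refine RingHom.ext fun b => ?_
  obtain ⟨x, rfl⟩ := RingQuot.mkAlgHom_surjective ℂ (Rel Γ T cg) b
  rw [key]

end Theta

end LatticeCS

end

theorem mainTheorem2 {V L : Type*} [Fintype V] [Finite L]
    (Γ : LatticeCS.CiliatedGraph V L)
    {H : Type*} [Ring H] [HopfAlgebra ℂ H] [StarRing H] [StarModule ℂ H]
    [LatticeCS.RibbonHopfStar H] [IsSemisimpleRing H]
    {𝒢 : V → Type*} [∀ x, Ring (𝒢 x)] [∀ x, HopfAlgebra ℂ (𝒢 x)]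
    [∀ x, StarRing (𝒢 x)] [∀ x, StarModule ℂ (𝒢 x)] [∀ x, LatticeCS.RibbonHopfStar (𝒢 x)]
    (T : ∀ x, LatticeCS.TwistEquiv (𝒢 x) H)
    {Lab : Type*} [Fintype Lab] (ρ : LatticeCS.UnitaryIrreps H Lab)
    (cg : LatticeCS.ClebschGordan ρ) :
    ∃ θ : LatticeCS.LatticeAlg Γ T cg →+* (LatticeCS.LatticeAlg Γ T cg)ᵐᵒᵖ,
      (∀ (c : ℂ) (b : LatticeCS.LatticeAlg Γ T cg), θ (c • b) = (starRingEnd ℂ) c • θ b) ∧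
      LatticeCS.IsTheta Γ T cg θ ∧
      ∀ θ' : LatticeCS.LatticeAlg Γ T cg →+* (LatticeCS.LatticeAlg Γ T cg)ᵐᵒᵖ,
        LatticeCS.IsTheta Γ T cg θ' → θ' = θ := by
  obtain ⟨θ, hθ⟩ := LatticeCS.exists_theta Γ T cg
  exact ⟨θ, hθ.map_smul, hθ, fun θ' hθ' => hθ.unique hθ'⟩
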